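/- Let $n\ge 1$ be an integer and let $\alpha\in\left(\frac1n,\,1+\frac1n\right)$. Call $\Sigma\subset\mathbb R^{n+1}$ a closed, strictly convex, smooth hypersurface if $\Sigma$ is a smooth embedded hypersurface which is the boundary of a compact convex set with non-empty interior, and whose second fundamental form with respect to the interior unit normal $\vec n$ is positive definite everywhere (with the sign for which a round sphere has positive principal curvatures). Let $K>0$ denote the Gauss curvature of $\Sigma$, that is, the product of its principal curvatures. Then a closed, strictly convex, smooth hypersurface $\Sigma\subset\mathbb R^{n+1}$ with position vector $F$ satisfies the shrinker equation $$K^{\alpha}=-\langle F,\vec n\rangle\qquad\text{at every point of }\Sigma$$ if and only if $\Sigma$ is the unit sphere $\{x\in\mathbb R^{n+1}:|x|=1\}$ centred at the origin. (In particular, the unit sphere is a closed, strictly convex, smooth hypersurface that satisfies this equation.) -/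

import Mathlib

open scoped ContDiff

noncomputable section

namespace GaussShrinker

/-- Euclidean space `ℝ^d`. -/
abbrev Euc (d : ℕ) : Type := EuclideanSpace ℝ (Fin d)

/-- `φ`, restricted to the open set `V ⊆ ℝ^n`, is a smooth local parametrization of
`S ⊆ ℝ^(n+1)`: a smooth injective immersion of `V` which is a homeomorphism onto a relatively
open subset of `S`. -/
structure IsLocalParametrization {n : ℕ} (S : Set (Euc (n + 1))) (V : Set (Euc n))
    (φ : Euc n → Euc (n + 1)) : Prop where
  isOpen : IsOpen V
  smooth : ContDiffOn ℝ ∞ φ V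
  injOn : Set.InjOn φ V
  immersion : ∀ u ∈ V, Function.Injective (fderiv ℝ φ u)
  relOpen : ∀ W : Set (Euc n), W ⊆ V → IsOpen W →
    ∃ U : Set (Euc (n + 1)), IsOpen U ∧ φ '' W = S ∩ U

/-- `S` is a smooth embedded hypersurface (without boundary) of `ℝ^(n+1)`. -/
def IsSmoothHypersurface {n : ℕ} (S : Set (Euc (n + 1))) : Prop :=
  ∀ x ∈ S, ∃ (V : Set (Euc n)) (φ : Euc n → Euc (n + 1)),
    IsLocalParametrization S V φ ∧ x ∈ φ '' V

/-- The partial derivative `∂ᵢ φ`. -/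
def partialDeriv {n : ℕ} (φ : Euc n → Euc (n + 1)) (i : Fin n) (u : Euc n) : Euc (n + 1) :=
  fderiv ℝ φ u (EuclideanSpace.single i 1)

/-- The second partial derivative `∂ᵢ ∂ⱼ φ`. -/
def partialDeriv₂ {n : ℕ} (φ : Euc n → Euc (n + 1)) (i j : Fin n) (u : Euc n) : Euc (n + 1) :=
  fderiv ℝ (partialDeriv φ j) u (EuclideanSpace.single i 1)

/-- The metric `g_ij = ⟨∂ᵢφ, ∂ⱼφ⟩`. -/
def firstForm {n : ℕ} (φ : Euc n → Euc (n + 1)) (u : Euc n) : Matrix (Fin n) (Fin n) ℝ :=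
  Matrix.of fun i j => inner ℝ (partialDeriv φ i u) (partialDeriv φ j u)

/-- The second fundamental form `h_ij = ⟨∂ᵢ∂ⱼφ, N⟩` with respect to the unit normal `N`. -/
def secondForm {n : ℕ} (φ : Euc n → Euc (n + 1)) (u : Euc n) (N : Euc (n + 1)) :
    Matrix (Fin n) (Fin n) ℝ :=
  Matrix.of fun i j => inner ℝ (partialDeriv₂ φ i j u) N

/-- The Gauss curvature `K = det (h_ij) / det (g_ij)`, the product of the principal curvatures. -/
def gaussCurvature {n : ℕ} (φ : Euc n → Euc (n + 1)) (u : Euc n) (N : Euc (n + 1)) : ℝ :=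
  (secondForm φ u N).det / (firstForm φ u).det

/-- `N` is the interior unit normal, at the point `φ u`, of the convex hypersurface `S`
parametrized by `φ` near `φ u`: it has length one, is orthogonal to the tangent space, and `S`
lies on the side of the tangent hyperplane to which `N` points. -/
structure IsInteriorUnitNormal {n : ℕ} (S : Set (Euc (n + 1))) (φ : Euc n → Euc (n + 1))
    (u : Euc n) (N : Euc (n + 1)) : Prop where
  norm_eq_one : ‖N‖ = 1
  orthogonal : ∀ i : Fin n, inner ℝ (partialDeriv φ i u) N = 0
  inward : ∀ y ∈ S, 0 ≤ inner ℝ (y - φ u) N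

/-- `S` is a closed (compact, without boundary), strictly convex, smooth hypersurface of
`ℝ^(n+1)`: a smooth hypersurface which is the boundary of a compact convex set with non-empty
interior, and whose second fundamental form with respect to the interior unit normal is positive
definite everywhere. -/
structure IsClosedStrictlyConvexHypersurface {n : ℕ} (S : Set (Euc (n + 1))) : Prop where
  smooth : IsSmoothHypersurface S
  convex : ∃ C : Set (Euc (n + 1)),
    Convex ℝ C ∧ IsCompact C ∧ (interior C).Nonempty ∧ frontier C = S
  posDef : ∀ (V : Set (Euc n)) (φ : Euc n → Euc (n + 1)), IsLocalParametrization S V φ →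
    ∀ u ∈ V, ∀ N : Euc (n + 1), IsInteriorUnitNormal S φ u N → (secondForm φ u N).PosDef

/-- The shrinker equation `K^α = -⟨F, n⟩` at every point of the convex hypersurface `S`, where
`F` is the position vector and `n` the interior unit normal. -/
def SatisfiesShrinkerEquation {n : ℕ} (α : ℝ) (S : Set (Euc (n + 1))) : Prop :=
  ∀ (V : Set (Euc n)) (φ : Euc n → Euc (n + 1)), IsLocalParametrization S V φ →
    ∀ u ∈ V, ∀ N : Euc (n + 1), IsInteriorUnitNormal S φ u N →
      gaussCurvature φ u N ^ α = -inner ℝ (φ u) N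

end GaussShrinker

end

/-! Put `β = 1 / α` and describe the hypersurface by its support function `H`, extended to `ℝ^(n+1)`
as a positively homogeneous function of degree one. Then `DH` is the support point, the eigenvalues
of `D²H` on the tangent space at a unit vector are the principal radii of curvature, and the
shrinker equation says that their product is `H ^ (-β)`. This translation is
`SatisfiesShrinkerEquation.isShrinkerSupport`; support points are unique and depend smoothly on the
direction because the second fundamental form is definite. What remains is
`IsShrinkerSupport.eq_one`: `H = 1` on the unit sphere. The sphere is then recovered by
`eq_sphere_of_supportFunction`.

For `n ≥ 2` the proof is a maximum principle for `H D²H(e, e) - (g / 2) |DH|²` over unit tangent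
vectors `e`, where `g = 1 - β / n` lies in `(0, 1)` because `α > 1 / n`. At a maximum, in an
eigenframe with radii `τ i` and tangential derivatives `p i` of `H`, the second order conditions are
summed with weights `1 / τ i` and combined with the once and twice differentiated equation. The
outcome is `∑ (1 - g) (p i)² / H ≤ g (∑ τ i - n max τ) ≤ 0`, so the tangential gradient of `H`
vanishes there. The largest radius need not be a smooth function, so the conditions are read off
from explicit test directions along lines (`IsShrinkerSupport.maximum_point_inequality`,
`maximum_point_algebra`).

To pass from one point to all, the same computation is run with a perturbation `B` added. A steep
exponential barrier and a Hopf type argument show that the maximum is attained over every point of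
the sphere (`IsShrinkerSupport.forall_exists_isMaxOn`). Hence `DH` is radial everywhere and `H` is a
constant `c` on the sphere; the equation reads `c ^ n = c ^ (-β)`, so `c = 1`.

For `n = 1` this argument loses its gradient term, and the equation becomes `h'' + h = h ^ (-β)` on
the circle. Reflections in critical points give `h` a period in `(0, 2π)`, so `h` times the position
vector has mean zero. Wirtinger's inequality for this function yields `(3 - β) ∫ h ^ (1 - β) h'² ≤
0`, hence `h' = 0`.

Conversely, on the unit sphere the interior normal is minus the position vector, and differentiating
the orthogonality of tangent and position vectors shows that the two fundamental forms agree, so `K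
= 1`. -/

noncomputable section

namespace GaussShrinker

open Filter Topology

/-! ### Calculus of 2-jets of functions of one real variable. -/

/-- `f` is differentiable near `0`, twice differentiable at `0`, with 2-jet `(a, b, c)` there. -/
def HasJet (f : ℝ → ℝ) (a b c : ℝ) : Prop :=
  f 0 = a ∧ ∃ f' : ℝ → ℝ, (∀ᶠ s in 𝓝 0, HasDerivAt f (f' s) s) ∧ f' 0 = b ∧ HasDerivAt f' c 0

namespace HasJet

variable {f g : ℝ → ℝ} {a b c a' b' c' : ℝ}

theorem congr_jet (h : HasJet f a b c) (ha : a = a') (hb : b = b') (hc : c = c') :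
    HasJet f a' b' c' := by subst ha hb hc; exact h

theorem const (a : ℝ) : HasJet (fun _ => a) a 0 0 :=
  ⟨rfl, fun _ => 0, Eventually.of_forall fun s => hasDerivAt_const s a, rfl, hasDerivAt_const 0 0⟩

theorem id : HasJet (fun s => s) 0 1 0 :=
  ⟨rfl, fun _ => 1, Eventually.of_forall fun s => hasDerivAt_id s, rfl, hasDerivAt_const 0 1⟩

theorem continuousAt (h : HasJet f a b c) : ContinuousAt f 0 := by
  obtain ⟨-, f', h1, -, -⟩ := h
  exact h1.self_of_nhds.continuousAt

theorem add (hf : HasJet f a b c) (hg : HasJet g a' b' c') :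
    HasJet (fun s => f s + g s) (a + a') (b + b') (c + c') := by
  obtain ⟨h0, f', h1, h2, h3⟩ := hf
  obtain ⟨k0, g', k1, k2, k3⟩ := hg
  refine ⟨by simp [h0, k0], fun s => f' s + g' s, ?_, by simp [h2, k2], h3.add k3⟩
  filter_upwards [h1, k1] with s hs ks using hs.add ks

theorem mul (hf : HasJet f a b c) (hg : HasJet g a' b' c') :
    HasJet (fun s => f s * g s) (a * a') (b * a' + a * b') (c * a' + 2 * b * b' + a * c') := by
  obtain ⟨h0, f', h1, h2, h3⟩ := hf
  obtain ⟨k0, g', k1, k2, k3⟩ := hg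
  refine ⟨by simp [h0, k0], fun s => f' s * g s + f s * g' s, ?_, by simp [h0, k0, h2, k2], ?_⟩
  · filter_upwards [h1, k1] with s hs ks using hs.mul ks
  · have := (h3.mul k1.self_of_nhds).add (h1.self_of_nhds.mul k3)
    refine this.congr_deriv ?_
    rw [h0, k0, h2, k2]; ring

theorem const_mul (r : ℝ) (hf : HasJet f a b c) :
    HasJet (fun s => r * f s) (r * a) (r * b) (r * c) :=
  ((const r).mul hf).congr_jet (by ring) (by ring) (by ring)

theorem neg (hf : HasJet f a b c) : HasJet (fun s => -f s) (-a) (-b) (-c) := by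
  simpa using hf.const_mul (-1)

theorem sub (hf : HasJet f a b c) (hg : HasJet g a' b' c') :
    HasJet (fun s => f s - g s) (a - a') (b - b') (c - c') := by
  simpa [sub_eq_add_neg] using hf.add hg.neg

theorem sq (hf : HasJet f a b c) :
    HasJet (fun s => f s ^ 2) (a ^ 2) (2 * a * b) (2 * b ^ 2 + 2 * a * c) := by
  simpa [pow_two] using (hf.mul hf).congr_jet (by ring) (by ring) (by ring)

theorem sum {ι : Type*} (t : Finset ι) {f : ι → ℝ → ℝ} {a b c : ι → ℝ}
    (h : ∀ i ∈ t, HasJet (f i) (a i) (b i) (c i)) :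
    HasJet (fun s => ∑ i ∈ t, f i s) (∑ i ∈ t, a i) (∑ i ∈ t, b i) (∑ i ∈ t, c i) := by
  classical
  induction t using Finset.induction_on with
  | empty => simpa using const 0
  | insert i t hi ih =>
    simp only [Finset.sum_insert hi]
    exact (h i (by simp)).add (ih fun j hj => h j (by simp [hj]))

theorem unique (hf : HasJet f a b c) (hg : HasJet f a' b' c') : a = a' ∧ b = b' ∧ c = c' := by
  obtain ⟨h0, f', h1, h2, h3⟩ := hf
  obtain ⟨k0, g', k1, k2, k3⟩ := hg
  have e : f' =ᶠ[𝓝 0] g' := by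
    filter_upwards [h1, k1] with s hs ks using hs.unique ks
  refine ⟨h0 ▸ k0, ?_, ?_⟩
  · rw [← h2, ← k2, e.self_of_nhds]
  · exact h3.unique (k3.congr_of_eventuallyEq e)

theorem comp {φ φ' : ℝ → ℝ} {φ₂ : ℝ} (hf : HasJet f a b c)
    (h1 : ∀ᶠ t in 𝓝 a, HasDerivAt φ (φ' t) t) (h2 : HasDerivAt φ' φ₂ a) :
    HasJet (fun s => φ (f s)) (φ a) (φ' a * b) (φ₂ * b ^ 2 + φ' a * c) := by
  have hc := hf.continuousAt
  obtain ⟨h0, f', k1, k2, k3⟩ := hf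
  subst h0
  refine ⟨rfl, fun s => φ' (f s) * f' s, ?_, by simp [k2], ?_⟩
  · filter_upwards [k1, hc.eventually h1] with s hs ks using ks.comp s hs
  · refine ((h2.comp 0 k1.self_of_nhds).mul k3).congr_deriv ?_
    simp only [Function.comp]
    rw [k2]; ring

theorem exp (hf : HasJet f a b c) :
    HasJet (fun s => Real.exp (f s)) (Real.exp a) (Real.exp a * b)
      (Real.exp a * b ^ 2 + Real.exp a * c) :=
  hf.comp (Eventually.of_forall Real.hasDerivAt_exp) (Real.hasDerivAt_exp a)

theorem rpow (hf : HasJet f a b c) (ha : 0 < a) (r : ℝ) :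
    HasJet (fun s => f s ^ r) (a ^ r) (a ^ r * (r * (b / a)))
      (a ^ r * (r * (r - 1) * (b / a) ^ 2 + r * (c / a))) := by
  have h1 : ∀ᶠ t in 𝓝 a, HasDerivAt (fun t : ℝ => t ^ r) (r * t ^ (r - 1)) t := by
    filter_upwards [eventually_gt_nhds ha] with t ht
    exact Real.hasDerivAt_rpow_const (Or.inl ht.ne')
  have h2 : HasDerivAt (fun t : ℝ => r * t ^ (r - 1)) (r * ((r - 1) * a ^ (r - 1 - 1))) a :=
    (Real.hasDerivAt_rpow_const (Or.inl ha.ne')).const_mul r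
  refine (hf.comp h1 h2).congr_jet rfl ?_ ?_
  · rw [Real.rpow_sub_one ha.ne']; ring
  · rw [Real.rpow_sub_one ha.ne', Real.rpow_sub_one ha.ne']; field_simp

/-- Necessary first and second order conditions at a local minimum. -/
theorem of_isLocalMin (hf : HasJet f a b c) (h : IsLocalMin f 0) : b = 0 ∧ 0 ≤ c := by
  have hc := hf.continuousAt
  obtain ⟨h0, f', h1, h2, h3⟩ := hf
  have hb : b = 0 := h2 ▸ h.hasDerivAt_eq_zero h1.self_of_nhds
  refine ⟨hb, ?_⟩
  by_contra! hneg
  have hd : deriv f =ᶠ[𝓝 0] f' := by filter_upwards [h1] with s hs using hs.deriv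
  have hdd : deriv (deriv f) 0 = c := by rw [hd.deriv_eq]; exact h3.deriv
  -- A negative second derivative makes `0` a local maximum as well, so `f` is locally constant and
  -- the second derivative is zero after all.
  have hmax : IsLocalMax f 0 := isLocalMax_of_deriv_deriv_neg (by rw [hdd]; exact hneg)
    (by rw [hd.self_of_nhds, h2, hb]) hc
  have hconst : f =ᶠ[𝓝 0] fun _ => f 0 := by
    filter_upwards [h, hmax] with s hs ks using le_antisymm ks hs
  have : deriv f =ᶠ[𝓝 0] fun _ => 0 := by simpa using hconst.deriv
  have h0' : deriv (deriv f) 0 = 0 := by simpa using this.deriv_eq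
  rw [h0'] at hdd
  exact hneg.ne hdd.symm

end HasJet

/-! ### Derivatives of determinants. -/

section Det

variable {ι : Type*} [Fintype ι] [DecidableEq ι]

/-- Jacobi's formula: by multilinearity the columns are differentiated one at a time, and Cramer's
rule collects the resulting determinants into the adjugate. -/
theorem hasDerivAt_det {M : ℝ → Matrix ι ι ℝ} {M' : Matrix ι ι ℝ} {s : ℝ}
    (h : ∀ i j, HasDerivAt (fun t => M t i j) (M' i j) s) :
    HasDerivAt (fun t => (M t).det) (∑ i, ∑ k, (M s).adjugate i k * M' k i) s := by
  have h1 : HasDerivAt (fun t => (M t).det)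
      (∑ i, ((M s).updateCol i fun k => M' k i).det) s := by
    simp only [Matrix.det_apply]
    have : ∀ σ ∈ (Finset.univ : Finset (Equiv.Perm ι)),
        HasDerivAt (fun t => Equiv.Perm.sign σ • ∏ i, M t (σ i) i)
        (Equiv.Perm.sign σ • ∑ i, (∏ j ∈ Finset.univ.erase i, M s (σ j) j) • M' (σ i) i) s :=
      fun σ _ => (HasDerivAt.fun_finsetProd fun i _ => h (σ i) i).const_smul _
    refine (HasDerivAt.fun_sum this).congr_deriv ?_
    rw [Finset.sum_comm]
    refine Finset.sum_congr rfl fun σ _ => ?_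
    rw [Finset.smul_sum]
    refine Finset.sum_congr rfl fun i _ => ?_
    congr 1
    rw [← Finset.mul_prod_erase _ _ (Finset.mem_univ i), smul_eq_mul, mul_comm]
    congr 1
    · simp
    · refine Finset.prod_congr rfl fun j hj => ?_
      rw [Matrix.updateCol_ne (Finset.ne_of_mem_erase hj)]
  refine h1.congr_deriv (Finset.sum_congr rfl fun i _ => ?_)
  rw [← Matrix.cramer_apply, Matrix.cramer_eq_adjugate_mulVec]
  rfl

/-- The 2-jet of a determinant at an invertible diagonal matrix. -/
theorem HasJet.det {M : ℝ → Matrix ι ι ℝ} {τ : ι → ℝ} {M₁ M₂ : ι → ι → ℝ} (hτ : ∀ i, τ i ≠ 0)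
    (h : ∀ i j, HasJet (fun s => M s i j) (if i = j then τ i else 0) (M₁ i j) (M₂ i j)) :
    HasJet (fun s => (M s).det) (∏ i, τ i) ((∏ i, τ i) * ∑ i, M₁ i i / τ i)
      ((∏ i, τ i) * ((∑ i, M₁ i i / τ i) ^ 2 + ∑ i, M₂ i i / τ i
        - ∑ i, ∑ k, M₁ i k * M₁ k i / (τ i * τ k))) := by
  choose h0 M' h1 h2 h3 using h
  have hM0 : M 0 = Matrix.diagonal τ := by
    ext i j; rw [Matrix.diagonal_apply]; exact h0 i j
  have hd0 : (M 0).det = ∏ i, τ i := by rw [hM0, Matrix.det_diagonal]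
  set P := ∏ i, τ i
  have hP : P ≠ 0 := Finset.prod_ne_zero_iff.2 fun i _ => hτ i
  have hdiff : ∀ᶠ s in 𝓝 (0 : ℝ), ∀ i j, HasDerivAt (fun s => M s i j) (M' i j s) s := by
    simp only [eventually_all]; exact h1
  have hadj : ∀ i k, ∃ A', HasDerivAt (fun s => (M s).adjugate i k) A' 0 := by
    intro i k
    simp only [Matrix.adjugate_apply]
    refine ⟨_, hasDerivAt_det (M' := fun a b => if a = k then 0 else M' a b 0) fun a b => ?_⟩
    by_cases hak : a = k
    · subst hak; simpa using hasDerivAt_const _ _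
    · simpa [Matrix.updateRow_ne hak, hak] using hdiff.self_of_nhds a b
  choose A' hA' using hadj
  have hA0 : ∀ i k, (M 0).adjugate i k = if i = k then P / τ i else 0 := by
    have h1 : M 0 * Matrix.diagonal (fun i => P / τ i) = (M 0).det • (1 : Matrix ι ι ℝ) := by
      rw [hd0, hM0, Matrix.diagonal_mul_diagonal]
      ext i j
      simp only [Matrix.diagonal_apply, Matrix.smul_apply, Matrix.one_apply, smul_eq_mul]
      split_ifs with hij
      · have := hτ i; field_simp
      · simp
    have h2 : (M 0).adjugate = Matrix.diagonal (fun i => P / τ i) := by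
      have h3 := congrArg (fun Z => (M 0).adjugate * Z) h1
      simp only [← Matrix.mul_assoc, Matrix.adjugate_mul, Matrix.smul_mul, Matrix.one_mul,
        Matrix.mul_smul, Matrix.mul_one] at h3
      exact (smul_right_injective _ (hd0 ▸ hP : (M 0).det ≠ 0) h3).symm
    intro i k
    rw [h2, Matrix.diagonal_apply]
  have hF1 : ∑ i, ∑ k, (M 0).adjugate i k * M' k i 0 = P * ∑ i, M₁ i i / τ i := by
    rw [Finset.mul_sum]
    refine Finset.sum_congr rfl fun i _ => ?_
    simp only [hA0, h2]
    simp; ring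
  -- The derivative of the adjugate is obtained by differentiating `M * adj M = det M • 1` at `0`,
  -- where `M` is diagonal and invertible.
  have hrel : ∀ i k, A' i k
      = ((if i = k then P * ∑ i, M₁ i i / τ i else 0) - M₁ i k * (P / τ k)) / τ i := by
    intro i k
    have e1 : HasDerivAt (fun s => ∑ j, M s i j * (M s).adjugate j k)
        (∑ j, (M' i j 0 * (M 0).adjugate j k + M 0 i j * A' j k)) 0 :=
      HasDerivAt.fun_sum fun j _ => (hdiff.self_of_nhds i j).mul (hA' j k)
    have e2 : HasDerivAt (fun s => ∑ j, M s i j * (M s).adjugate j k)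
        (if i = k then P * ∑ i, M₁ i i / τ i else 0) 0 := by
      have hfun : (fun s => ∑ j, M s i j * (M s).adjugate j k)
          = fun s => (M s).det * if i = k then 1 else 0 := by
        funext s
        rw [← Matrix.mul_apply, Matrix.mul_adjugate, Matrix.smul_apply, Matrix.one_apply,
          smul_eq_mul]
      rw [hfun]
      refine ((hasDerivAt_det hdiff.self_of_nhds).mul_const _).congr_deriv ?_
      rw [hF1]; split_ifs <;> simp
    have e3 := e1.unique e2
    rw [← e3, Finset.sum_add_distrib]
    have : ∑ j, M' i j 0 * (M 0).adjugate j k = M₁ i k * (P / τ k) := by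
      simp only [hA0, h2]; simp
    rw [this]
    have : ∑ j, M 0 i j * A' j k = τ i * A' i k := by
      rw [hM0]; simp [Matrix.diagonal_apply]
    rw [this]
    have := hτ i
    field_simp; ring
  refine ⟨hd0, fun s => ∑ i, ∑ k, (M s).adjugate i k * M' k i s, ?_, hF1, ?_⟩
  · filter_upwards [hdiff] with s hs using hasDerivAt_det hs
  · have := HasDerivAt.fun_sum (u := Finset.univ) fun i _ =>
      HasDerivAt.fun_sum (u := Finset.univ) fun k _ => (hA' i k).mul (h3 k i)
    refine this.congr_deriv ?_
    simp only [h2, hA0, hrel]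
    have : ∀ i, ∑ k, (((if i = k then P * ∑ i, M₁ i i / τ i else 0) - M₁ i k * (P / τ k)) / τ i
          * M₁ k i + (if i = k then P / τ i else 0) * M₂ k i)
        = P * ((∑ i, M₁ i i / τ i) * (M₁ i i / τ i) + M₂ i i / τ i
          - ∑ k, M₁ i k * M₁ k i / (τ i * τ k)) := by
      intro i
      have e : ∀ k, (((if i = k then P * ∑ i, M₁ i i / τ i else 0) - M₁ i k * (P / τ k)) / τ i
          * M₁ k i + (if i = k then P / τ i else 0) * M₂ k i)
          = (if i = k then P * (∑ i, M₁ i i / τ i) / τ i * M₁ k i + P / τ i * M₂ k i else 0)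
            - P * (M₁ i k * M₁ k i / (τ i * τ k)) := by
        intro k
        have := hτ i
        have := hτ k
        split_ifs <;> (field_simp; try ring)
      simp only [e]
      rw [Finset.sum_sub_distrib, ← Finset.mul_sum]
      simp; ring
    simp only [this]
    rw [← Finset.mul_sum, Finset.sum_sub_distrib, Finset.sum_add_distrib, ← Finset.mul_sum, pow_two]

end Det

/-! ### Directional derivatives and homogeneous functions. -/

section DirDeriv

variable {E : Type*} [NormedAddCommGroup E] [NormedSpace ℝ E]

/-- The directional derivative, as an operator on functions. -/
def dirDeriv (v : E) (f : E → ℝ) (x : E) : ℝ := fderiv ℝ f x v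

/-- `f` is smooth away from the origin. -/
def SmoothOff (f : E → ℝ) : Prop := ∀ x, x ≠ 0 → ContDiffAt ℝ ∞ f x

variable {f : E → ℝ}

theorem SmoothOff.dirDeriv (hf : SmoothOff f) (v : E) : SmoothOff (dirDeriv v f) := fun x hx =>
  ((hf x hx).fderiv_right (m := ∞) (by simp)).clm_apply contDiffAt_const

theorem SmoothOff.differentiableAt (hf : SmoothOff f) {x : E} (hx : x ≠ 0) :
    DifferentiableAt ℝ f x := (hf x hx).differentiableAt (by simp)

theorem SmoothOff.dirDeriv_dirDeriv (hf : SmoothOff f) (v w : E) {x : E} (hx : x ≠ 0) :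
    GaussShrinker.dirDeriv v (GaussShrinker.dirDeriv w f) x = fderiv ℝ (fderiv ℝ f) x v w := by
  have h : DifferentiableAt ℝ (fderiv ℝ f) x :=
    ((hf x hx).fderiv_right (m := ∞) (by simp)).differentiableAt (by simp)
  unfold GaussShrinker.dirDeriv
  rw [fderiv_clm_apply h (differentiableAt_const w)]
  simp

theorem SmoothOff.dirDeriv_comm (hf : SmoothOff f) (v w : E) {x : E} (hx : x ≠ 0) :
    GaussShrinker.dirDeriv v (GaussShrinker.dirDeriv w f) x
      = GaussShrinker.dirDeriv w (GaussShrinker.dirDeriv v f) x := by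
  rw [hf.dirDeriv_dirDeriv v w hx, hf.dirDeriv_dirDeriv w v hx]
  exact ((hf x hx).isSymmSndFDerivAt (by simp; exact ENat.LEInfty.out)).eq v w

theorem SmoothOff.hasDerivAt_line (hf : SmoothOff f) {x v : E} {s : ℝ} (h : x + s • v ≠ 0) :
    HasDerivAt (fun t : ℝ => f (x + t • v)) (GaussShrinker.dirDeriv v f (x + s • v)) s := by
  have h1 := (hf.differentiableAt h).hasFDerivAt
  have h2 : HasDerivAt (fun t : ℝ => x + t • v) v s := by
    simpa using ((hasDerivAt_id s).smul_const v).const_add x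
  exact h1.comp_hasDerivAt s h2

theorem SmoothOff.hasJet_line (hf : SmoothOff f) {x : E} (hx : x ≠ 0) (v : E) :
    HasJet (fun t : ℝ => f (x + t • v)) (f x) (GaussShrinker.dirDeriv v f x)
      (GaussShrinker.dirDeriv v (GaussShrinker.dirDeriv v f) x) := by
  have hc : ContinuousAt (fun t : ℝ => x + t • v) 0 := by fun_prop
  have hne : ∀ᶠ s : ℝ in 𝓝 0, x + s • v ≠ 0 := hc.eventually_ne (by simpa using hx)
  refine ⟨by simp, fun s => GaussShrinker.dirDeriv v f (x + s • v), ?_, by simp, ?_⟩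
  · filter_upwards [hne] with s hs using hf.hasDerivAt_line hs
  · simpa using (hf.dirDeriv v).hasDerivAt_line (s := 0) (by simpa using hx)

/-- `f` is positively homogeneous of integer degree `m`. -/
def Homog (m : ℤ) (f : E → ℝ) : Prop := ∀ c : ℝ, 0 < c → ∀ x, x ≠ 0 → f (c • x) = c ^ m * f x

theorem Homog.dirDeriv {m : ℤ} (hf : Homog m f) (hs : SmoothOff f) (v : E) :
    Homog (m - 1) (dirDeriv v f) := by
  intro c hc x hx
  have hcx : c • x ≠ 0 := smul_ne_zero hc.ne' hx
  have h1 : HasFDerivAt (fun y => f (c • y)) ((fderiv ℝ f (c • x)).comp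
      (c • ContinuousLinearMap.id ℝ E)) x :=
    (hs.differentiableAt hcx).hasFDerivAt.comp x ((hasFDerivAt_id x).const_smul c)
  have h2 : HasFDerivAt (fun y => f (c • y)) (c ^ m • fderiv ℝ f x) x := by
    refine ((hs.differentiableAt hx).hasFDerivAt.const_smul (c ^ m)).congr_of_eventuallyEq ?_
    filter_upwards [isOpen_ne.mem_nhds hx] with y hy
    simpa using hf c hc y hy
  have h3 := DFunLike.congr_fun (h1.unique h2) v
  simp only [ContinuousLinearMap.comp_apply, _root_.smul_apply,
    ContinuousLinearMap.id_apply, map_smul, smul_eq_mul] at h3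
  unfold GaussShrinker.dirDeriv
  rw [zpow_sub_one₀ hc.ne']
  field_simp
  linarith

/-- Euler's relation, from differentiating `f ((1 + t) • x) = (1 + t) ^ m * f x` at `t = 0`. -/
theorem Homog.dirDeriv_self {m : ℤ} (hf : Homog m f) (hs : SmoothOff f) {x : E} (hx : x ≠ 0) :
    GaussShrinker.dirDeriv x f x = m * f x := by
  have h1 : HasDerivAt (fun t : ℝ => f (x + t • x)) (GaussShrinker.dirDeriv x f x) 0 := by
    simpa using hs.hasDerivAt_line (x := x) (v := x) (s := 0) (by simpa using hx)
  have h2 : HasDerivAt (fun t : ℝ => (1 + t) ^ m * f x) (m * f x) 0 := by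
    have := ((hasDerivAt_zpow m (1 + 0 : ℝ) (by simp)).comp 0
      ((hasDerivAt_id (0 : ℝ)).const_add 1)).mul_const (f x)
    simpa [Function.comp_def] using this
  refine h1.unique (h2.congr_of_eventuallyEq ?_)
  filter_upwards [eventually_gt_nhds (show (-1 : ℝ) < 0 by norm_num)] with t ht
  have := hf (1 + t) (by linarith) x hx
  rwa [add_smul, one_smul] at this

end DirDeriv

/-! ### Algebra at a maximum point. -/

/-- The contribution of the direction of the largest radius. The first order condition `h1`
eliminates the third derivative `T`; the coefficient of `p ^ 2` is then `(n - 1) (1 - g) (1 + g)`,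
which is at least `1 - g` exactly because `n ≥ 2`. -/
theorem maxTerm_lower_bound {n : ℕ} (hn : 2 ≤ n) {u g β τ p T b : ℝ} (hu : 0 < u) (hτ : 0 < τ)
    (hg0 : 0 < g) (hg1 : g < 1) (hβ : β = n * (1 - g))
    (h1 : g * (τ * p) - b - (p * τ + u * T) = 0) :
    ((1 - g) * p ^ 2 - 6 * |p * b| / τ) / u
      ≤ β * (1 + g) * p ^ 2 / u + u * (T ^ 2 / (τ * τ)) + 2 * p * T / τ := by
  have hn' : (2 : ℝ) ≤ n := by exact_mod_cast hn
  have hT : T = -(p * (τ - g * τ) + b) / u := by field_simp; linarith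
  have e : β * (1 + g) * p ^ 2 / u + u * (T ^ 2 / (τ * τ)) + 2 * p * T / τ
      = ((n - 1) * (1 - g) * (1 + g) * p ^ 2 + b ^ 2 / τ ^ 2 - 2 * g * (p * b) / τ) / u := by
    rw [hT, hβ]; field_simp; ring
  rw [e]
  have h2 : 2 * g * (p * b) / τ ≤ 6 * |p * b| / τ := by
    gcongr ?_ / _
    nlinarith [le_abs_self (p * b), abs_nonneg (p * b)]
  have h3 : (1 - g) * p ^ 2 ≤ (n - 1) * (1 - g) * (1 + g) * p ^ 2 := by
    have : 1 ≤ ((n : ℝ) - 1) * (1 + g) := by nlinarith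
    nlinarith [mul_nonneg (sub_nonneg.2 hg1.le) (sq_nonneg p)]
  have h4 : 0 ≤ b ^ 2 / τ ^ 2 := by positivity
  gcongr ?_ / _
  linarith

/-- The contribution of any other direction, with radius `τ ≤ τ₀`. The last summand comes from
rotating the test direction. Without it the coefficient of `p ^ 2` can be negative; with it, the
coefficient is `1 - g` times a number that is at least `2`. -/
theorem crossTerm_lower_bound {n : ℕ} {u g β τ₀ τ p T b : ℝ} (hu : 0 < u)
    (hτ : 0 < τ) (hle : τ ≤ τ₀) (hg0 : 0 < g) (hg1 : g < 1) (hβ : β = n * (1 - g))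
    (h1 : g * (τ * p) - b - (p * τ₀ + u * T) = 0) :
    ((1 - g) * p ^ 2 - 6 * |p * b| / τ) / u
      ≤ β * g * p ^ 2 / u + u * (2 * T ^ 2 / (τ₀ * τ)) + 2 * p * T / τ
        + (u / τ₀) * (4 * -(p / u) * T + 2 * (p / u) ^ 2 * (τ - τ₀)) := by
  have hτ₀ : 0 < τ₀ := hτ.trans_le hle
  have hT : T = -(p * (τ₀ - g * τ) + b) / u := by field_simp; linarith
  have e : β * g * p ^ 2 / u + u * (2 * T ^ 2 / (τ₀ * τ)) + 2 * p * T / τ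
        + (u / τ₀) * (4 * -(p / u) * T + 2 * (p / u) ^ 2 * (τ - τ₀))
      = ((1 - g) * (2 + 2 * (τ / τ₀) * (1 - g) + g * n) * p ^ 2 + 2 * b ^ 2 / (τ₀ * τ)
        + (2 / τ + 4 * (1 - g) / τ₀) * (p * b)) / u := by
    rw [hT, hβ]; field_simp; ring
  rw [e]
  -- The constant `6` is `2 + 4`: the factor of `p * b` is at most `2 / τ + 4 / τ₀`, and `τ ≤ τ₀`.
  have h2 : -(6 * |p * b| / τ) ≤ (2 / τ + 4 * (1 - g) / τ₀) * (p * b) := by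
    have k : 2 / τ + 4 * (1 - g) / τ₀ ≤ 6 / τ := by
      have : 4 * (1 - g) / τ₀ ≤ 4 / τ := by gcongr; linarith
      calc _ ≤ 2 / τ + 4 / τ := by linarith
        _ = 6 / τ := by ring
    have k0 : 0 ≤ 2 / τ + 4 * (1 - g) / τ₀ := by
      have := sub_nonneg.2 hg1.le
      positivity
    have k1 := mul_le_mul_of_nonneg_left (neg_abs_le (p * b)) k0
    have k2 := mul_le_mul_of_nonneg_right k (abs_nonneg (p * b))
    have : 6 / τ * |p * b| = 6 * |p * b| / τ := by ring
    linarith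
  have h3 : (1 - g) * p ^ 2 ≤ (1 - g) * (2 + 2 * (τ / τ₀) * (1 - g) + g * n) * p ^ 2 := by
    have : 1 ≤ 2 + 2 * (τ / τ₀) * (1 - g) + g * n := by
      have := sub_nonneg.2 hg1.le
      have : 0 ≤ 2 * (τ / τ₀) * (1 - g) + g * n := by positivity
      linarith
    nlinarith [mul_nonneg (sub_nonneg.2 hg1.le) (sq_nonneg p)]
  have h4 : 0 ≤ 2 * b ^ 2 / (τ₀ * τ) := by positivity
  gcongr ?_ / _
  linarith

/-- All terms are nonnegative by symmetry of `T₂`, so only those with an index equal to `o` are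
kept; the mixed pairs `(o, j)` and `(j, o)` produce the factor `2`. -/
theorem sum_cross_sq_ge {ι : Type*} [Fintype ι] [DecidableEq ι] (o : ι) {τ T : ι → ℝ}
    {T₂ : ι → ι → ℝ} (hτ : ∀ i, 0 < τ i) (h1 : ∀ i, T₂ o i = T i) (hs : ∀ i k, T₂ i k = T₂ k i) :
    T o ^ 2 / (τ o * τ o) + ∑ j ∈ Finset.univ.erase o, 2 * T j ^ 2 / (τ o * τ j)
      ≤ ∑ i, ∑ k, T₂ i k * T₂ k i / (τ i * τ k) := by
  have h2 : ∀ i, T₂ i o = T i := fun i => by rw [hs, h1]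
  rw [← Finset.add_sum_erase _ _ (Finset.mem_univ o), ← Finset.add_sum_erase _ _ (Finset.mem_univ o)]
  have h3 : ∑ i ∈ Finset.univ.erase o, T i ^ 2 / (τ o * τ i)
      ≤ ∑ i ∈ Finset.univ.erase o, ∑ k, T₂ i k * T₂ k i / (τ i * τ k) := by
    refine Finset.sum_le_sum fun i _ => ?_
    rw [← Finset.add_sum_erase _ _ (Finset.mem_univ o), h1, h2]
    have : 0 ≤ ∑ k ∈ Finset.univ.erase o, T₂ i k * T₂ k i / (τ i * τ k) :=
      Finset.sum_nonneg fun k _ => by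
        rw [hs k i]
        have := hτ i
        have := hτ k
        have := mul_self_nonneg (T₂ i k)
        positivity
    rw [mul_comm (τ i), pow_two]
    linarith
  have h4 : ∑ j ∈ Finset.univ.erase o, 2 * T j ^ 2 / (τ o * τ j)
      = (∑ k ∈ Finset.univ.erase o, T₂ o k * T₂ k o / (τ o * τ k))
        + ∑ i ∈ Finset.univ.erase o, T i ^ 2 / (τ o * τ i) := by
    rw [← Finset.sum_add_distrib]
    refine Finset.sum_congr rfl fun i _ => ?_
    rw [h1, h2]; ring
  rw [h4, h1]
  have : T o ^ 2 = T o * T o := pow_two _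
  rw [this]
  linarith

/-- The algebra behind the maximum principle: the second order conditions at a maximum, weighted
with the inverse of the radii of curvature, combined with the twice differentiated equation. -/
theorem maximum_point_algebra {ι : Type*} [Fintype ι] [DecidableEq ι] (o : ι) {n : ℕ} (hn : 2 ≤ n)
    (hcard : Fintype.card ι = n) {u g β : ℝ} {τ p T q R b₁ b₂ : ι → ℝ} {T₂ : ι → ι → ℝ}
    (hτ : ∀ i, 0 < τ i) (hmax : ∀ i, τ i ≤ τ o) (hu : 0 < u) (hg0 : 0 < g) (hg1 : g < 1)
    (hβ : β = n * (1 - g)) (hT : ∀ i, T₂ o i = T i) (hs : ∀ i k, T₂ i k = T₂ k i)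
    (hq : ∑ i, q i / τ i - ∑ i, ∑ k, T₂ i k * T₂ k i / (τ i * τ k)
      = -(n + 2 - β) - β * (τ o / u - (p o / u) ^ 2))
    (hR : ∑ i, R i / τ i = ∑ i, τ i - n * u - β * (∑ i, p i ^ 2) / u)
    (h1 : ∀ i, g * (τ i * p i) - b₁ i - (p i * τ o + u * T i) = 0)
    (h2 : ∀ i, 0 ≤ g * R i - b₂ i - (u * q i + 2 * p i * T i + τ i * τ o)
      + if i = o then 2 * u * τ o * (∑ j ∈ Finset.univ.erase o, (p j / u) ^ 2) - 2 * u * τ o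
        - u * (4 * (∑ j ∈ Finset.univ.erase o, -(p j / u) * T j)
          + 2 * ∑ j ∈ Finset.univ.erase o, (p j / u) ^ 2 * τ j) else 0) :
    ∑ i, (b₂ i / τ i + ((1 - g) * p i ^ 2 - 6 * |p i * b₁ i| / τ i) / u)
      ≤ g * (∑ i, τ i - n * τ o) := by
  have hτo := hτ o
  -- The weights `1 / τ i` are the inverse Hessian, that is, the coefficients of the linearized
  -- equation, so that the fourth derivatives `q i` enter only through `hq`.
  have hS : 0 ≤ ∑ i, (g * R i - b₂ i - (u * q i + 2 * p i * T i + τ i * τ o)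
      + if i = o then 2 * u * τ o * (∑ j ∈ Finset.univ.erase o, (p j / u) ^ 2) - 2 * u * τ o
        - u * (4 * (∑ j ∈ Finset.univ.erase o, -(p j / u) * T j)
          + 2 * ∑ j ∈ Finset.univ.erase o, (p j / u) ^ 2 * τ j) else 0) / τ i :=
    Finset.sum_nonneg fun i _ => div_nonneg (h2 i) (hτ i).le
  have hterm : ∀ i, (g * R i - b₂ i - (u * q i + 2 * p i * T i + τ i * τ o)
      + if i = o then 2 * u * τ o * (∑ j ∈ Finset.univ.erase o, (p j / u) ^ 2) - 2 * u * τ o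
        - u * (4 * (∑ j ∈ Finset.univ.erase o, -(p j / u) * T j)
          + 2 * ∑ j ∈ Finset.univ.erase o, (p j / u) ^ 2 * τ j) else 0) / τ i
      = g * (R i / τ i) - b₂ i / τ i - u * (q i / τ i) - 2 * p i * T i / τ i - τ o
      + if i = o then 2 * u * (∑ j ∈ Finset.univ.erase o, (p j / u) ^ 2) - 2 * u
        - u / τ o * (4 * (∑ j ∈ Finset.univ.erase o, -(p j / u) * T j)
          + 2 * ∑ j ∈ Finset.univ.erase o, (p j / u) ^ 2 * τ j) else 0 := by
    intro i
    have := hτ i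
    split_ifs with hi
    · subst hi; field_simp; ring
    · field_simp; ring
  simp only [hterm, Finset.sum_add_distrib, Finset.sum_sub_distrib, ← Finset.mul_sum,
    Finset.sum_ite_eq', Finset.mem_univ, if_true, Finset.sum_const, Finset.card_univ, hcard,
    nsmul_eq_mul] at hS
  have hcs := sum_cross_sq_ge o hτ hT hs
  have hcs' := mul_le_mul_of_nonneg_left hcs hu.le
  have hlow : ∑ i, ((1 - g) * p i ^ 2 - 6 * |p i * b₁ i| / τ i) / u
      ≤ (β * (1 + g) * p o ^ 2 / u + u * (T o ^ 2 / (τ o * τ o)) + 2 * p o * T o / τ o)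
        + ∑ j ∈ Finset.univ.erase o,
        (β * g * p j ^ 2 / u + u * (2 * T j ^ 2 / (τ o * τ j)) + 2 * p j * T j / τ j
        + (u / τ o) * (4 * -(p j / u) * T j + 2 * (p j / u) ^ 2 * (τ j - τ o))) := by
    rw [← Finset.add_sum_erase _ _ (Finset.mem_univ o)]
    refine add_le_add (maxTerm_lower_bound hn hu hτo hg0 hg1 hβ (h1 o))
      (Finset.sum_le_sum fun j _ =>
        crossTerm_lower_bound hu (hτ j) (hmax j) hg0 hg1 hβ (h1 j))
  have hexp : ∑ j ∈ Finset.univ.erase o,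
        (β * g * p j ^ 2 / u + u * (2 * T j ^ 2 / (τ o * τ j)) + 2 * p j * T j / τ j
        + (u / τ o) * (4 * -(p j / u) * T j + 2 * (p j / u) ^ 2 * (τ j - τ o)))
      = β * g / u * (∑ j ∈ Finset.univ.erase o, p j ^ 2)
        + u * (∑ j ∈ Finset.univ.erase o, 2 * T j ^ 2 / (τ o * τ j))
        + (∑ j ∈ Finset.univ.erase o, 2 * p j * T j / τ j)
        + (u / τ o * (4 * (∑ j ∈ Finset.univ.erase o, -(p j / u) * T j)
          + 2 * ∑ j ∈ Finset.univ.erase o, (p j / u) ^ 2 * τ j)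
          - 2 * u * (∑ j ∈ Finset.univ.erase o, (p j / u) ^ 2)) := by
    simp only [Finset.mul_sum, ← Finset.sum_add_distrib, ← Finset.sum_sub_distrib]
    refine Finset.sum_congr rfl fun j _ => ?_
    field_simp; ring
  rw [hexp] at hlow
  have hp2 := Finset.add_sum_erase _ (fun j => p j ^ 2) (Finset.mem_univ o)
  have hpT := Finset.add_sum_erase _ (fun j => 2 * p j * T j / τ j) (Finset.mem_univ o)
  rw [hR] at hS
  have hq' : ∑ i, q i / τ i = ∑ i, ∑ k, T₂ i k * T₂ k i / (τ i * τ k)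
      -(n + 2 - β) - β * (τ o / u - (p o / u) ^ 2) := by linarith
  rw [hq'] at hS
  rw [Finset.sum_add_distrib]
  set A := ∑ j ∈ Finset.univ.erase o, p j ^ 2
  rw [← hp2] at hS
  rw [← hpT] at hS
  have e1 : g * (∑ i, τ i - n * u - β * (p o ^ 2 + A) / u)
      = g * ∑ i, τ i - n * g * u - β * g * p o ^ 2 / u - β * g / u * A := by
    field_simp; ring
  have e2 : u * (∑ i, ∑ k, T₂ i k * T₂ k i / (τ i * τ k)
      -(n + 2 - β) - β * (τ o / u - (p o / u) ^ 2))
      = u * (∑ i, ∑ k, T₂ i k * T₂ k i / (τ i * τ k)) - (n + 2 - β) * u - β * τ o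
        + β * p o ^ 2 / u := by
    field_simp; ring
  have e3 : β * (1 + g) * p o ^ 2 / u = β * p o ^ 2 / u + β * g * p o ^ 2 / u := by
    field_simp
  have e4 : n * g = n - β := by rw [hβ]; ring
  rw [e1, e2] at hS
  rw [e3] at hlow
  have e5 : g * (∑ i, τ i - n * τ o) = g * ∑ i, τ i - (n - β) * τ o := by rw [← e4]; ring
  rw [e5]
  have e6 : (n : ℝ) * g * u = (n - β) * u := by rw [← e4]
  rw [e6] at hS
  linarith

/-! ### Support functions of shrinkers and the differentiated Monge–Ampère equation. -/

/-- `H` behaves like the support function of a closed strictly convex hypersurface of `ℝ^(n+1)`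
satisfying the shrinker equation with exponent `α = 1 / β`: the product of the principal radii of
curvature is `H ^ (-β)`, expressed in the tangent hyperplane to the unit sphere at `b 0`. -/
structure IsShrinkerSupport (n : ℕ) (β : ℝ) (H : Euc (n + 1) → ℝ) : Prop where
  smooth : SmoothOff H
  homog : Homog 1 H
  pos : ∀ x, x ≠ 0 → 0 < H x
  hess_pos : ∀ x, x ≠ 0 → ∀ v, v ≠ 0 → inner ℝ x v = 0 → 0 < fderiv ℝ (fderiv ℝ H) x v v
  monge : ∀ b : Fin (n + 1) → Euc (n + 1), Orthonormal ℝ b → ∀ x, inner ℝ x (b 0) = 1 →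
    (Matrix.of fun i j : Fin n => dirDeriv (b i.succ) (dirDeriv (b j.succ) H) x).det
      = (‖x‖ ^ 2) ^ (-(n + 2 - β) / 2) * H x ^ (-β)

theorem dirDeriv_congr_off {E : Type*} [NormedAddCommGroup E] [NormedSpace ℝ E] {f g : E → ℝ}
    (h : ∀ x, x ≠ 0 → f x = g x) (v : E) {x : E} (hx : x ≠ 0) : dirDeriv v f x = dirDeriv v g x := by
  have : f =ᶠ[𝓝 x] g := by
    filter_upwards [isOpen_ne.mem_nhds hx] with y hy using h y hy
  unfold dirDeriv
  rw [this.fderiv_eq]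

theorem norm_sq_eq_sum_orthonormal {n : ℕ} {b : Fin (n + 1) → Euc (n + 1)}
    (hb : Orthonormal ℝ b) (L : Euc (n + 1) →L[ℝ] ℝ) :
    ‖L‖ ^ 2 = L (b 0) ^ 2 + ∑ k : Fin n, L (b k.succ) ^ 2 := by
  let B : OrthonormalBasis (Fin (n + 1)) ℝ (Euc (n + 1)) :=
    OrthonormalBasis.mk hb (by
      rw [hb.linearIndependent.span_eq_top_of_card_eq_finrank (by simp)])
  have hB : ∀ i, B i = b i := fun i => by simp [B]
  obtain ⟨y, rfl⟩ := (InnerProductSpace.toDual ℝ (Euc (n + 1))).surjective L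
  rw [LinearIsometryEquiv.norm_map, ← B.sum_sq_norm_inner_right y, Fin.sum_univ_succ]
  simp only [hB, InnerProductSpace.toDual_apply_apply, Real.norm_eq_abs, sq_abs]
  congr 1
  · rw [real_inner_comm]
  · exact Finset.sum_congr rfl fun i _ => by rw [real_inner_comm]

section Symmetry

variable {E : Type*} [NormedAddCommGroup E] [NormedSpace ℝ E] {H : E → ℝ}

theorem SmoothOff.dirDeriv₃_comm_right (hH : SmoothOff H) (a b c : E) {x : E} (hx : x ≠ 0) :
    GaussShrinker.dirDeriv a (GaussShrinker.dirDeriv b (GaussShrinker.dirDeriv c H)) x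
      = GaussShrinker.dirDeriv a (GaussShrinker.dirDeriv c (GaussShrinker.dirDeriv b H)) x :=
  dirDeriv_congr_off (fun _ hy => hH.dirDeriv_comm b c hy) a hx

theorem SmoothOff.dirDeriv₃_rotate (hH : SmoothOff H) (a b c : E) {x : E} (hx : x ≠ 0) :
    GaussShrinker.dirDeriv a (GaussShrinker.dirDeriv b (GaussShrinker.dirDeriv c H)) x
      = GaussShrinker.dirDeriv b (GaussShrinker.dirDeriv c (GaussShrinker.dirDeriv a H)) x := by
  rw [(hH.dirDeriv c).dirDeriv_comm a b hx, hH.dirDeriv₃_comm_right b a c hx]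

/-- Exchanges the second derivative along `a` of the `bb` entry of the Hessian with the second
derivative along `b` of the `aa` entry, which the twice differentiated equation controls.
Derivatives are flat ones, so no curvature terms appear. -/
theorem SmoothOff.dirDeriv₄_swap (hH : SmoothOff H) (a b : E) {x : E} (hx : x ≠ 0) :
    GaussShrinker.dirDeriv a (GaussShrinker.dirDeriv a
        (GaussShrinker.dirDeriv b (GaussShrinker.dirDeriv b H))) x
      = GaussShrinker.dirDeriv b (GaussShrinker.dirDeriv b
        (GaussShrinker.dirDeriv a (GaussShrinker.dirDeriv a H))) x := by
  rw [(hH.dirDeriv b).dirDeriv₃_rotate a a b hx,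
    ((hH.dirDeriv b).dirDeriv a).dirDeriv_comm a b hx]
  refine dirDeriv_congr_off (fun y hy => ?_) b hx
  exact (hH.dirDeriv₃_rotate b a a hy).symm

end Symmetry

namespace IsShrinkerSupport

variable {n : ℕ} {β : ℝ} {H : Euc (n + 1) → ℝ}

/-- Euler's relation for the first derivatives of `H`, which have degree zero. -/
theorem hess_self_left (hH : IsShrinkerSupport n β H) {x : Euc (n + 1)} (hx : x ≠ 0)
    (v : Euc (n + 1)) : dirDeriv x (dirDeriv v H) x = 0 := by
  have := (hH.homog.dirDeriv hH.smooth v).dirDeriv_self (hH.smooth.dirDeriv v) hx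
  simpa using this

variable {b : Fin (n + 1) → Euc (n + 1)} {τ : Fin n → ℝ}

theorem norm_sq_line (hb : Orthonormal ℝ b) (i : Fin n) (s : ℝ) :
    ‖b 0 + s • b i.succ‖ ^ 2 = 1 + s ^ 2 := by
  rw [norm_add_sq_real, inner_smul_right, hb.2 (Fin.succ_ne_zero i).symm, norm_smul, hb.1, hb.1]
  simp

/-- The logarithmic derivatives of the equation along a line. -/
theorem monge_jet (hH : IsShrinkerSupport n β H) (hb : Orthonormal ℝ b) (hτ : ∀ i, 0 < τ i)
    (hdiag : ∀ i j : Fin n, dirDeriv (b i.succ) (dirDeriv (b j.succ) H) (b 0)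
      = if i = j then τ i else 0) (k : Fin n) :
    (∑ i : Fin n, dirDeriv (b k.succ) (dirDeriv (b i.succ) (dirDeriv (b i.succ) H)) (b 0) / τ i
      = -β * (dirDeriv (b k.succ) H (b 0) / H (b 0))) ∧
    ∑ i : Fin n, dirDeriv (b k.succ) (dirDeriv (b k.succ)
        (dirDeriv (b i.succ) (dirDeriv (b i.succ) H))) (b 0) / τ i
      - ∑ i : Fin n, ∑ j : Fin n,
        dirDeriv (b k.succ) (dirDeriv (b i.succ) (dirDeriv (b j.succ) H)) (b 0)
        * dirDeriv (b k.succ) (dirDeriv (b j.succ) (dirDeriv (b i.succ) H)) (b 0) / (τ i * τ j)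
      = -(n + 2 - β) - β * (τ k / H (b 0) - (dirDeriv (b k.succ) H (b 0) / H (b 0)) ^ 2) := by
  have hθ : b 0 ≠ 0 := hb.ne_zero 0
  have hu := hH.pos _ hθ
  have hdet := HasJet.det (M := fun s => Matrix.of fun i j : Fin n =>
      dirDeriv (b i.succ) (dirDeriv (b j.succ) H) (b 0 + s • b k.succ)) (fun i => (hτ i).ne')
    (M₁ := fun i j => dirDeriv (b k.succ) (dirDeriv (b i.succ) (dirDeriv (b j.succ) H)) (b 0))
    (M₂ := fun i j => dirDeriv (b k.succ) (dirDeriv (b k.succ)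
        (dirDeriv (b i.succ) (dirDeriv (b j.succ) H))) (b 0))
    (fun i j => by
      have := ((hH.smooth.dirDeriv (b j.succ)).dirDeriv (b i.succ)).hasJet_line hθ (b k.succ)
      rw [hdiag] at this
      exact this)
  have hHj := hH.smooth.hasJet_line hθ (b k.succ)
  rw [hdiag, if_pos rfl] at hHj
  have hA : HasJet (fun s : ℝ => 1 + s ^ 2) 1 0 2 :=
    ((HasJet.const 1).add HasJet.id.sq).congr_jet (by norm_num) (by norm_num) (by norm_num)
  have hrhs := (hA.rpow one_pos (-(n + 2 - β) / 2)).mul (hHj.rpow hu (-β))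
  -- The line through `b 0` in the direction `b k.succ` stays in the hyperplane where the inner
  -- product with `b 0` is `1`, so the equation holds along all of it with one fixed frame.
  have heq : (fun s : ℝ => (1 + s ^ 2) ^ (-(n + 2 - β) / 2) * H (b 0 + s • b k.succ) ^ (-β))
      = fun s : ℝ => (Matrix.of fun i j : Fin n =>
      dirDeriv (b i.succ) (dirDeriv (b j.succ) H) (b 0 + s • b k.succ)).det := by
    funext s
    rw [hH.monge b hb, norm_sq_line hb]
    rw [inner_add_left, inner_smul_left, hb.2 (Fin.succ_ne_zero k), real_inner_self_eq_norm_sq,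
      hb.1]
    simp
  rw [heq] at hrhs
  obtain ⟨h0, h1, h2⟩ := hdet.unique hrhs
  have hP : H (b 0) ^ (-β) ≠ 0 := (Real.rpow_pos_of_pos hu _).ne'
  rw [Real.one_rpow, one_mul] at h0
  rw [h0] at h1 h2
  simp only [Real.one_rpow, zero_div, mul_zero, zero_mul, one_mul, zero_add] at h1 h2
  have h1' := mul_left_cancel₀ hP h1
  refine ⟨h1', ?_⟩
  have h2' := mul_left_cancel₀ hP (h2.trans (show _ = H (b 0) ^ (-β) * (-(n + 2 - β) +
    (-β * (-β - 1) * (dirDeriv (b k.succ) H (b 0) / H (b 0)) ^ 2 + -β * (τ k / H (b 0)))) by ring))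
  rw [h1'] at h2'
  linear_combination h2'

/-- The second order inequality at a point where a perturbation of the largest value of
`H D²H(e, e) - g |DH|² / 2` over the unit tangent vectors `e` is maximal. -/
theorem maximum_point_inequality (hH : IsShrinkerSupport n β H) (hn : 2 ≤ n) {g : ℝ} (hg0 : 0 < g)
    (hg1 : g < 1) (hβ : β = n * (1 - g)) (hb : Orthonormal ℝ b) (hτ : ∀ i, 0 < τ i)
    (hdiag : ∀ i j : Fin n, dirDeriv (b i.succ) (dirDeriv (b j.succ) H) (b 0)
      = if i = j then τ i else 0) {o : Fin n} (hmax : ∀ i, τ i ≤ τ o)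
    {B : Euc (n + 1) → ℝ} {b₁ b₂ : Fin n → ℝ}
    (hB : ∀ i : Fin n, HasJet (fun s => B (b 0 + s • b i.succ)) (B (b 0)) (b₁ i) (b₂ i)) {m : ℝ}
    (hle : ∀ x, x ≠ 0 → ∀ ξ, H x * fderiv ℝ (fderiv ℝ H) x ξ ξ * ‖x‖ ^ 2
      ≤ (m + g / 2 * ‖fderiv ℝ H x‖ ^ 2 - B x) * (‖ξ‖ ^ 2 * ‖x‖ ^ 2 - inner ℝ x ξ ^ 2))
    (heq : H (b 0) * τ o = m + g / 2 * ‖fderiv ℝ H (b 0)‖ ^ 2 - B (b 0)) :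
    ∑ i, (b₂ i / τ i + ((1 - g) * dirDeriv (b i.succ) H (b 0) ^ 2
      - 6 * |dirDeriv (b i.succ) H (b 0) * b₁ i| / τ i) / H (b 0))
      ≤ g * (∑ i, τ i - n * τ o) := by
  have hθ : b 0 ≠ 0 := hb.ne_zero 0
  have hu := hH.pos _ hθ
  set u := H (b 0) with hu_def
  set p : Fin n → ℝ := fun i => dirDeriv (b i.succ) H (b 0) with hp_def
  set T : Fin n → Fin n → Fin n → ℝ := fun i j k =>
    dirDeriv (b i.succ) (dirDeriv (b j.succ) (dirDeriv (b k.succ) H)) (b 0) with hT_def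
  set q : Fin n → ℝ := fun i => dirDeriv (b o.succ) (dirDeriv (b o.succ)
        (dirDeriv (b i.succ) (dirDeriv (b i.succ) H))) (b 0) with hq_def
  -- Half the second derivative of `|DH|²` along `b i.succ`. The term `-u * τ i` is the radial
  -- component: `D_{b 0} H` has 2-jet `(u, 0, -τ i)` by Euler's relation.
  set R : Fin n → ℝ := fun i => τ i ^ 2 + ∑ k, p k * T i i k - u * τ i with hR_def
  have hTr : ∀ i j k, T i j k = T i k j := fun i j k => hH.smooth.dirDeriv₃_comm_right _ _ _ hθ
  have hTrot : ∀ i j k, T i j k = T j k i := fun i j k => hH.smooth.dirDeriv₃_rotate _ _ _ hθ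
  have hgrad : ∀ i : Fin n, HasJet (fun s => g / 2 * ‖fderiv ℝ H (b 0 + s • b i.succ)‖ ^ 2)
      (g / 2 * ‖fderiv ℝ H (b 0)‖ ^ 2) (g * (τ i * p i)) (g * R i) := by
    intro i
    have j0 := (hH.smooth.dirDeriv (b 0)).hasJet_line hθ (b i.succ)
    have e0 : dirDeriv (b 0) H (b 0) = u := by
      simpa using hH.homog.dirDeriv_self hH.smooth hθ
    have e1 : dirDeriv (b i.succ) (dirDeriv (b 0) H) (b 0) = 0 := by
      rw [hH.smooth.dirDeriv_comm _ _ hθ]; exact hH.hess_self_left hθ _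
    have e2 : dirDeriv (b i.succ) (dirDeriv (b i.succ) (dirDeriv (b 0) H)) (b 0) = -τ i := by
      rw [← hH.smooth.dirDeriv₃_rotate (b 0) _ _ hθ]
      have h1 := (hH.homog.dirDeriv hH.smooth (b i.succ)).dirDeriv
        (hH.smooth.dirDeriv (b i.succ)) (b i.succ)
      have h2 := h1.dirDeriv_self ((hH.smooth.dirDeriv (b i.succ)).dirDeriv (b i.succ)) hθ
      rw [hdiag, if_pos rfl] at h2
      simpa using h2
    rw [e0, e1, e2] at j0
    have jk : ∀ k : Fin n, HasJet (fun s => dirDeriv (b k.succ) H (b 0 + s • b i.succ))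
        (p k) (if i = k then τ i else 0) (T i i k) := by
      intro k
      have := (hH.smooth.dirDeriv (b k.succ)).hasJet_line hθ (b i.succ)
      rwa [hdiag] at this
    have jr := (j0.sq.add (HasJet.sum Finset.univ fun k _ => (jk k).sq)).const_mul (g / 2)
    have hfun : (fun s : ℝ => g / 2 * ‖fderiv ℝ H (b 0 + s • b i.succ)‖ ^ 2)
        = fun s : ℝ => g / 2 * (dirDeriv (b 0) H (b 0 + s • b i.succ) ^ 2
          + ∑ k : Fin n, dirDeriv (b k.succ) H (b 0 + s • b i.succ) ^ 2) := by
      funext s; rw [norm_sq_eq_sum_orthonormal hb]; rfl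
    rw [hfun]
    refine jr.congr_jet ?_ ?_ ?_
    · rw [norm_sq_eq_sum_orthonormal hb, ← e0]; rfl
    · simp; ring
    · simp only [hR_def, Finset.sum_add_distrib]
      have : ∑ k, 2 * (if i = k then τ i else 0) ^ 2 = 2 * τ i ^ 2 := by simp
      rw [this]
      have : ∑ k, 2 * p k * T i i k = 2 * ∑ k, p k * T i i k := by
        rw [Finset.mul_sum]; exact Finset.sum_congr rfl fun k _ => by ring
      rw [this]; ring
  -- Rate at which the test direction turns towards `b j.succ`. This choice gives the gain in
  -- `crossTerm_lower_bound`. Unlike the derivative of an eigenvector, it needs no division by `τ o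
  -- - τ j`, so multiple eigenvalues do no harm.
  set c : Fin n → ℝ := fun j => -(p j / u) with hc_def
  set C : Euc (n + 1) := ∑ j ∈ Finset.univ.erase o, c j • b j.succ with hC_def
  have hbs : ∀ i j : Fin n, inner ℝ (b i.succ) (b j.succ) = if i = j then (1 : ℝ) else 0 := by
    intro i j
    rw [orthonormal_iff_ite.1 hb]
    simp
  have hb0 : ∀ j : Fin n, inner ℝ (b 0) (b j.succ) = (0 : ℝ) := fun j =>
    hb.2 (Fin.succ_ne_zero j).symm
  have hbC : ∀ i, inner ℝ (b i.succ) C = if i = o then 0 else c i := by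
    intro i
    simp only [hC_def, inner_sum, inner_smul_right, hbs]
    simp [eq_comm]
  have hb0C : inner ℝ (b 0) C = (0 : ℝ) := by
    simp only [hC_def, inner_sum, inner_smul_right, hb0]
    simp
  have hCC : ‖C‖ ^ 2 = ∑ j ∈ Finset.univ.erase o, c j ^ 2 := by
    rw [← real_inner_self_eq_norm_sq]
    nth_rewrite 1 [hC_def]
    simp only [sum_inner, inner_smul_left, hbC]
    refine Finset.sum_congr rfl fun j hj => ?_
    simp [Finset.ne_of_mem_erase hj, pow_two]
  set A := ∑ j ∈ Finset.univ.erase o, c j ^ 2 with hA_def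
  have hcond : ∀ i, g * (τ i * p i) - b₁ i - (p i * τ o + u * T o o i) = 0 ∧
      0 ≤ g * R i - b₂ i - (u * q i + 2 * p i * T o o i + τ i * τ o)
      + if i = o then 2 * u * τ o * A - 2 * u * τ o
        - u * (4 * (∑ j ∈ Finset.univ.erase o, c j * T o o j)
          + 2 * ∑ j ∈ Finset.univ.erase o, c j ^ 2 * τ j) else 0 := by
    intro i
    -- The test direction is turned only along the line in direction `o`; along the other lines it
    -- stays fixed.
    set δ : ℝ := if i = o then 1 else 0 with hδ_def
    have hδ2 : δ ^ 2 = δ := by simp only [hδ_def]; split_ifs <;> norm_num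
    have jH := hH.smooth.hasJet_line hθ (b i.succ)
    rw [hdiag, if_pos rfl] at jH
    have j2 : ∀ j k : Fin n,
        HasJet (fun s => dirDeriv (b j.succ) (dirDeriv (b k.succ) H) (b 0 + s • b i.succ))
          (if j = k then τ j else 0) (T i j k)
          (dirDeriv (b i.succ) (dirDeriv (b i.succ) (dirDeriv (b j.succ) (dirDeriv (b k.succ) H)))
            (b 0)) := by
      intro j k
      have := ((hH.smooth.dirDeriv (b k.succ)).dirDeriv (b j.succ)).hasJet_line hθ (b i.succ)
      rwa [hdiag] at this
    set ξ : ℝ → Euc (n + 1) := fun s => b o.succ + (δ * s) • C with hξ_def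
    have jK : HasJet (fun s => dirDeriv (b o.succ) (dirDeriv (b o.succ) H) (b 0 + s • b i.succ)
        + (2 * δ * (s * ∑ j ∈ Finset.univ.erase o, c j *
            dirDeriv (b o.succ) (dirDeriv (b j.succ) H) (b 0 + s • b i.succ))
        + δ * (s ^ 2 * ∑ j ∈ Finset.univ.erase o, ∑ k ∈ Finset.univ.erase o, (c j * c k) *
            dirDeriv (b j.succ) (dirDeriv (b k.succ) H) (b 0 + s • b i.succ))))
        (τ o) (T o o i) (q i + (4 * δ * (∑ j ∈ Finset.univ.erase o, c j * T i o j)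
          + 2 * δ * ∑ j ∈ Finset.univ.erase o, c j ^ 2 * τ j)) := by
      have k1 := HasJet.sum (Finset.univ.erase o) fun j _ => (j2 o j).const_mul (c j)
      have k2 := HasJet.sum (Finset.univ.erase o) fun j _ =>
        HasJet.sum (Finset.univ.erase o) fun k _ => (j2 j k).const_mul (c j * c k)
      refine ((j2 o o).add (((HasJet.id.mul k1).const_mul (2 * δ)).add
        ((HasJet.id.sq.mul k2).const_mul δ))).congr_jet ?_ ?_ ?_
      · simp
      · have : ∑ j ∈ Finset.univ.erase o, c j * (if o = j then τ o else 0) = 0 := by simp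
        rw [this, hTrot o o i, hTrot o i o]
        ring
      · have : ∑ j ∈ Finset.univ.erase o, ∑ k ∈ Finset.univ.erase o,
            (c j * c k) * (if j = k then τ j else 0)
            = ∑ j ∈ Finset.univ.erase o, c j ^ 2 * τ j := by
          refine Finset.sum_congr rfl fun j hj => ?_
          simp only [mul_ite, mul_zero, Finset.sum_ite_eq, hj, if_true]
          ring
        rw [this, hH.smooth.dirDeriv₄_swap _ _ hθ]
        simp only [hq_def]
        ring
    have hK : ∀ᶠ s : ℝ in 𝓝 0, fderiv ℝ (fderiv ℝ H) (b 0 + s • b i.succ) (ξ s) (ξ s)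
        = dirDeriv (b o.succ) (dirDeriv (b o.succ) H) (b 0 + s • b i.succ)
        + (2 * δ * (s * ∑ j ∈ Finset.univ.erase o, c j *
            dirDeriv (b o.succ) (dirDeriv (b j.succ) H) (b 0 + s • b i.succ))
        + δ * (s ^ 2 * ∑ j ∈ Finset.univ.erase o, ∑ k ∈ Finset.univ.erase o, (c j * c k) *
            dirDeriv (b j.succ) (dirDeriv (b k.succ) H) (b 0 + s • b i.succ))) := by
      have hc : ContinuousAt (fun t : ℝ => b 0 + t • b i.succ) 0 := by fun_prop
      filter_upwards [hc.eventually_ne (by simpa using hθ)] with s hs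
      simp only [hH.smooth.dirDeriv_dirDeriv _ _ hs]
      have hsym := ((hH.smooth _ hs).isSymmSndFDerivAt (by simp; exact ENat.LEInfty.out)).eq
      set L := fderiv ℝ (fderiv ℝ H) (b 0 + s • b i.succ)
      have l1 : L (b o.succ) C = ∑ j ∈ Finset.univ.erase o, c j * L (b o.succ) (b j.succ) := by
        simp [hC_def, map_sum]
      have l2 : L C C = ∑ j ∈ Finset.univ.erase o, ∑ k ∈ Finset.univ.erase o,
          (c j * c k) * L (b j.succ) (b k.succ) := by
        simp only [hC_def, map_sum, _root_.sum_apply, map_smul,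
          _root_.smul_apply, smul_eq_mul, Finset.mul_sum]
        rw [Finset.sum_comm]
        exact Finset.sum_congr rfl fun j _ => Finset.sum_congr rfl fun k _ => by ring
      rw [← l1, ← l2]
      simp only [hξ_def, map_add, _root_.add_apply, map_smul, _root_.smul_apply, smul_eq_mul]
      rw [hsym C (b o.succ)]
      linear_combination s ^ 2 * L C C * hδ2
    have jF : HasJet (fun s : ℝ => (1 + δ * A * s ^ 2) * (1 + s ^ 2) - δ * s ^ 2)
        1 0 (2 * (δ * A + 1 - δ)) := by
      refine ((((HasJet.const 1).add (HasJet.id.sq.const_mul (δ * A))).mul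
        ((HasJet.const 1).add HasJet.id.sq)).sub (HasJet.id.sq.const_mul δ)).congr_jet ?_ ?_ ?_
      all_goals norm_num
      ring
    have jΦ := ((((HasJet.const m).add (hgrad i)).sub (hB i)).mul jF).sub
      ((jH.mul jK).mul ((HasJet.const 1).add HasJet.id.sq))
    -- The bound `hle`, evaluated along the line at the test direction `ξ s`, says that this
    -- difference is nonnegative; it vanishes at `s = 0` by `heq`.
    have hmin : IsLocalMin (fun s : ℝ => (m + g / 2 * ‖fderiv ℝ H (b 0 + s • b i.succ)‖ ^ 2
        - B (b 0 + s • b i.succ)) * ((1 + δ * A * s ^ 2) * (1 + s ^ 2) - δ * s ^ 2)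
        - H (b 0 + s • b i.succ) *
        (dirDeriv (b o.succ) (dirDeriv (b o.succ) H) (b 0 + s • b i.succ)
        + (2 * δ * (s * ∑ j ∈ Finset.univ.erase o, c j *
            dirDeriv (b o.succ) (dirDeriv (b j.succ) H) (b 0 + s • b i.succ))
        + δ * (s ^ 2 * ∑ j ∈ Finset.univ.erase o, ∑ k ∈ Finset.univ.erase o, (c j * c k) *
            dirDeriv (b j.succ) (dirDeriv (b k.succ) H) (b 0 + s • b i.succ))))
        * (1 + s ^ 2)) 0 := by
      have hc : ContinuousAt (fun t : ℝ => b 0 + t • b i.succ) 0 := by fun_prop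
      filter_upwards [hK, hc.eventually_ne (by simpa using hθ)] with s hs hne
      have h0 : (m + g / 2 * ‖fderiv ℝ H (b 0 + (0 : ℝ) • b i.succ)‖ ^ 2
        - B (b 0 + (0 : ℝ) • b i.succ)) * ((1 + δ * A * 0 ^ 2) * (1 + 0 ^ 2) - δ * 0 ^ 2)
        - H (b 0 + (0 : ℝ) • b i.succ) *
        (dirDeriv (b o.succ) (dirDeriv (b o.succ) H) (b 0 + (0 : ℝ) • b i.succ)
        + (2 * δ * (0 * ∑ j ∈ Finset.univ.erase o, c j *
            dirDeriv (b o.succ) (dirDeriv (b j.succ) H) (b 0 + (0 : ℝ) • b i.succ))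
        + δ * (0 ^ 2 * ∑ j ∈ Finset.univ.erase o, ∑ k ∈ Finset.univ.erase o, (c j * c k) *
            dirDeriv (b j.succ) (dirDeriv (b k.succ) H) (b 0 + (0 : ℝ) • b i.succ))))
        * (1 + 0 ^ 2) = 0 := by
        simp only [zero_smul, add_zero, hdiag, if_true]
        rw [← heq]; ring
      rw [h0, ← hs]
      have h1 := hle _ hne (ξ s)
      have e1 : ‖ξ s‖ ^ 2 = 1 + δ * A * s ^ 2 := by
        simp only [hξ_def]
        rw [norm_add_sq_real, inner_smul_right, hbC, norm_smul, hb.1, mul_pow, hCC,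
          Real.norm_eq_abs, sq_abs, if_pos rfl, mul_pow, hδ2]
        ring
      have e2 : inner ℝ (b 0 + s • b i.succ) (ξ s) = δ * s := by
        simp only [hξ_def, inner_add_left, inner_add_right, inner_smul_left, inner_smul_right, hb0,
          hb0C, hbs, hbC, hδ_def]
        split_ifs <;> simp
      rw [norm_sq_line hb, e1, e2, mul_pow, hδ2] at h1
      linarith
    obtain ⟨hΦ1, hΦ2⟩ := jΦ.of_isLocalMin hmin
    have eT : ∀ j, T i o j = T o j i := fun j => by rw [hTrot i o j]
    have hval : m + g / 2 * ‖fderiv ℝ H (b 0)‖ ^ 2 - B (b 0) = u * τ o := heq.symm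
    constructor
    · linear_combination hΦ1
    · rw [hval] at hΦ2
      by_cases hi : i = o
      · have hδ : δ = 1 := by simp [hδ_def, hi]
        rw [if_pos hi]
        subst hi
        rw [hδ] at hΦ2
        refine hΦ2.trans_eq ?_
        ring
      · have hδ : δ = 0 := by simp [hδ_def, hi]
        rw [if_neg hi]
        rw [hδ] at hΦ2
        refine hΦ2.trans_eq ?_
        ring
  have hMJ := hH.monge_jet hb hτ hdiag
  refine maximum_point_algebra o hn (by simp) (q := q) (R := R) (T := fun i => T o o i)
    (T₂ := fun i k => T o i k) hτ hmax hu hg0 hg1 hβ (fun i => rfl) (fun i k => hTr o i k)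
    (hMJ o).2 ?_ (fun i => (hcond i).1) ?_
  · have e : ∀ i, R i / τ i = τ i + ∑ k, p k * (T k i i / τ i) - u := by
      intro i
      have := (hτ i).ne'
      have e2 : ∑ k, p k * (T k i i / τ i) = (∑ k, p k * T i i k) / τ i := by
        rw [Finset.sum_div]
        refine Finset.sum_congr rfl fun k _ => ?_
        rw [hTrot k i i]; ring
      rw [e2]
      simp only [hR_def]
      field_simp
    simp only [e, Finset.sum_sub_distrib, Finset.sum_add_distrib]
    -- With `k` outermost, the inner sum is the trace of a third derivative against the inverse
    -- Hessian, which the once differentiated equation evaluates.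
    rw [Finset.sum_comm]
    have e3 : ∀ k, ∑ i, p k * (T k i i / τ i) = -(β / u) * p k ^ 2 := by
      intro k
      rw [← Finset.mul_sum, (hMJ k).1]
      ring
    simp only [e3, ← Finset.mul_sum]
    simp
    ring
  · intro i
    have h2 := (hcond i).2
    have ec : ∀ j, c j ^ 2 = (p j / u) ^ 2 := fun j => by simp only [hc_def]; ring
    simp only [hA_def, ec] at h2
    exact h2

end IsShrinkerSupport

/-! ### Eigenframes of the Hessian on the tangent space. -/

section Frame

/-- A symmetric bilinear form on `ℝ^(n+1)` is diagonal in some orthonormal frame of the orthogonal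
complement of a given unit vector. -/
theorem exists_orthonormal_diagonal {n : ℕ} {θ : Euc (n + 1)} (hθ : ‖θ‖ = 1)
    (L : Euc (n + 1) →L[ℝ] Euc (n + 1) →L[ℝ] ℝ) (hL : ∀ v w, L v w = L w v) :
    ∃ (b : Fin (n + 1) → Euc (n + 1)) (τ : Fin n → ℝ), Orthonormal ℝ b ∧ b 0 = θ ∧
      (∀ i j : Fin n, L (b i.succ) (b j.succ) = if i = j then τ i else 0) ∧
      ∀ e, inner ℝ θ e = 0 → ∃ c : Fin n → ℝ, ‖e‖ ^ 2 = ∑ i, c i ^ 2 ∧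
        L e e = ∑ i, τ i * c i ^ 2 := by
  have hθ0 : θ ≠ 0 := by rintro rfl; simp at hθ
  have : Fact (Module.finrank ℝ (Euc (n + 1)) = n + 1) := ⟨by simp⟩
  set K : Submodule ℝ (Euc (n + 1)) := (ℝ ∙ θ)ᗮ
  have hK : Module.finrank ℝ K = n := Submodule.finrank_orthogonal_span_singleton hθ0
  let A : Euc (n + 1) → Euc (n + 1) := fun v => (InnerProductSpace.toDual ℝ (Euc (n + 1))).symm (L v)
  have hA : ∀ v w, inner ℝ (A v) w = L v w := fun v w => by
    simp [A, InnerProductSpace.toDual_symm_apply]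
  let T : K →ₗ[ℝ] K :=
    { toFun := fun v => K.orthogonalProjectionOnto (A v)
      map_add' := fun v w => by simp [A]
      map_smul' := fun r v => by simp [A] }
  have hTi : ∀ v w : K, inner ℝ (T v) w = L v w := fun v w => by
    change inner ℝ (K.orthogonalProjectionOnto (A v)) w = _
    rw [Submodule.inner_orthogonalProjectionOnto_eq_of_mem_right, hA]
  have hT : T.IsSymmetric := fun v w => by
    rw [hTi, real_inner_comm, hTi, hL]
  let f := hT.eigenvectorBasis hK
  refine ⟨Fin.cons θ fun i => (f i : Euc (n + 1)), hT.eigenvalues hK, ?_, rfl, ?_, ?_⟩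
  · have hperp : ∀ i, inner ℝ θ (f i : Euc (n + 1)) = 0 := fun i =>
      Submodule.mem_orthogonal_singleton_iff_inner_right.1 (f i).2
    constructor
    · intro i
      refine Fin.cases ?_ (fun i => ?_) i
      · simpa using hθ
      · rw [Fin.cons_succ]; exact f.orthonormal.1 i
    · intro i j
      refine Fin.cases ?_ (fun i => ?_) i <;> refine Fin.cases ?_ (fun j => ?_) j
      · simp
      · intro _; simpa using hperp j
      · intro _; rw [real_inner_comm]; simpa using hperp i
      · intro hij
        have := f.orthonormal.2 (i := i) (j := j) (fun h => hij (by rw [h]))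
        simpa using this
  · intro i j
    simp only [Fin.cons_succ]
    rw [← hTi, hT.apply_eigenvectorBasis hK i]
    rw [inner_smul_left, orthonormal_iff_ite.1 f.orthonormal]
    split_ifs <;> simp
  · intro e he
    let e' : K := ⟨e, Submodule.mem_orthogonal_singleton_iff_inner_right.2 he⟩
    refine ⟨fun i => inner ℝ (f i) e', ?_, ?_⟩
    · have := f.sum_sq_norm_inner_right e'
      simp only [Real.norm_eq_abs, sq_abs] at this
      rw [this]; rfl
    · have h1 : L e e = inner ℝ (T e') e' := (hTi e' e').symm
      rw [h1, ← f.sum_inner_mul_inner]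
      refine Finset.sum_congr rfl fun i _ => ?_
      rw [hT e' (f i), hT.apply_eigenvectorBasis hK i, inner_smul_right, real_inner_comm]
      simp only [RCLike.ofReal_real_eq_id, id]
      ring

end Frame

/-! ### The curvature gap on the unit tangent bundle. -/

/-- The pairs of orthogonal unit vectors, that is, the unit tangent bundle of the sphere. -/
def unitTangent (n : ℕ) : Set (Euc (n + 1) × Euc (n + 1)) :=
  {z | ‖z.1‖ = 1 ∧ ‖z.2‖ = 1 ∧ inner ℝ z.1 z.2 = 0}

theorem isCompact_unitTangent (n : ℕ) : IsCompact (unitTangent n) := by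
  refine Metric.isCompact_of_isClosed_isBounded ?_ ?_
  · refine (isClosed_eq (by fun_prop) continuous_const).inter
      ((isClosed_eq (by fun_prop) continuous_const).inter
        (isClosed_eq (by fun_prop) continuous_const))
  · refine (Metric.isBounded_closedBall (x := (0 : Euc (n + 1) × Euc (n + 1))) (r := 1)).subset ?_
    rintro ⟨x, y⟩ ⟨h1, h2, -⟩
    simp [Prod.norm_def] at *
    exact ⟨h1.le, h2.le⟩

theorem exists_unitTangent {n : ℕ} (hn : 1 ≤ n) {θ : Euc (n + 1)} (hθ : ‖θ‖ = 1) :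
    ∃ e, (θ, e) ∈ unitTangent n := by
  obtain ⟨b, -, hb, rfl, -⟩ := exists_orthonormal_diagonal hθ 0 (by simp)
  exact ⟨b (Fin.succ ⟨0, hn⟩), hb.1 _, hb.1 _, hb.2 (Fin.succ_ne_zero _).symm⟩

/-- The quantity to which the maximum principle is applied. -/
def curvatureGap {n : ℕ} (g : ℝ) (H : Euc (n + 1) → ℝ) (z : Euc (n + 1) × Euc (n + 1)) : ℝ :=
  H z.1 * fderiv ℝ (fderiv ℝ H) z.1 z.2 z.2 - g / 2 * ‖fderiv ℝ H z.1‖ ^ 2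

namespace IsShrinkerSupport

variable {n : ℕ} {β : ℝ} {H : Euc (n + 1) → ℝ}

theorem contDiffAt_fderiv (hH : IsShrinkerSupport n β H) {x : Euc (n + 1)} (hx : x ≠ 0) :
    ContDiffAt ℝ ∞ (fderiv ℝ H) x := (hH.smooth x hx).fderiv_right (by simp)

theorem ne_zero_of_mem {z : Euc (n + 1) × Euc (n + 1)} (hz : z ∈ unitTangent n) : z.1 ≠ 0 := by
  intro h; have := hz.1; simp [h] at this

theorem continuousOn_hess (hH : IsShrinkerSupport n β H) :
    ContinuousOn (fun z : Euc (n + 1) × Euc (n + 1) => fderiv ℝ (fderiv ℝ H) z.1 z.2 z.2)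
      (unitTangent n) := by
  intro z hz
  refine ContinuousAt.continuousWithinAt ?_
  have h2 : ContinuousAt (fderiv ℝ (fderiv ℝ H)) z.1 :=
    ((hH.contDiffAt_fderiv (ne_zero_of_mem hz)).fderiv_right (m := ∞) (by simp)).continuousAt
  have h3 : ContinuousAt (fun z : Euc (n + 1) × Euc (n + 1) => fderiv ℝ (fderiv ℝ H) z.1) z :=
    ContinuousAt.comp (f := Prod.fst) h2 continuousAt_fst
  exact (h3.clm_apply continuousAt_snd).clm_apply continuousAt_snd

theorem continuousOn_fderiv (hH : IsShrinkerSupport n β H) :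
    ContinuousOn (fun z : Euc (n + 1) × Euc (n + 1) => fderiv ℝ H z.1) (unitTangent n) :=
  fun _ hz => (ContinuousAt.comp (f := Prod.fst) (hH.contDiffAt_fderiv
    (ne_zero_of_mem hz)).continuousAt continuousAt_fst).continuousWithinAt

theorem continuousOn_fst (hH : IsShrinkerSupport n β H) :
    ContinuousOn (fun z : Euc (n + 1) × Euc (n + 1) => H z.1) (unitTangent n) :=
  fun _ hz => (ContinuousAt.comp (f := Prod.fst) (hH.smooth _
    (ne_zero_of_mem hz)).continuousAt continuousAt_fst).continuousWithinAt

theorem continuousOn_curvatureGap (hH : IsShrinkerSupport n β H) (g : ℝ) :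
    ContinuousOn (curvatureGap g H) (unitTangent n) :=
  (hH.continuousOn_fst.mul hH.continuousOn_hess).sub
    (continuousOn_const.mul (hH.continuousOn_fderiv.norm.pow 2))

theorem hess_symm (hH : IsShrinkerSupport n β H) {x : Euc (n + 1)} (hx : x ≠ 0)
    (v w : Euc (n + 1)) : fderiv ℝ (fderiv ℝ H) x v w = fderiv ℝ (fderiv ℝ H) x w v :=
  ((hH.smooth x hx).isSymmSndFDerivAt (by simp; exact ENat.LEInfty.out)).eq v w

theorem hess_self (hH : IsShrinkerSupport n β H) {x : Euc (n + 1)} (hx : x ≠ 0)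
    (v : Euc (n + 1)) : fderiv ℝ (fderiv ℝ H) x x v = 0 := by
  rw [← hH.smooth.dirDeriv_dirDeriv _ _ hx, hH.hess_self_left hx]

theorem exists_frame (hH : IsShrinkerSupport n β H) (hn : 1 ≤ n) {θ : Euc (n + 1)} (hθ : ‖θ‖ = 1) :
    ∃ (b : Fin (n + 1) → Euc (n + 1)) (τ : Fin n → ℝ) (o : Fin n), Orthonormal ℝ b ∧ b 0 = θ ∧
      (∀ i, 0 < τ i) ∧ (∀ i, τ i ≤ τ o) ∧
      (∀ i j : Fin n, dirDeriv (b i.succ) (dirDeriv (b j.succ) H) (b 0)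
        = if i = j then τ i else 0) ∧
      ∀ e, (θ, e) ∈ unitTangent n → fderiv ℝ (fderiv ℝ H) θ e e ≤ τ o := by
  have hθ0 : θ ≠ 0 := by rintro rfl; simp at hθ
  obtain ⟨b, τ, hb, hb0, hd, he⟩ :=
    exists_orthonormal_diagonal hθ (fderiv ℝ (fderiv ℝ H) θ) (hH.hess_symm hθ0)
  have : Nonempty (Fin n) := ⟨⟨0, hn⟩⟩
  obtain ⟨o, ho⟩ := Finite.exists_max τ
  refine ⟨b, τ, o, hb, hb0, fun i => ?_, ho, fun i j => ?_, fun e hz => ?_⟩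
  · have := hH.hess_pos θ hθ0 (b i.succ) (hb.ne_zero _)
      (by rw [← hb0]; exact hb.2 (Fin.succ_ne_zero i).symm)
    rwa [hd, if_pos rfl] at this
  · rw [hb0, hH.smooth.dirDeriv_dirDeriv _ _ hθ0, hd]
  · obtain ⟨c, hc1, hc2⟩ := he e hz.2.2
    have h1 : ‖e‖ = 1 := hz.2.1
    rw [h1, one_pow] at hc1
    calc _ = ∑ i, τ i * c i ^ 2 := hc2
      _ ≤ ∑ i, τ o * c i ^ 2 :=
        Finset.sum_le_sum fun i _ => mul_le_mul_of_nonneg_right (ho i) (sq_nonneg _)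
      _ = τ o := by rw [← Finset.mul_sum, ← hc1, mul_one]

/-- A bound for the curvature gap on the unit tangent bundle, in homogeneous form. -/
theorem homogeneous_bound (hH : IsShrinkerSupport n β H) {g m : ℝ} {B : Euc (n + 1) → ℝ}
    (hB : Homog 0 B) (h : ∀ z ∈ unitTangent n, curvatureGap g H z + B z.1 ≤ m) {x : Euc (n + 1)}
    (hx : x ≠ 0) (ξ : Euc (n + 1)) :
    H x * fderiv ℝ (fderiv ℝ H) x ξ ξ * ‖x‖ ^ 2
      ≤ (m + g / 2 * ‖fderiv ℝ H x‖ ^ 2 - B x) * (‖ξ‖ ^ 2 * ‖x‖ ^ 2 - inner ℝ x ξ ^ 2) := by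
  set ρ := ‖x‖
  have hρ : 0 < ρ := norm_pos_iff.2 hx
  set θ := ρ⁻¹ • x with hθ_def
  have hθ1 : ‖θ‖ = 1 := by rw [norm_smul, norm_inv, norm_norm, inv_mul_cancel₀ hρ.ne']
  have hθ0 : θ ≠ 0 := by intro h; simp [h] at hθ1
  have hxθ : x = ρ • θ := by rw [hθ_def, smul_smul, mul_inv_cancel₀ hρ.ne', one_smul]
  set a := inner ℝ θ ξ with ha
  set ζ := ξ - a • θ with hζ
  have hperp : inner ℝ θ ζ = 0 := by
    rw [hζ, inner_sub_right, inner_smul_right, real_inner_self_eq_norm_sq, hθ1, ← ha]; ring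
  have hξ : ξ = ζ + a • θ := by rw [hζ]; abel
  have hBx : B x = B θ := by rw [hxθ, hB ρ hρ θ hθ0]; simp
  have hHx : H x = ρ * H θ := by rw [hxθ, hH.homog ρ hρ θ hθ0]; simp
  have hD : fderiv ℝ H x = fderiv ℝ H θ := by
    -- The first derivatives of `H` have degree `0` and the second derivatives degree `-1`, so `H
    -- D²H` and `|DH|²` both have degree `0`.
    ext v
    have := (hH.homog.dirDeriv hH.smooth v) ρ hρ θ hθ0
    rw [← hxθ] at this
    simpa [dirDeriv] using this
  have hDD : ∀ v w, fderiv ℝ (fderiv ℝ H) x v w = ρ⁻¹ * fderiv ℝ (fderiv ℝ H) θ v w := by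
    intro v w
    have := ((hH.homog.dirDeriv hH.smooth w).dirDeriv (hH.smooth.dirDeriv w) v) ρ hρ θ hθ0
    rw [← hxθ, hH.smooth.dirDeriv_dirDeriv _ _ hx, hH.smooth.dirDeriv_dirDeriv _ _ hθ0] at this
    simpa using this
  have hss : fderiv ℝ (fderiv ℝ H) θ ξ ξ = fderiv ℝ (fderiv ℝ H) θ ζ ζ := by
    have e1 := hH.hess_self hθ0
    have e2 : ∀ v, fderiv ℝ (fderiv ℝ H) θ v θ = 0 := fun v => by rw [hH.hess_symm hθ0, e1]
    rw [hξ]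
    simp [e1, e2]
  have hn1 : ‖ξ‖ ^ 2 * ρ ^ 2 - inner ℝ x ξ ^ 2 = ρ ^ 2 * ‖ζ‖ ^ 2 := by
    have e1 : ‖ξ‖ ^ 2 = ‖ζ‖ ^ 2 + a ^ 2 := by
      rw [hξ, norm_add_sq_real, inner_smul_right, real_inner_comm, hperp, norm_smul, hθ1]
      simp
    have e2 : inner ℝ x ξ = ρ * a := by rw [ha]; nth_rewrite 1 [hxθ]; rw [inner_smul_left]; simp
    rw [e1, e2]; ring
  rw [hn1, hHx, hDD, hD, hBx, hss]
  have key : H θ * fderiv ℝ (fderiv ℝ H) θ ζ ζ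
      ≤ (m + g / 2 * ‖fderiv ℝ H θ‖ ^ 2 - B θ) * ‖ζ‖ ^ 2 := by
    by_cases hz : ζ = 0
    · simp [hz]
    · have hzn : 0 < ‖ζ‖ := norm_pos_iff.2 hz
      have h1 := h (θ, ‖ζ‖⁻¹ • ζ) ⟨hθ1, by
        rw [norm_smul, norm_inv, norm_norm, inv_mul_cancel₀ hzn.ne'], by
        simp only [inner_smul_right, hperp, mul_zero]⟩
      simp only [curvatureGap, map_smul, _root_.smul_apply, smul_eq_mul] at h1
      have h2 : H θ * (‖ζ‖⁻¹ * (‖ζ‖⁻¹ * fderiv ℝ (fderiv ℝ H) θ ζ ζ)) * ‖ζ‖ ^ 2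
          ≤ (m + g / 2 * ‖fderiv ℝ H θ‖ ^ 2 - B θ) * ‖ζ‖ ^ 2 := by
        gcongr
        linarith
      refine le_trans (le_of_eq ?_) h2
      field_simp
  calc ρ * H θ * (ρ⁻¹ * fderiv ℝ (fderiv ℝ H) θ ζ ζ) * ρ ^ 2
      = ρ ^ 2 * (H θ * fderiv ℝ (fderiv ℝ H) θ ζ ζ) := by field_simp
    _ ≤ ρ ^ 2 * ((m + g / 2 * ‖fderiv ℝ H θ‖ ^ 2 - B θ) * ‖ζ‖ ^ 2) := by gcongr
    _ = _ := by ring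

/-- The inequality at a maximum point of the perturbed curvature gap. -/
theorem inequality_of_isMax (hH : IsShrinkerSupport n β H) (hn : 2 ≤ n) {g : ℝ} (hg0 : 0 < g)
    (hg1 : g < 1) (hβ : β = n * (1 - g)) {B : Euc (n + 1) → ℝ} (hB : Homog 0 B)
    {z : Euc (n + 1) × Euc (n + 1)} (hz : z ∈ unitTangent n)
    (hmax : ∀ z' ∈ unitTangent n, curvatureGap g H z' + B z'.1 ≤ curvatureGap g H z + B z.1) :
    ∃ (b : Fin (n + 1) → Euc (n + 1)) (τ : Fin n → ℝ), Orthonormal ℝ b ∧ b 0 = z.1 ∧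
      (∀ i, 0 < τ i) ∧ (∀ i j : Fin n, dirDeriv (b i.succ) (dirDeriv (b j.succ) H) (b 0)
        = if i = j then τ i else 0) ∧
      ∀ b₁ b₂ : Fin n → ℝ,
      (∀ i : Fin n, HasJet (fun s => B (b 0 + s • b i.succ)) (B (b 0)) (b₁ i) (b₂ i)) →
      ∑ i, (b₂ i / τ i + ((1 - g) * dirDeriv (b i.succ) H (b 0) ^ 2
        - 6 * |dirDeriv (b i.succ) H (b 0) * b₁ i| / τ i) / H (b 0)) ≤ 0 := by
  obtain ⟨θ, e⟩ := z
  obtain ⟨b, τ, o, hb, rfl, hτ, ho, hd, he⟩ := hH.exists_frame (by omega) hz.1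
  refine ⟨b, τ, hb, rfl, hτ, hd, fun b₁ b₂ hj => ?_⟩
  have hθ0 : b 0 ≠ 0 := hb.ne_zero 0
  have heo : fderiv ℝ (fderiv ℝ H) (b 0) (b o.succ) (b o.succ) = τ o := by
    rw [← hH.smooth.dirDeriv_dirDeriv _ _ hθ0, hd, if_pos rfl]
  have hval : H (b 0) * τ o = (curvatureGap g H (b 0, e) + B (b 0))
      + g / 2 * ‖fderiv ℝ H (b 0)‖ ^ 2 - B (b 0) := by
    have h1 := hmax (b 0, b o.succ) ⟨hb.1 _, hb.1 _, hb.2 (Fin.succ_ne_zero o).symm⟩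
    have h2 := mul_le_mul_of_nonneg_left (he e hz) (hH.pos _ hθ0).le
    simp only [curvatureGap] at h1 ⊢
    rw [heo] at h1
    simp only at h1 h2
    linarith
  have := hH.maximum_point_inequality hn hg0 hg1 hβ hb hτ hd ho hj
    (fun x hx ξ => hH.homogeneous_bound hB hmax hx ξ) hval
  refine this.trans (mul_nonpos_of_nonneg_of_nonpos hg0.le ?_)
  have : ∑ i, τ i ≤ ∑ _i : Fin n, τ o := Finset.sum_le_sum fun i _ => ho i
  simp at this
  linarith

end IsShrinkerSupport

/-! ### Barriers and the strong maximum principle. -/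

/-- The exponential barrier, extended to be homogeneous of degree zero. -/
def barrier {n : ℕ} (ε k : ℝ) (p : Euc (n + 1)) (x : Euc (n + 1)) : ℝ :=
  ε * Real.exp (k * (inner ℝ x p * (‖x‖ ^ 2) ^ (-(1 / 2) : ℝ)))

theorem barrier_homog {n : ℕ} (ε k : ℝ) (p : Euc (n + 1)) : Homog 0 (barrier ε k p) := by
  intro c hc x hx
  have hx' : 0 < ‖x‖ := norm_pos_iff.2 hx
  simp only [barrier, zpow_zero, one_mul]
  congr 3
  rw [inner_smul_left, norm_smul, Real.norm_eq_abs, abs_of_pos hc, mul_pow,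
    Real.mul_rpow (by positivity) (by positivity)]
  have : c * (c ^ 2) ^ (-(1 / 2) : ℝ) = 1 := by
    rw [Real.rpow_neg (by positivity), ← Real.sqrt_eq_rpow, Real.sqrt_sq hc.le,
      mul_inv_cancel₀ hc.ne']
  simp only [conj_trivial]
  linear_combination inner ℝ x p * (‖x‖ ^ 2) ^ (-(1 / 2) : ℝ) * this

theorem barrier_of_norm_one {n : ℕ} (ε k : ℝ) (p : Euc (n + 1)) {x : Euc (n + 1)}
    (hx : ‖x‖ = 1) : barrier ε k p x = ε * Real.exp (k * inner ℝ x p) := by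
  simp [barrier, hx]

theorem hasJet_barrier {n : ℕ} (ε k : ℝ) (p : Euc (n + 1)) {b : Fin (n + 1) → Euc (n + 1)}
    (hb : Orthonormal ℝ b) (i : Fin n) :
    HasJet (fun s => barrier ε k p (b 0 + s • b i.succ)) (barrier ε k p (b 0))
      (ε * Real.exp (k * inner ℝ (b 0) p) * (k * inner ℝ (b i.succ) p))
      (ε * Real.exp (k * inner ℝ (b 0) p) *
        (k ^ 2 * inner ℝ (b i.succ) p ^ 2 - k * inner ℝ (b 0) p)) := by
  have hA : HasJet (fun s : ℝ => 1 + s ^ 2) 1 0 2 :=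
    ((HasJet.const 1).add HasJet.id.sq).congr_jet (by norm_num) (by norm_num) (by norm_num)
  have hI : HasJet (fun s : ℝ => inner ℝ (b 0) p + s * inner ℝ (b i.succ) p)
      (inner ℝ (b 0) p) (inner ℝ (b i.succ) p) 0 :=
    ((HasJet.const _).add (HasJet.id.mul (HasJet.const _))).congr_jet
      (by ring) (by ring) (by ring)
  have := (((hI.mul (hA.rpow one_pos (-(1 / 2)))).const_mul k).exp).const_mul ε
  have hfun : (fun s => barrier ε k p (b 0 + s • b i.succ)) = fun s : ℝ => ε * Real.exp
      (k * ((inner ℝ (b 0) p + s * inner ℝ (b i.succ) p) * (1 + s ^ 2) ^ (-(1 / 2) : ℝ))) := by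
    funext s
    simp only [barrier]
    rw [IsShrinkerSupport.norm_sq_line hb, inner_add_left, inner_smul_left]
    simp
  rw [hfun]
  refine this.congr_jet ?_ ?_ ?_
  · rw [barrier_of_norm_one _ _ _ (hb.1 0)]; simp
  · simp; ring
  · simp; ring

namespace IsShrinkerSupport

variable {n : ℕ} {β : ℝ} {H : Euc (n + 1) → ℝ}

/-- Uniform bounds on the unit tangent bundle. -/
theorem exists_bounds (hH : IsShrinkerSupport n β H) (hn : 1 ≤ n) :
    ∃ l Λ u₀ P : ℝ, 0 < l ∧ 0 < Λ ∧ 0 < u₀ ∧ 0 ≤ P ∧ ∀ z ∈ unitTangent n,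
      l ≤ fderiv ℝ (fderiv ℝ H) z.1 z.2 z.2 ∧ fderiv ℝ (fderiv ℝ H) z.1 z.2 z.2 ≤ Λ ∧
      u₀ ≤ H z.1 ∧ |fderiv ℝ H z.1 z.2| ≤ P := by
  have hc := isCompact_unitTangent n
  have hne : (unitTangent n).Nonempty := by
    obtain ⟨e, he⟩ := exists_unitTangent hn (θ := (EuclideanSpace.single 0 1 : Euc (n + 1))) (by simp)
    exact ⟨_, he⟩
  obtain ⟨z1, h1, h1'⟩ := hc.exists_isMinOn hne hH.continuousOn_hess
  obtain ⟨z2, h2, h2'⟩ := hc.exists_isMaxOn hne hH.continuousOn_hess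
  obtain ⟨z3, h3, h3'⟩ := hc.exists_isMinOn hne hH.continuousOn_fst
  obtain ⟨z4, h4, h4'⟩ := hc.exists_isMaxOn hne hH.continuousOn_fderiv.norm
  have hpos : ∀ z ∈ unitTangent n, 0 < fderiv ℝ (fderiv ℝ H) z.1 z.2 z.2 := fun z hz =>
    hH.hess_pos _ (ne_zero_of_mem hz) _ (by intro h; have := hz.2.1; simp [h] at this) hz.2.2
  refine ⟨_, _, _, ‖fderiv ℝ H z4.1‖, hpos z1 h1, hpos z2 h2, hH.pos _ (ne_zero_of_mem h3), norm_nonneg _,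
    fun z hz => ⟨h1' hz, h2' hz, h3' hz, ?_⟩⟩
  refine le_trans ?_ (h4' hz)
  have := (fderiv ℝ H z.1).le_opNorm z.2
  rw [hz.2.1, mul_one] at this
  exact this

/-- No perturbation of the curvature gap by a steep barrier has its maximum in the region where
the barrier is uniformly non-degenerate. -/
theorem exists_steep (hH : IsShrinkerSupport n β H) (hn : 2 ≤ n) {g : ℝ} (hg0 : 0 < g)
    (hg1 : g < 1) (hβ : β = n * (1 - g)) {δ : ℝ} (hδ : 0 < δ) :
    ∃ k : ℝ, 0 < k ∧ ∀ ε, 0 < ε → ∀ p : Euc (n + 1), ‖p‖ = 1 → ∀ z ∈ unitTangent n,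
      (∀ z' ∈ unitTangent n, curvatureGap g H z' + barrier ε k p z'.1
        ≤ curvatureGap g H z + barrier ε k p z.1) → 1 - inner ℝ z.1 p ^ 2 < δ := by
  obtain ⟨l, Λ, u₀, P, hl, hΛ, hu₀, hP, hbd⟩ := hH.exists_bounds (by omega)
  -- `k * D` bounds the terms linear in `k`, and `k` is chosen so that the quadratic gain `k ^ 2 * δ
  -- / Λ` equals `k * (D + 1)`.
  set D := n * (1 / l + 6 * P / (l * u₀)) with hD
  have hD0 : 0 ≤ D := by positivity
  refine ⟨Λ * (D + 1) / δ, by positivity, ?_⟩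
  set k := Λ * (D + 1) / δ with hk
  have hk0 : 0 < k := by positivity
  intro ε hε p hp z hz hmax
  by_contra! hcon
  obtain ⟨b, τ, hb, hbz, hτ, hd, hineq⟩ :=
    hH.inequality_of_isMax hn hg0 hg1 hβ (barrier_homog ε k p) hz hmax
  have hθ0 : b 0 ≠ 0 := hb.ne_zero 0
  have h1 := hineq _ _ fun i => hasJet_barrier ε k p hb i
  rw [← hbz] at hcon
  set t := inner ℝ (b 0) p with ht
  set F := ε * Real.exp (k * t) with hF
  have hF0 : 0 < F := by positivity
  set w : Fin n → ℝ := fun i => inner ℝ (b i.succ) p with hw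
  have hwsum : ∑ i, w i ^ 2 = 1 - t ^ 2 := by
    have := norm_sq_eq_sum_orthonormal hb (InnerProductSpace.toDual ℝ (Euc (n + 1)) p)
    rw [LinearIsometryEquiv.norm_map, hp] at this
    simp only [InnerProductSpace.toDual_apply_apply] at this
    simp only [hw, ht]
    simp only [real_inner_comm p]
    linarith
  have hterm : ∀ i, F * (k ^ 2 * w i ^ 2 / Λ - k * (1 / l + 6 * P / (l * u₀)))
      ≤ F * (k ^ 2 * w i ^ 2 - k * t) / τ i + ((1 - g) * dirDeriv (b i.succ) H (b 0) ^ 2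
        - 6 * |dirDeriv (b i.succ) H (b 0) * (F * (k * w i))| / τ i) / H (b 0) := by
    intro i
    have hmem : (b 0, b i.succ) ∈ unitTangent n :=
      ⟨hb.1 _, hb.1 _, hb.2 (Fin.succ_ne_zero i).symm⟩
    obtain ⟨b1, b2, b3, b4⟩ := hbd _ hmem
    have hτi : fderiv ℝ (fderiv ℝ H) (b 0) (b i.succ) (b i.succ) = τ i := by
      rw [← hH.smooth.dirDeriv_dirDeriv _ _ hθ0, hd, if_pos rfl]
    simp only [hτi] at b1 b2
    have hτ0 := hτ i
    set u := H (b 0)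
    simp only at b3 b4
    have hu : 0 < u := hu₀.trans_le b3
    have hpi : |dirDeriv (b i.succ) H (b 0)| ≤ P := b4
    set pi := dirDeriv (b i.succ) H (b 0)
    have hwi : |w i| ≤ 1 := by
      have := abs_real_inner_le_norm (b i.succ) p
      rwa [hb.1, hp, one_mul] at this
    have hti : t ≤ 1 := by
      have := real_inner_le_norm (b 0) p
      rwa [hb.1, hp, one_mul] at this
    have c1 : k ^ 2 * w i ^ 2 / Λ ≤ k ^ 2 * w i ^ 2 / τ i := by gcongr
    have c2 : k * t / τ i ≤ k / l := by
      calc k * t / τ i ≤ k * 1 / τ i := by gcongr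
        _ ≤ k / l := by rw [mul_one]; gcongr
    have c3 : 6 * |pi * (F * (k * w i))| / τ i / u ≤ F * (k * (6 * P / (l * u₀))) := by
      have : |pi * (F * (k * w i))| ≤ P * (F * k) := by
        rw [abs_mul, abs_mul F, abs_mul k, abs_of_pos hF0, abs_of_pos hk0]
        have : F * (k * |w i|) ≤ F * k := by
          have := mul_le_mul_of_nonneg_left hwi (mul_pos hF0 hk0).le
          linarith
        gcongr
      calc _ ≤ 6 * (P * (F * k)) / l / u₀ := by gcongr
        _ = _ := by field_simp
    have c4 : 0 ≤ (1 - g) * pi ^ 2 / u := by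
      have := sub_nonneg.2 hg1.le
      positivity
    calc F * (k ^ 2 * w i ^ 2 / Λ - k * (1 / l + 6 * P / (l * u₀)))
        = F * (k ^ 2 * w i ^ 2 / Λ - k / l) - F * (k * (6 * P / (l * u₀))) := by ring
      _ ≤ F * (k ^ 2 * w i ^ 2 / τ i - k * t / τ i) - 6 * |pi * (F * (k * w i))| / τ i / u := by
        gcongr
      _ ≤ _ := by
        rw [sub_div]
        have : F * (k ^ 2 * w i ^ 2 - k * t) / τ i
          = F * (k ^ 2 * w i ^ 2 / τ i - k * t / τ i) := by ring
        rw [this]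
        linarith
  have h2 := (Finset.sum_le_sum fun i (_ : i ∈ Finset.univ) => hterm i).trans h1
  rw [← Finset.mul_sum, Finset.sum_sub_distrib, ← Finset.sum_div, ← Finset.mul_sum, hwsum] at h2
  simp only [Finset.sum_const, Finset.card_univ, Fintype.card_fin, nsmul_eq_mul] at h2
  have h3 : k ^ 2 * (1 - t ^ 2) / Λ - k * D ≤ 0 := by
    have := nonpos_of_mul_nonpos_right h2 hF0
    rw [hD]; linarith
  have h4 : k * (D + 1) ≤ k ^ 2 * (1 - t ^ 2) / Λ := by
    have : k * (D + 1) = k ^ 2 * δ / Λ := by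
      have : k * δ = Λ * (D + 1) := by rw [hk]; field_simp
      rw [pow_two, mul_assoc, this]; field_simp
    rw [this]; gcongr
  linarith

/-- The strong maximum principle: the largest curvature gap is attained over every point. -/
theorem forall_exists_isMaxOn (hH : IsShrinkerSupport n β H) (hn : 2 ≤ n) {g : ℝ} (hg0 : 0 < g)
    (hg1 : g < 1) (hβ : β = n * (1 - g)) {θ : Euc (n + 1)} (hθ : ‖θ‖ = 1) :
    ∃ e, (θ, e) ∈ unitTangent n ∧
      ∀ z ∈ unitTangent n, curvatureGap g H z ≤ curvatureGap g H (θ, e) := by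
  have hc := isCompact_unitTangent n
  have hcont := hH.continuousOn_curvatureGap g
  have hne : (unitTangent n).Nonempty := by
    obtain ⟨e, he⟩ := exists_unitTangent (n := n) (by omega) hθ
    exact ⟨_, he⟩
  obtain ⟨zm, hzm, hzmax⟩ := hc.exists_isMaxOn hne hcont
  set M := curvatureGap g H zm with hM
  have hzmax' : ∀ z ∈ unitTangent n, curvatureGap g H z ≤ M := fun z hz => hzmax hz
  by_contra hcon
  have hno : ∀ e, (θ, e) ∈ unitTangent n → curvatureGap g H (θ, e) ≠ M := by
    intro e he h
    exact hcon ⟨e, he, fun z hz => h ▸ hzmax' z hz⟩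
  -- The pole `p` must miss the projected maximum set, which must contain a point other than `-p`.
  -- The choice `p = θ` works unless all maxima lie over `-θ`; then any unit `p` orthogonal to `θ`
  -- does.
  obtain ⟨p, θ₂, e₂, hp, hz₂, hM₂, hpno, hp₂⟩ : ∃ (p θ₂ e₂ : Euc (n + 1)), ‖p‖ = 1 ∧
      (θ₂, e₂) ∈ unitTangent n ∧ curvatureGap g H (θ₂, e₂) = M ∧
      (∀ e, (p, e) ∈ unitTangent n → curvatureGap g H (p, e) ≠ M) ∧ θ₂ ≠ -p := by
    by_cases h : ∃ z ∈ unitTangent n, curvatureGap g H z = M ∧ z.1 ≠ -θ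
    · obtain ⟨z, hz, h1, h2⟩ := h
      exact ⟨θ, z.1, z.2, hθ, hz, h1, hno, h2⟩
    · push Not at h
      obtain ⟨p, hp⟩ := exists_unitTangent (n := n) (by omega) hθ
      have hpne : p ≠ -θ := by
        rintro rfl
        have := hp.2.2
        simp [hθ] at this
      refine ⟨p, zm.1, zm.2, hp.2.1, hzm, rfl, fun e he h1 => hpne (h _ he h1), ?_⟩
      rw [h zm hzm rfl]
      intro h1
      have h2 : θ = p := neg_injective h1
      have := hp.2.2
      rw [h2] at this
      simp [hp.2.1] at this
  set t₀ := inner ℝ θ₂ p with ht₀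
  have ht₀' : -1 < t₀ := by
    by_contra! h
    refine hp₂ ?_
    have h1 : ‖θ₂ + p‖ ^ 2 ≤ 0 := by
      rw [norm_add_sq_real, hz₂.1, hp]; linarith
    have : θ₂ + p = 0 := by
      rw [← norm_eq_zero]; exact pow_eq_zero_iff two_ne_zero |>.1 (le_antisymm h1 (by positivity))
    exact eq_neg_of_add_eq_zero_left this
  -- A cap around `p` that misses the maximum set, with a quantitative gap.
  obtain ⟨t₁, ht₁, η, hη, hcap⟩ : ∃ t₁ < 1, ∃ η > 0, ∀ z ∈ unitTangent n, t₁ ≤ inner ℝ z.1 p →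
      curvatureGap g H z ≤ M - η := by
    have hΓ : IsCompact (unitTangent n ∩ curvatureGap g H ⁻¹' {M}) :=
      hc.of_isClosed_subset (hcont.preimage_isClosed_of_isClosed hc.isClosed isClosed_singleton)
        Set.inter_subset_left
    obtain ⟨zs, hzs, hzs'⟩ := hΓ.exists_isMaxOn ⟨zm, hzm, rfl⟩
      (f := fun z => inner ℝ z.1 p) (by fun_prop)
    have hs1 : inner ℝ zs.1 p < 1 := by
      have h1 := real_inner_le_norm zs.1 p
      rw [hzs.1.1, hp, one_mul] at h1
      refine lt_of_le_of_ne h1 fun h2 => ?_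
      have h3 : zs.1 = p := (inner_eq_one_iff_of_norm_eq_one hzs.1.1 hp).1 h2
      exact hpno zs.2 (h3 ▸ hzs.1) (h3 ▸ hzs.2)
    refine ⟨(1 + inner ℝ zs.1 p) / 2, by linarith, ?_⟩
    have hC : IsCompact (unitTangent n ∩ {z | (1 + inner ℝ zs.1 p) / 2 ≤ inner ℝ z.1 p}) :=
      hc.inter_right (isClosed_le continuous_const (by fun_prop))
    rcases (unitTangent n ∩ {z | (1 + inner ℝ zs.1 p) / 2 ≤ inner ℝ z.1 p}).eq_empty_or_nonempty
      with h0 | h0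
    · refine ⟨1, one_pos, fun z hz hzt => ?_⟩
      have : z ∈ unitTangent n ∩ {z | (1 + inner ℝ zs.1 p) / 2 ≤ inner ℝ z.1 p} := ⟨hz, hzt⟩
      rw [h0] at this
      exact this.elim
    · obtain ⟨zc, hzc, hzc'⟩ := hC.exists_isMaxOn h0 (hcont.mono Set.inter_subset_left)
      have hlt : curvatureGap g H zc < M := by
        refine lt_of_le_of_ne (hzmax' _ hzc.1) fun h => ?_
        have h1 : inner ℝ zc.1 p ≤ inner ℝ zs.1 p := hzs' ⟨hzc.1, h⟩
        have h2 : (1 + inner ℝ zs.1 p) / 2 ≤ inner ℝ zc.1 p := hzc.2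
        linarith
      refine ⟨M - curvatureGap g H zc, by linarith, fun z hz hzt => ?_⟩
      have : curvatureGap g H z ≤ curvatureGap g H zc := hzc' ⟨hz, hzt⟩
      linarith
  -- For `t₀ ≤ t < t₁` the number `1 - t ^ 2 = (1 - t) * (1 + t)` exceeds this product, so the
  -- perturbed maximum cannot lie in that zone. Below `t₀` it is beaten by the value over `θ₂`, and
  -- above `t₁` by the cap gap.
  have hδ : 0 < (1 - t₁) * (1 + t₀) := mul_pos (by linarith) (by linarith)
  obtain ⟨k, hk, hsteep⟩ := hH.exists_steep hn hg0 hg1 hβ hδ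
  -- The barrier is at most `ε * exp k = η` on the unit sphere, so it cannot make up for the loss
  -- `η` on the cap.
  set ε := η / Real.exp k with hε
  have hε0 : 0 < ε := by positivity
  have hεk : ε * Real.exp k = η := by rw [hε]; field_simp
  have hbc : ContinuousOn (fun z : Euc (n + 1) × Euc (n + 1) => barrier ε k p z.1)
      (unitTangent n) := by
    refine ContinuousOn.congr (f := fun z : Euc (n + 1) × Euc (n + 1) =>
      ε * Real.exp (k * inner ℝ z.1 p)) (by fun_prop) fun z hz => barrier_of_norm_one _ _ _ hz.1
  obtain ⟨z, hz, hzm'⟩ := hc.exists_isMaxOn hne (hcont.add hbc)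
  have hmax : ∀ z' ∈ unitTangent n, curvatureGap g H z' + barrier ε k p z'.1
        ≤ curvatureGap g H z + barrier ε k p z.1 := fun z' hz' => hzm' hz'
  have h1 := hsteep ε hε0 p hp z hz hmax
  set t := inner ℝ z.1 p
  have h2 := hmax _ hz₂
  rw [hM₂, barrier_of_norm_one _ _ _ hz.1, barrier_of_norm_one _ _ _ hz₂.1] at h2
  have ht0 : t₀ ≤ t := by
    have h3 := hzmax' z hz
    have h4 : Real.exp (k * t₀) ≤ Real.exp (k * t) := by
      have : ε * Real.exp (k * t₀) ≤ ε * Real.exp (k * t) := by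
        change M + ε * Real.exp (k * t₀) ≤ curvatureGap g H z + ε * Real.exp (k * t) at h2
        linarith
      exact le_of_mul_le_mul_left this hε0
    exact le_of_mul_le_mul_left (Real.exp_le_exp.1 h4) hk
  have ht_le : t ≤ 1 := by
    have := real_inner_le_norm z.1 p
    rwa [hz.1, hp, one_mul] at this
  have ht1 : t < t₁ := by
    by_contra! h
    have h3 := hcap z hz h
    have h4 : ε * Real.exp (k * t) ≤ η := by
      rw [← hεk]
      gcongr
      nlinarith
    have h5 : 0 < ε * Real.exp (k * t₀) := by positivity
    change M + ε * Real.exp (k * t₀) ≤ curvatureGap g H z + ε * Real.exp (k * t) at h2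
    linarith
  nlinarith

/-- Over every `θ` there is a maximum of the unperturbed gap; the inequality with `B = 0` makes a
sum of nonnegative multiples of the squared tangential derivatives nonpositive. Only the radial
derivative is left, and Euler's relation gives its value `H θ`. -/
theorem norm_fderiv_sq (hH : IsShrinkerSupport n β H) (hn : 2 ≤ n) {g : ℝ} (hg0 : 0 < g)
    (hg1 : g < 1) (hβ : β = n * (1 - g)) {θ : Euc (n + 1)} (hθ : ‖θ‖ = 1) :
    ‖fderiv ℝ H θ‖ ^ 2 = H θ ^ 2 := by
  obtain ⟨e, he, hmax⟩ := hH.forall_exists_isMaxOn hn hg0 hg1 hβ hθ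
  obtain ⟨b, τ, hb, hbz, hτ, -, hineq⟩ :=
    hH.inequality_of_isMax hn hg0 hg1 hβ (B := fun _ => 0) (fun c _ x _ => by simp) he
      (fun z hz => by simpa using hmax z hz)
  have h1 := hineq (fun _ => 0) (fun _ => 0) fun i => HasJet.const 0
  have hθ0 : b 0 ≠ 0 := hb.ne_zero 0
  have hu := hH.pos _ hθ0
  simp only at hbz
  subst hbz
  have hnn : ∀ i : Fin n, 0 ≤ (1 - g) * dirDeriv (b i.succ) H (b 0) ^ 2 / H (b 0) := fun i => by
    have := sub_nonneg.2 hg1.le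
    positivity
  simp only [zero_div, mul_zero, abs_zero, sub_zero, zero_add] at h1
  have h2 := (Finset.sum_eq_zero_iff_of_nonneg fun i _ => hnn i).1
    (le_antisymm h1 (Finset.sum_nonneg fun i _ => hnn i))
  have h3 : ∀ i : Fin n, fderiv ℝ H (b 0) (b i.succ) ^ 2 = 0 := by
    intro i
    have h4 := h2 i (Finset.mem_univ i)
    have h5 : (1 - g) ≠ 0 := (sub_pos.2 hg1).ne'
    rw [div_eq_zero_iff, or_iff_left hu.ne', mul_eq_zero, or_iff_right h5] at h4
    exact h4
  rw [norm_sq_eq_sum_orthonormal hb]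
  simp only [h3, Finset.sum_const_zero, add_zero]
  have := hH.homog.dirDeriv_self hH.smooth hθ0
  simp only [dirDeriv, Int.cast_one, one_mul] at this
  rw [this]

end IsShrinkerSupport

/-! ### Constancy of the support function for `n ≥ 2`. -/

namespace IsShrinkerSupport

variable {n : ℕ} {β : ℝ} {H : Euc (n + 1) → ℝ}

/-- If `H` is constant on the unit sphere, the constant is `1`. -/
theorem eq_one_of_const (hH : IsShrinkerSupport n β H) (hn : 1 ≤ n) (hβ : 0 < β) {c : ℝ}
    (hc : ∀ x : Euc (n + 1), ‖x‖ = 1 → H x = c) : c = 1 := by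
  obtain ⟨b, τ, -, hb, -, hτ, -, hd, -⟩ :=
    hH.exists_frame hn (θ := (EuclideanSpace.single 0 1 : Euc (n + 1))) (by simp)
  have hθ0 : b 0 ≠ 0 := hb.ne_zero 0
  have hval : H (b 0) = c := hc _ (hb.1 0)
  have hc0 : 0 < c := hval ▸ hH.pos _ hθ0
  have hτc : ∀ i, τ i = c := by
    intro i
    have j1 := hH.smooth.hasJet_line hθ0 (b i.succ)
    rw [hd, if_pos rfl] at j1
    have hA : HasJet (fun s : ℝ => 1 + s ^ 2) 1 0 2 :=
      ((HasJet.const 1).add HasJet.id.sq).congr_jet (by norm_num) (by norm_num) (by norm_num)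
    have j2 := (hA.rpow one_pos (1 / 2)).const_mul c
    have hfun : (fun s : ℝ => H (b 0 + s • b i.succ))
        = fun s : ℝ => c * (1 + s ^ 2) ^ (1 / 2 : ℝ) := by
      funext s
      set x := b 0 + s • b i.succ
      have hx2 : ‖x‖ ^ 2 = 1 + s ^ 2 := norm_sq_line hb i s
      have hx : 0 < ‖x‖ := by
        by_contra! h
        have : ‖x‖ = 0 := le_antisymm h (norm_nonneg _)
        rw [this] at hx2
        nlinarith
      have hx0 : x ≠ 0 := norm_pos_iff.1 hx
      rw [← hx2, ← Real.sqrt_eq_rpow, Real.sqrt_sq hx.le]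
      have := hH.homog _ (inv_pos.2 hx) x hx0
      rw [hc _ (by rw [norm_smul, norm_inv, norm_norm, inv_mul_cancel₀ hx.ne']), zpow_one] at this
      rw [this]; field_simp
    rw [hfun] at j1
    have := (j1.unique j2).2.2
    simpa using this
  have h1 := hH.monge b hb (b 0) (by rw [real_inner_self_eq_norm_sq, hb.1]; norm_num)
  have h2 : (Matrix.of fun i j : Fin n => dirDeriv (b i.succ) (dirDeriv (b j.succ) H) (b 0))
      = Matrix.diagonal fun _ => c := by
    ext i j
    rw [Matrix.of_apply, hd, Matrix.diagonal_apply, hτc]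
  rw [h2, Matrix.det_diagonal, hb.1, hval] at h1
  simp only [Finset.prod_const, Finset.card_univ, Fintype.card_fin, one_pow, Real.one_rpow,
    one_mul] at h1
  rw [← Real.rpow_natCast] at h1
  have h3 : c ^ ((n : ℝ) + β) = 1 := by
    rw [Real.rpow_add hc0, h1, ← Real.rpow_add hc0]; simp
  exact (Real.rpow_left_inj hc0.le zero_le_one (by positivity)).1 (h3.trans (Real.one_rpow _).symm)

/-- `DH` is radial, so the degree zero function `H² / |x|²` has vanishing derivative on the
connected complement of the origin. -/
theorem eq_one_of_two_le (hH : IsShrinkerSupport n β H) (hn : 2 ≤ n) (hβ0 : 0 < β) (hβn : β < n)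
    {x : Euc (n + 1)} (hx : ‖x‖ = 1) : H x = 1 := by
  have hn0 : (0 : ℝ) < n := by positivity
  have hg0 : 0 < 1 - β / n := by rw [sub_pos, div_lt_one hn0]; exact hβn
  have hg1 : 1 - β / n < 1 := by have : 0 < β / n := by positivity
                                 linarith
  have hgβ : β = n * (1 - (1 - β / n)) := by field_simp; ring
  have hgrad : ∀ y : Euc (n + 1), y ≠ 0 → ∀ v, ‖y‖ ^ 2 * fderiv ℝ H y v = H y * inner ℝ y v := by
    intro y hy v
    have hr : 0 < ‖y‖ := norm_pos_iff.2 hy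
    set θ := ‖y‖⁻¹ • y with hθ_def
    have hθ1 : ‖θ‖ = 1 := by rw [norm_smul, norm_inv, norm_norm, inv_mul_cancel₀ hr.ne']
    have hθ0 : θ ≠ 0 := by intro h; simp [h] at hθ1
    have hyθ : y = ‖y‖ • θ := by rw [hθ_def, smul_smul, mul_inv_cancel₀ hr.ne', one_smul]
    have h1 : H y = ‖y‖ * H θ := by
      nth_rewrite 1 [hyθ]; rw [hH.homog _ hr θ hθ0]; simp
    have h2 : fderiv ℝ H y v = fderiv ℝ H θ v := by
      have := (hH.homog.dirDeriv hH.smooth v) _ hr θ hθ0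
      rw [← hyθ] at this
      simpa [dirDeriv] using this
    have h3 := hH.norm_fderiv_sq hn hg0 hg1 hgβ hθ1
    obtain ⟨w, hw⟩ := (InnerProductSpace.toDual ℝ (Euc (n + 1))).surjective (fderiv ℝ H θ)
    have hwv : ∀ v, fderiv ℝ H θ v = inner ℝ w v := fun v => by rw [← hw]; simp
    have h4 : inner ℝ w θ = H θ := by
      rw [← hwv]
      have := hH.homog.dirDeriv_self hH.smooth hθ0
      simpa [dirDeriv] using this
    rw [← hw, LinearIsometryEquiv.norm_map] at h3
    -- Equality case of Cauchy–Schwarz: `|w|² = H²` and `⟨w, θ⟩ = H` give `|w - H θ|² = H² - 2H² +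
    -- H² = 0`.
    have h5 : w = H θ • θ := by
      rw [← sub_eq_zero, ← norm_eq_zero, ← sq_eq_zero_iff, norm_sub_sq_real, inner_smul_right, h4,
        norm_smul, hθ1, h3, mul_one, Real.norm_eq_abs, sq_abs]
      ring
    rw [h2, hwv, h5, h1, inner_smul_left]
    have : inner ℝ y v = ‖y‖ * inner ℝ θ v := by
      nth_rewrite 1 [hyθ]; rw [inner_smul_left]; simp
    rw [this]; simp; ring
  have hconn : IsPreconnected ({0}ᶜ : Set (Euc (n + 1))) := by
    refine (isConnected_compl_singleton_of_one_lt_rank ?_ 0).isPreconnected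
    rw [← Module.finrank_eq_rank]
    simp only [finrank_euclideanSpace, Fintype.card_fin]
    exact_mod_cast (by omega : 1 < n + 1)
  have hdiff : ∀ y : Euc (n + 1), y ≠ 0 →
      HasFDerivAt (fun y => H y ^ 2 * (‖y‖ ^ 2)⁻¹) (0 : Euc (n + 1) →L[ℝ] ℝ) y := by
    intro y hy
    have h1 := (hH.smooth.differentiableAt hy).hasFDerivAt.pow 2
    have h2 := (hasStrictFDerivAt_norm_sq y).hasFDerivAt
    have hy2 : ‖y‖ ^ 2 ≠ 0 := by positivity
    have := h1.mul ((hasDerivAt_inv hy2).comp_hasFDerivAt y h2)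
    refine this.congr_fderiv ?_
    ext v
    have h3 := hgrad y hy v
    simp only [_root_.smul_apply, _root_.add_apply, smul_eq_mul, innerSL_apply_apply,
      _root_.zero_apply, nsmul_eq_mul, Nat.cast_ofNat, Nat.add_one_sub_one, pow_one,
      Function.comp_apply]
    field_simp
    linear_combination 2 * H y * h3
  have hconst : ∀ y z : Euc (n + 1), ‖y‖ = 1 → ‖z‖ = 1 → H y = H z := by
    intro y z hy hz
    have hy0 : y ≠ 0 := by intro h; simp [h] at hy
    have hz0 : z ≠ 0 := by intro h; simp [h] at hz
    have := isOpen_compl_singleton.is_const_of_fderiv_eq_zero (𝕜 := ℝ) hconn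
      (f := fun y => H y ^ 2 * (‖y‖ ^ 2)⁻¹)
      (fun y hy => (hdiff y hy).differentiableAt.differentiableWithinAt)
      (fun y hy => (hdiff y hy).fderiv) (x := y) (y := z) hy0 hz0
    simp only [hy, hz, one_pow, inv_one, mul_one] at this
    exact (sq_eq_sq₀ (hH.pos y hy0).le (hH.pos z hz0).le).1 this
  exact hH.eq_one_of_const (by omega) hβ0 fun y hy => hconst y x hy hx

end IsShrinkerSupport

/-! ### The plane case, `n = 1`. -/

section Wirtinger

open MeasureTheory intervalIntegral

/-- Wirtinger's inequality for periodic functions of mean zero. -/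
theorem wirtinger {f f' : ℝ → ℂ} (hf : ∀ t, HasDerivAt f (f' t) t) (hf' : Continuous f')
    (hper : f (2 * Real.pi) = f 0) (hmean : ∫ t in (0 : ℝ)..(2 * Real.pi), f t = 0) :
    ∫ t in (0 : ℝ)..(2 * Real.pi), ‖f t‖ ^ 2 ≤ ∫ t in (0 : ℝ)..(2 * Real.pi), ‖f' t‖ ^ 2 := by
  have hab : (0 : ℝ) < 2 * Real.pi := by positivity
  have hfc : Continuous f := continuous_iff_continuousAt.2 fun t => (hf t).continuousAt
  have hL2 : ∀ g : ℝ → ℂ, Continuous g →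
      MemLp g 2 (volume.restrict (Set.Ioc 0 (2 * Real.pi))) := by
    intro g hg
    obtain ⟨C, hC⟩ := (isCompact_Icc (a := (0 : ℝ)) (b := 2 * Real.pi)).exists_bound_of_continuousOn
      hg.continuousOn
    refine MemLp.of_bound hg.aestronglyMeasurable C ?_
    filter_upwards [ae_restrict_mem measurableSet_Ioc] with t ht
    exact hC t ⟨ht.1.le, ht.2⟩
  have s1 := hasSum_sq_fourierCoeffOn hab (hL2 f hfc)
  have s2 := hasSum_sq_fourierCoeffOn hab (hL2 f' hf')
  have hle : ∀ i : ℤ, ‖fourierCoeffOn hab f i‖ ^ 2 ≤ ‖fourierCoeffOn hab f' i‖ ^ 2 := by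
    intro i
    by_cases hi : i = 0
    · subst hi
      rw [fourierCoeffOn_eq_integral]
      simp [hmean]
    -- For nonzero `i`, integration by parts multiplies the norm of the coefficient of `f` by `|i| ≥
    -- 1` to give that of `f'`; Parseval then compares the two integrals.
    · rw [fourierCoeffOn_of_hasDerivAt hab hi (fun x _ => hf x) (hf'.intervalIntegrable _ _), hper]
      have h1 : (1 : ℝ) ≤ |(i : ℝ)| := by exact_mod_cast Int.one_le_abs hi
      have e : ‖1 / (-2 * (Real.pi : ℂ) * Complex.I * i) * (fourier (-i)
          ((0 : ℝ) : AddCircle (2 * Real.pi - 0)) * (f 0 - f 0)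
          - (((2 * Real.pi : ℝ) : ℂ) - ((0 : ℝ) : ℂ)) * fourierCoeffOn hab f' i)‖
          = ‖fourierCoeffOn hab f' i‖ / |(i : ℝ)| := by
        rw [sub_self, mul_zero, zero_sub, norm_mul, norm_neg, norm_mul]
        simp only [Complex.ofReal_zero, sub_zero, norm_div, norm_mul, norm_neg, Complex.norm_I,
          norm_one, Complex.norm_real, Complex.norm_intCast, Real.norm_eq_abs, mul_one,
          abs_of_pos Real.pi_pos, Nat.abs_ofNat]
        simp only [Complex.norm_ofNat]
        have := Real.pi_pos
        have : (0 : ℝ) < |(i : ℝ)| := by linarith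
        field_simp
      rw [e]
      gcongr
      exact div_le_self (norm_nonneg _) h1
  have := hasSum_le hle s1 s2
  simp only [sub_zero, smul_eq_mul] at this
  exact le_of_mul_le_mul_left this (inv_pos.2 hab)

end Wirtinger

/-- `h` is a positive `2π`-periodic solution of `h'' + h = h ^ (-β)`, the support function of a
plane shrinker. -/
structure IsPlaneShrinker (β : ℝ) (h h₁ : ℝ → ℝ) : Prop where
  pos : ∀ t, 0 < h t
  deriv : ∀ t, HasDerivAt h (h₁ t) t
  deriv₂ : ∀ t, HasDerivAt h₁ (h t ^ (-β) - h t) t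
  periodic : Function.Periodic h (2 * Real.pi)

namespace IsPlaneShrinker

variable {β : ℝ} {h h₁ : ℝ → ℝ}

theorem continuous (H : IsPlaneShrinker β h h₁) : Continuous h :=
  continuous_iff_continuousAt.2 fun t => (H.deriv t).continuousAt

theorem continuous_deriv (H : IsPlaneShrinker β h h₁) : Continuous h₁ :=
  continuous_iff_continuousAt.2 fun t => (H.deriv₂ t).continuousAt

theorem comp_add (H : IsPlaneShrinker β h h₁) (a : ℝ) :
    IsPlaneShrinker β (fun t => h (a + t)) (fun t => h₁ (a + t)) where
  pos t := H.pos _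
  deriv t := by simpa using (H.deriv (a + t)).comp_const_add a t
  deriv₂ t := by simpa using (H.deriv₂ (a + t)).comp_const_add a t
  periodic t := by
    change h (a + (t + 2 * Real.pi)) = h (a + t)
    rw [← add_assoc]; exact H.periodic _

theorem exists_lower_bound (H : IsPlaneShrinker β h h₁) : ∃ c > 0, ∀ t, c ≤ h t := by
  obtain ⟨t, -, ht⟩ := isCompact_Icc.exists_isMinOn
    (Set.nonempty_Icc.2 (show (0 : ℝ) ≤ 2 * Real.pi by positivity)) H.continuous.continuousOn
  refine ⟨h t, H.pos t, fun s => ?_⟩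
  obtain ⟨y, hy, hys⟩ := H.periodic.exists_mem_Ico₀ (by positivity) s
  rw [hys]
  exact ht ⟨hy.1, hy.2.le⟩

theorem exists_lipschitzOnWith_field {β c : ℝ} (hβ : 0 < β) (hc : 0 < c) :
    ∃ K, LipschitzOnWith K (fun y : ℝ × ℝ => (y.2, y.1 ^ (-β) - y.1)) {y | c ≤ y.1} := by
  have h1 : LipschitzOnWith (‖-β‖₊ * ‖c ^ (-β - 1)‖₊) (fun y : ℝ => y ^ (-β)) (Set.Ici c) := by
    refine (convex_Ici c).lipschitzOnWith_of_nnnorm_hasDerivWithin_le (f' := fun y =>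
      -β * y ^ (-β - 1)) (fun y hy => (Real.hasDerivAt_rpow_const
        (Or.inl (hc.trans_le hy).ne')).hasDerivWithinAt) fun y hy => ?_
    rw [nnnorm_mul]
    gcongr
    have hy0 : 0 < y := hc.trans_le hy
    rw [← NNReal.coe_le_coe, coe_nnnorm, coe_nnnorm, Real.norm_eq_abs, Real.norm_eq_abs,
      abs_of_pos (Real.rpow_pos_of_pos hy0 _), abs_of_pos (Real.rpow_pos_of_pos hc _)]
    exact Real.rpow_le_rpow_of_nonpos hc hy (by linarith)
  have h2 : LipschitzOnWith 1 (Prod.fst : ℝ × ℝ → ℝ) {y | c ≤ y.1} :=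
    LipschitzWith.prod_fst.lipschitzOnWith
  have h3 : LipschitzOnWith 1 (Prod.snd : ℝ × ℝ → ℝ) {y | c ≤ y.1} :=
    LipschitzWith.prod_snd.lipschitzOnWith
  exact ⟨_, h3.prodMk ((h1.comp h2 fun y hy => hy).sub h2)⟩

/-- A solution is symmetric about each of its critical points. -/
theorem symmetric (H : IsPlaneShrinker β h h₁) (hβ : 0 < β) {a : ℝ} (ha : h₁ a = 0) (t : ℝ) :
    h (a + t) = h (a - t) := by
  obtain ⟨c, hc, hle⟩ := H.exists_lower_bound
  obtain ⟨K, hK⟩ := exists_lipschitzOnWith_field hβ hc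
  -- The curve and its time reversal, with the sign of the velocity flipped, solve the same first
  -- order system and agree at `t = 0` because `h₁ a = 0`.
  have := ODE_solution_unique_univ (v := fun _ (y : ℝ × ℝ) => (y.2, y.1 ^ (-β) - y.1))
    (s := fun _ => {y | c ≤ y.1}) (K := K) (f := fun t => (h (a + t), h₁ (a + t)))
    (g := fun t => (h (a - t), -h₁ (a - t))) (t₀ := 0) (fun _ => hK)
    (fun t => ⟨(((H.comp_add a).deriv t).prodMk ((H.comp_add a).deriv₂ t)), hle _⟩)
    (fun t => ⟨?_, hle _⟩) (by simp [ha])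
  · exact congrArg Prod.fst (congrFun this t)
  · refine HasDerivAt.prodMk ?_ ?_
    · simpa using (H.deriv (a - t)).comp_const_sub a t
    · exact ((H.deriv₂ (a - t)).comp_const_sub a t).fun_neg.congr_deriv (neg_neg _)

theorem deriv_eq_zero_of_symmetric (H : IsPlaneShrinker β h h₁) {a : ℝ}
    (ha : ∀ t, h (a + t) = h (a - t)) : h₁ a = 0 := by
  have e1 : HasDerivAt (fun t => h (a + t)) (h₁ a) 0 := by
    simpa using (H.comp_add a).deriv 0
  have e2 : HasDerivAt (fun t => h (a + t)) (-h₁ a) 0 := by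
    simp only [ha]
    have := (H.deriv (a - 0)).comp_const_sub a 0
    simpa using this
  linarith [e1.unique e2]

/-- A solution critical at the origin is critical at some point of `(0, π)`. -/
theorem exists_critical (H : IsPlaneShrinker β h h₁) (hβ : 0 < β) (h0 : h₁ 0 = 0) :
    ∃ L ∈ Set.Ioo 0 Real.pi, h₁ L = 0 := by
  have hsym := H.symmetric hβ h0
  have hπ : h₁ Real.pi = 0 := by
    refine H.deriv_eq_zero_of_symmetric fun t => ?_
    have e1 := hsym (Real.pi + t)
    have e2 := H.periodic (0 - (Real.pi + t))
    rw [zero_add] at e1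
    rw [e1, ← e2]
    congr 1; ring
  -- The function is `h'' sin - h' cos`, with derivative `(h ^ (-β))' sin`. It vanishes at `0` and
  -- `π`, so Rolle's theorem yields a point of `(0, π)` where `(h ^ (-β))'`, and hence `h'`, is
  -- zero.
  have hG : ∀ t, HasDerivAt (fun t => (h t ^ (-β) - h t) * Real.sin t - h₁ t * Real.cos t)
      (-β * h t ^ (-β - 1) * h₁ t * Real.sin t) t := by
    intro t
    have e := ((((H.deriv t).rpow_const (p := -β) (Or.inl (H.pos t).ne')).sub (H.deriv t)).mul
      (Real.hasDerivAt_sin t)).sub ((H.deriv₂ t).mul (Real.hasDerivAt_cos t))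
    refine e.congr_deriv ?_
    simp only [Pi.sub_apply]
    ring
  obtain ⟨L, hL, hL'⟩ := exists_hasDerivAt_eq_zero Real.pi_pos
    (fun t _ => (hG t).continuousAt.continuousWithinAt) (by simp [h0, hπ]) fun t _ => hG t
  refine ⟨L, hL, ?_⟩
  have hs := Real.sin_pos_of_mem_Ioo hL
  have hp := Real.rpow_pos_of_pos (H.pos L) (-β - 1)
  simpa [hβ.ne', hp.ne', hs.ne'] using hL'

/-- The composition of the reflections in the critical points `0` and `L` is the translation by `2 *
L`, which is less than `2π`. -/
theorem exists_period (H : IsPlaneShrinker β h h₁) (hβ : 0 < β) (h0 : h₁ 0 = 0) :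
    ∃ L, 0 < L ∧ L < 2 * Real.pi ∧ Function.Periodic h L := by
  obtain ⟨L, hL, hL'⟩ := H.exists_critical hβ h0
  refine ⟨2 * L, by linarith [hL.1], by linarith [hL.2], fun t => ?_⟩
  have e1 := H.symmetric hβ hL' (t + L)
  have e2 := H.symmetric hβ h0 t
  rw [zero_add] at e2
  rw [e2, show t + 2 * L = L + (t + L) by ring, e1]
  congr 1; ring

theorem periodic_deriv (H : IsPlaneShrinker β h h₁) {L : ℝ} (hL : Function.Periodic h L) :
    Function.Periodic h₁ L := by
  intro t
  have e1 : HasDerivAt (fun s => h (s + L)) (h₁ (t + L)) t := (H.deriv (t + L)).comp_add_const t L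
  have e2 : (fun s => h (s + L)) = h := funext hL
  rw [e2] at e1
  exact e1.unique (H.deriv t)

theorem integral_le_zero (H : IsPlaneShrinker β h h₁) {L : ℝ} (hL0 : 0 < L)
    (hL1 : L < 2 * Real.pi) (hL : Function.Periodic h L) :
    (3 - β) * ∫ t in (0 : ℝ)..(2 * Real.pi), h t * h t ^ (-β) * h₁ t ^ 2 ≤ 0 := by
  have hL₁ := H.periodic_deriv hL
  have hper₁ := H.periodic_deriv H.periodic
  have hc := H.continuous
  have hc₁ := H.continuous_deriv
  set k : ℝ → ℝ := fun t => h t ^ (-β) with hk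
  have hkc : Continuous k := hc.rpow_const fun t => Or.inl (H.pos t).ne'
  have hkd : ∀ t, HasDerivAt k (-β * k t / h t * h₁ t) t := by
    intro t
    refine ((H.deriv t).rpow_const (p := -β) (Or.inl (H.pos t).ne')).congr_deriv ?_
    rw [Real.rpow_sub_one (H.pos t).ne']; simp only [hk]; ring
  set E : ℝ → ℂ := fun t => Complex.exp (t * Complex.I) with hE
  have hEd : ∀ t, HasDerivAt E (E t * Complex.I) t := by
    intro t
    have : HasDerivAt (fun t : ℝ => (t : ℂ) * Complex.I) Complex.I t := by
      simpa using (Complex.ofRealCLM.hasDerivAt (x := t)).mul_const Complex.I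
    exact this.cexp
  -- As a complex number, the position vector of the curve is `(h + i h') exp (i t)`; `f` is `h`
  -- times it.
  set f : ℝ → ℂ := fun t => (h t : ℂ) * (h t + h₁ t * Complex.I) * E t with hf
  set f' : ℝ → ℂ := fun t => ((h t * h₁ t : ℝ) + (h₁ t ^ 2 + h t * k t : ℝ) * Complex.I) * E t
    with hf'
  have hfd : ∀ t, HasDerivAt f (f' t) t := by
    intro t
    have d0 := (H.deriv t).ofReal_comp
    have d1 := (H.deriv₂ t).ofReal_comp
    have := (d0.mul (d0.add (d1.mul_const Complex.I))).mul (hEd t)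
    refine this.congr_deriv ?_
    simp only [hf', hk, Pi.add_apply, Pi.mul_apply]
    push_cast
    linear_combination (h t * h₁ t * E t : ℂ) * Complex.I_sq
  have hEc : Continuous E := by fun_prop
  have hfc : Continuous f := by fun_prop
  have hfc' : Continuous f' := by fun_prop
  have hE2 : ∀ t, E (t + 2 * Real.pi) = E t := by
    intro t
    simp only [hE]
    push_cast
    rw [add_mul, Complex.exp_periodic]
  have hfper : Function.Periodic f (2 * Real.pi) := fun t => by
    simp only [hf]; rw [H.periodic t, hper₁ t, hE2]
  -- Translation by the shorter period `L` multiplies `f` by `exp (i L) ≠ 1` but preserves its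
  -- integral over a period.
  have hmean : ∫ t in (0 : ℝ)..(2 * Real.pi), f t = 0 := by
    have e1 : ∫ t in (0 : ℝ)..(2 * Real.pi), f (t + L) = ∫ t in (0 : ℝ)..(2 * Real.pi), f t := by
      rw [intervalIntegral.integral_comp_add_right]
      have := hfper.intervalIntegral_add_eq (0 + L) 0
      rw [zero_add] at this ⊢
      rw [add_comm (2 * Real.pi) L, this, zero_add]
    have e2 : ∀ t, f (t + L) = Complex.exp (L * Complex.I) * f t := by
      intro t
      simp only [hf, hE]
      rw [hL t, hL₁ t]
      push_cast
      rw [add_mul, Complex.exp_add]; ring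
    simp only [e2] at e1
    rw [intervalIntegral.integral_const_mul] at e1
    have hne : Complex.exp (L * Complex.I) ≠ 1 := by
      intro h1
      obtain ⟨m, hm⟩ := Complex.exp_eq_one_iff.1 h1
      have h2 : L = m * (2 * Real.pi) := by
        have h3 : (L : ℂ) * Complex.I = ((m * (2 * Real.pi) : ℝ) : ℂ) * Complex.I := by
          rw [hm]; push_cast; ring
        exact_mod_cast mul_right_cancel₀ Complex.I_ne_zero h3
      have hm0 : (0 : ℝ) < m := by
        by_contra! hcon
        nlinarith [Real.pi_pos]
      have hm1 : (1 : ℝ) ≤ m := by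
        have : (0 : ℤ) < m := by exact_mod_cast hm0
        exact_mod_cast this
      nlinarith [Real.pi_pos]
    have : (Complex.exp (L * Complex.I) - 1) * ∫ t in (0 : ℝ)..(2 * Real.pi), f t = 0 := by
      rw [sub_mul, e1]; ring
    exact (mul_eq_zero.1 this).resolve_left (sub_ne_zero.2 hne)
  have hW := wirtinger hfd hfc' (by simpa using hfper 0) hmean
  have hEn : ∀ t, ‖E t‖ = 1 := fun t => Complex.norm_exp_ofReal_mul_I t
  have hn1 : ∀ t, ‖f t‖ ^ 2 = h t ^ 4 + h t ^ 2 * h₁ t ^ 2 := by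
    intro t
    have : (h t : ℂ) * (h t + h₁ t * Complex.I)
        = ((h t * h t : ℝ) : ℂ) + ((h t * h₁ t : ℝ) : ℂ) * Complex.I := by push_cast; ring
    simp only [hf]
    rw [norm_mul, hEn, mul_one, this, ← Complex.normSq_eq_norm_sq, Complex.normSq_add_mul_I]
    ring
  have hn2 : ∀ t, ‖f' t‖ ^ 2 = (h t * h₁ t) ^ 2 + (h₁ t ^ 2 + h t * k t) ^ 2 := by
    intro t
    simp only [hf']
    rw [norm_mul, hEn, mul_one, ← Complex.normSq_eq_norm_sq, Complex.normSq_add_mul_I]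
  simp only [hn1, hn2] at hW
  -- A periodic primitive of `|f'|² - |f|² + (3 - β) h k h'²`; integrating over a period turns
  -- Wirtinger's inequality into the claim.
  set Φ : ℝ → ℝ := fun t => h t * h₁ t ^ 3 + h t ^ 3 * h₁ t + h t ^ 2 * h₁ t * k t with hΦ
  have hΦd : ∀ t, HasDerivAt Φ ((h t * h₁ t) ^ 2 + (h₁ t ^ 2 + h t * k t) ^ 2
      - (h t ^ 4 + h t ^ 2 * h₁ t ^ 2) + (3 - β) * (h t * k t * h₁ t ^ 2)) t := by
    intro t
    have d0 := H.deriv t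
    have d1 := H.deriv₂ t
    have := ((d0.mul (d1.pow 3)).add ((d0.pow 3).mul d1)).add (((d0.pow 2).mul d1).mul (hkd t))
    refine this.congr_deriv ?_
    have := (H.pos t).ne'
    change _ = _
    simp only [Pi.mul_apply, Pi.pow_apply, Nat.cast_ofNat, Nat.add_one_sub_one, pow_one]
    change h₁ t * h₁ t ^ 3 + h t * (3 * h₁ t ^ 2 * (k t - h t)) + (3 * h t ^ 2 * h₁ t * h₁ t
      + h t ^ 3 * (k t - h t)) + ((2 * h t * h₁ t * h₁ t + h t ^ 2 * (k t - h t)) * k t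
      + h t ^ 2 * h₁ t * (-β * k t / h t * h₁ t)) = _
    field_simp
    ring
  have hint := intervalIntegral.integral_eq_sub_of_hasDerivAt (a := 0) (b := 2 * Real.pi)
    (fun t _ => hΦd t) (Continuous.intervalIntegrable (by fun_prop) _ _)
  have hΦp : Φ (2 * Real.pi) = Φ 0 := by
    have e0 := H.periodic 0
    have e1 := hper₁ 0
    rw [zero_add] at e0 e1
    simp only [hΦ, hk, e0, e1]
  rw [hΦp, sub_self, intervalIntegral.integral_add, intervalIntegral.integral_sub,
    intervalIntegral.integral_const_mul] at hint
  · linarith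
  all_goals exact Continuous.intervalIntegrable (by fun_prop) _ _

theorem deriv_eq_zero_of_critical (H : IsPlaneShrinker β h h₁) (hβ : 0 < β) (hβ3 : β < 3)
    (h0 : h₁ 0 = 0) (t : ℝ) : h₁ t = 0 := by
  obtain ⟨L, hL0, hL1, hL⟩ := H.exists_period hβ h0
  have hi := H.integral_le_zero hL0 hL1 hL
  have hc := H.continuous
  have hc₁ := H.continuous_deriv
  have hkc : Continuous fun t => h t ^ (-β) := hc.rpow_const fun t => Or.inl (H.pos t).ne'
  have hpos := H.pos
  have hnn : ∀ t, 0 ≤ h t * h t ^ (-β) * h₁ t ^ 2 := fun t => by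
    have := Real.rpow_pos_of_pos (H.pos t) (-β)
    have := H.pos t
    positivity
  have hi0 : ∫ t in (0 : ℝ)..(2 * Real.pi), h t * h t ^ (-β) * h₁ t ^ 2 ≤ 0 := by
    by_contra! hcon
    have := mul_pos (sub_pos.2 hβ3) hcon
    linarith
  obtain ⟨s, hs, hst⟩ := (H.periodic_deriv H.periodic).exists_mem_Ico₀ (by positivity) t
  rw [hst]
  by_contra hne
  have : 0 < ∫ t in (0 : ℝ)..(2 * Real.pi), h t * h t ^ (-β) * h₁ t ^ 2 := by
    refine intervalIntegral.integral_pos (by positivity) (by fun_prop) (fun t _ => hnn t)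
      ⟨s, ⟨hs.1, hs.2.le⟩, ?_⟩
    have := Real.rpow_pos_of_pos (H.pos s) (-β)
    have := H.pos s
    positivity
  linarith

/-- Plane shrinkers are round. -/
theorem deriv_eq_zero (H : IsPlaneShrinker β h h₁) (hβ : 0 < β) (hβ3 : β < 3) (t : ℝ) :
    h₁ t = 0 := by
  obtain ⟨a, -, ha⟩ := isCompact_Icc.exists_isMaxOn
    (Set.nonempty_Icc.2 (show (0 : ℝ) ≤ 2 * Real.pi by positivity)) H.continuous.continuousOn
  have hmax : IsLocalMax h a := by
    refine Eventually.of_forall fun s => ?_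
    obtain ⟨y, hy, hys⟩ := H.periodic.exists_mem_Ico₀ (by positivity) s
    rw [hys]
    exact ha ⟨hy.1, hy.2.le⟩
  have h0 : h₁ a = 0 := hmax.hasDerivAt_eq_zero (H.deriv a)
  have := (H.comp_add a).deriv_eq_zero_of_critical hβ hβ3 (by simpa using h0) (t - a)
  simpa using this

end IsPlaneShrinker

/-- The unit circle, parametrized by the angle. -/
def circlePoint (t : ℝ) : Euc (1 + 1) :=
  Real.cos t • EuclideanSpace.single 0 1 + Real.sin t • EuclideanSpace.single 1 1

/-- The unit tangent vector of the unit circle. -/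
def circleTangent (t : ℝ) : Euc (1 + 1) :=
  (-Real.sin t) • EuclideanSpace.single 0 1 + Real.cos t • EuclideanSpace.single 1 1

theorem hasDerivAt_circlePoint (t : ℝ) : HasDerivAt circlePoint (circleTangent t) t :=
  ((Real.hasDerivAt_cos t).smul_const _).add ((Real.hasDerivAt_sin t).smul_const _)

theorem hasDerivAt_circleTangent (t : ℝ) : HasDerivAt circleTangent (-circlePoint t) t := by
  have := ((Real.hasDerivAt_sin t).neg.smul_const
    (EuclideanSpace.single 0 1 : Euc (1 + 1))).add
    ((Real.hasDerivAt_cos t).smul_const (EuclideanSpace.single 1 1 : Euc (1 + 1)))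
  refine this.congr_deriv ?_
  simp only [circlePoint, neg_smul, neg_add]

theorem orthonormal_circle (t : ℝ) : Orthonormal ℝ ![circlePoint t, circleTangent t] := by
  rw [orthonormal_iff_ite]
  have := Real.sin_sq_add_cos_sq t
  intro i j
  fin_cases i <;> fin_cases j <;>
    simp [circlePoint, circleTangent, PiLp.inner_apply, Fin.sum_univ_two,
      -inner_self_eq_norm_sq_to_K] <;> nlinarith

theorem exists_circlePoint {x : Euc (1 + 1)} (hx : ‖x‖ = 1) : ∃ t, circlePoint t = x := by
  have h1 : x 0 ^ 2 + x 1 ^ 2 = 1 := by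
    have := EuclideanSpace.real_norm_sq_eq x
    rw [hx, Fin.sum_univ_two] at this
    linarith
  set z : ℂ := ⟨x 0, x 1⟩
  have hz : ‖z‖ = 1 := by
    rw [Complex.norm_def, Complex.normSq_mk, ← pow_two, ← pow_two, h1, Real.sqrt_one]
  have hz0 : z ≠ 0 := norm_ne_zero_iff.1 (by rw [hz]; exact one_ne_zero)
  refine ⟨z.arg, ?_⟩
  ext i
  fin_cases i
  · simp [circlePoint, Complex.cos_arg hz0, hz, z]
  · simp [circlePoint, Complex.sin_arg, hz, z]

namespace IsShrinkerSupport

theorem isPlaneShrinker {β : ℝ} {H : Euc (1 + 1) → ℝ} (hH : IsShrinkerSupport 1 β H) :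
    IsPlaneShrinker β (fun t => H (circlePoint t))
      (fun t => fderiv ℝ H (circlePoint t) (circleTangent t)) := by
  have hne : ∀ t, circlePoint t ≠ 0 := fun t => (orthonormal_circle t).ne_zero 0
  refine ⟨fun t => hH.pos _ (hne t), fun t => ?_, fun t => ?_, fun t => ?_⟩
  · exact (hH.smooth.differentiableAt (hne t)).hasFDerivAt.comp_hasDerivAt t
      (hasDerivAt_circlePoint t)
  · have hd : DifferentiableAt ℝ (fderiv ℝ H) (circlePoint t) :=
      ((hH.smooth _ (hne t)).fderiv_right (m := ∞) (by simp)).differentiableAt (by simp)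
    have h1 := (hd.hasFDerivAt.comp_hasDerivAt t (hasDerivAt_circlePoint t)).clm_apply
      (hasDerivAt_circleTangent t)
    refine h1.congr_deriv ?_
    have h2 := hH.homog.dirDeriv_self hH.smooth (hne t)
    have hb := orthonormal_circle t
    have hn : ‖circlePoint t‖ = 1 := hb.1 0
    have h3 := hH.monge _ hb (circlePoint t) (by
      simp only [Matrix.cons_val_zero]
      rw [real_inner_self_eq_norm_sq, hn, one_pow])
    rw [Matrix.det_fin_one, hn] at h3
    simp only [Matrix.of_apply, one_pow, Real.one_rpow, one_mul] at h3
    rw [hH.smooth.dirDeriv_dirDeriv _ _ (hne t)] at h3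
    simp only [dirDeriv, Int.cast_one, one_mul] at h2
    simp only [Fin.succ_zero_eq_one, Matrix.cons_val_one, Matrix.cons_val_zero] at h3
    simp only [map_neg, h2, ← h3, Function.comp_apply]
    ring
  · simp only [circlePoint, Real.cos_add_two_pi, Real.sin_add_two_pi]

theorem eq_one {n : ℕ} {β : ℝ} {H : Euc (n + 1) → ℝ} (hH : IsShrinkerSupport n β H) (hn : 1 ≤ n)
    (hβ0 : 0 < β) (hβn : β < n) {x : Euc (n + 1)} (hx : ‖x‖ = 1) : H x = 1 := by
  rcases hn.eq_or_lt with rfl | hn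
  · have P := hH.isPlaneShrinker
    have hβ : β < 3 := by norm_num at hβn; linarith
    have hconst : ∀ s t, H (circlePoint s) = H (circlePoint t) :=
      is_const_of_deriv_eq_zero (fun t => (P.deriv t).differentiableAt)
        fun t => (P.deriv t).deriv.trans (P.deriv_eq_zero hβ0 hβ t)
    have hc : ∀ y : Euc (1 + 1), ‖y‖ = 1 → H y = H (circlePoint 0) := by
      intro y hy
      obtain ⟨t, rfl⟩ := exists_circlePoint hy
      exact hconst _ _
    rw [hc x hx]
    exact hH.eq_one_of_const le_rfl hβ0 hc
  · exact hH.eq_one_of_two_le hn hβ0 hβn hx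

end IsShrinkerSupport

/-! ### Local parametrizations and the critical point equation. -/

section LocalGeometry

variable {n : ℕ} {S : Set (Euc (n + 1))} {V : Set (Euc n)} {φ : Euc n → Euc (n + 1)} {u : Euc n}
  {x : Euc (n + 1)}

theorem clm_apply_eq_sum {F : Type*} [NormedAddCommGroup F] [NormedSpace ℝ F] (L : Euc n →L[ℝ] F)
    (a : Euc n) : L a = ∑ i, a i • L (EuclideanSpace.single i 1) := by
  conv_lhs => rw [← (EuclideanSpace.basisFun (Fin n) ℝ).sum_repr a]
  simp

namespace IsLocalParametrization

theorem contDiffAt (hφ : IsLocalParametrization S V φ) (hu : u ∈ V) : ContDiffAt ℝ ∞ φ u :=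
  hφ.smooth.contDiffAt (hφ.isOpen.mem_nhds hu)

theorem contDiffAt_partialDeriv (hφ : IsLocalParametrization S V φ) (hu : u ∈ V) (i : Fin n) :
    ContDiffAt ℝ ∞ (partialDeriv φ i) u :=
  ((hφ.contDiffAt hu).fderiv_right (m := ∞) (by simp)).clm_apply contDiffAt_const

theorem mapsTo (hφ : IsLocalParametrization S V φ) : Set.MapsTo φ V S := by
  obtain ⟨U, -, hU⟩ := hφ.relOpen V le_rfl hφ.isOpen
  intro v hv
  exact ((Set.ext_iff.1 hU _).1 ⟨v, hv, rfl⟩).1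

theorem inner_fderiv_eq_zero (hφ : IsLocalParametrization S V φ) (hu : u ∈ V)
    (hmax : ∀ y ∈ S, inner ℝ y x ≤ inner ℝ (φ u) x) (a : Euc n) :
    inner ℝ (fderiv ℝ φ u a) x = 0 := by
  have hm : IsLocalMax (fun v => inner ℝ (φ v) x) u := by
    filter_upwards [hφ.isOpen.mem_nhds hu] with v hv using hmax _ (hφ.mapsTo hv)
  have hd := (((hφ.contDiffAt hu).differentiableAt (by simp)).hasFDerivAt).inner ℝ
    (hasFDerivAt_const x u)
  have := DFunLike.congr_fun (hm.hasFDerivAt_eq_zero hd) a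
  simpa [fderivInnerCLM_apply] using this

theorem isInteriorUnitNormal (hφ : IsLocalParametrization S V φ) (hu : u ∈ V) (hx : x ≠ 0)
    (hmax : ∀ y ∈ S, inner ℝ y x ≤ inner ℝ (φ u) x) :
    IsInteriorUnitNormal S φ u (‖x‖⁻¹ • -x) where
  norm_eq_one := by
    rw [norm_smul, norm_neg, norm_inv, norm_norm, inv_mul_cancel₀ (norm_ne_zero_iff.2 hx)]
  orthogonal i := by
    rw [inner_smul_right, inner_neg_right, partialDeriv, hφ.inner_fderiv_eq_zero hu hmax]
    simp
  inward y hy := by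
    rw [inner_smul_right, inner_neg_right, inner_sub_left]
    have := hmax y hy
    have := inv_nonneg.2 (norm_nonneg x)
    apply mul_nonneg <;> linarith

end IsLocalParametrization

theorem secondForm_smul (φ : Euc n → Euc (n + 1)) (u : Euc n) (c : ℝ) (N : Euc (n + 1)) :
    secondForm φ u (c • N) = c • secondForm φ u N := by
  ext i j
  simp [secondForm, inner_smul_right]

theorem IsClosedStrictlyConvexHypersurface.secondForm_posDef
    (hS : IsClosedStrictlyConvexHypersurface S) (hφ : IsLocalParametrization S V φ) (hu : u ∈ V)
    (hx : x ≠ 0) (hmax : ∀ y ∈ S, inner ℝ y x ≤ inner ℝ (φ u) x) :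
    (secondForm φ u (-x)).PosDef := by
  have h := (hS.posDef V φ hφ u hu _ (hφ.isInteriorUnitNormal hu hx hmax)).smul (norm_pos_iff.2 hx)
  rwa [← secondForm_smul, smul_smul, mul_inv_cancel₀ (norm_ne_zero_iff.2 hx), one_smul] at h

/-- The components of `x` in the tangent directions of `φ` at `u`. -/
def tangentialPart (φ : Euc n → Euc (n + 1)) (z : Euc (n + 1) × Euc n) : Euc n :=
  WithLp.toLp 2 fun i => inner ℝ (partialDeriv φ i z.2) z.1

theorem tangentialPart_eq_zero_iff (z : Euc (n + 1) × Euc n) :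
    tangentialPart φ z = 0 ↔ ∀ i, inner ℝ (partialDeriv φ i z.2) z.1 = 0 := by
  rw [PiLp.ext_iff]; rfl

theorem IsLocalParametrization.contDiffAt_tangentialPart (hφ : IsLocalParametrization S V φ)
    (hu : u ∈ V) : ContDiffAt ℝ ∞ (tangentialPart φ) (x, u) := by
  rw [contDiffAt_piLp]
  intro i
  exact ((hφ.contDiffAt_partialDeriv hu i).comp (x, u) contDiffAt_snd).inner ℝ contDiffAt_fst

theorem IsLocalParametrization.fderiv_tangentialPart (hφ : IsLocalParametrization S V φ)
    (hu : u ∈ V) (v : Euc (n + 1)) (a : Euc n) (i : Fin n) :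
    fderiv ℝ (tangentialPart φ) (x, u) (v, a) i
      = inner ℝ (partialDeriv φ i u) v - ∑ j, a j * secondForm φ u (-x) j i := by
  have h1 := ((hφ.contDiffAt_tangentialPart (x := x) hu).differentiableAt (by simp)).hasFDerivAt
  have h2 : HasFDerivAt (fun z => tangentialPart φ z i) _ (x, u) :=
    ((PiLp.proj 2 (fun _ : Fin n => ℝ) i : Euc n →L[ℝ] ℝ).hasFDerivAt).comp (x, u) h1
  have h3 := ((((hφ.contDiffAt_partialDeriv hu i).differentiableAt (by simp)).hasFDerivAt).comp
    (x, u) (hasFDerivAt_snd (𝕜 := ℝ) (p := (x, u)))).inner ℝ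
      (hasFDerivAt_fst (𝕜 := ℝ) (p := (x, u)))
  have := DFunLike.congr_fun (h2.unique h3) (v, a)
  refine this.trans ?_
  have e : ∑ j, a j * secondForm φ u (-x) j i
      = -inner ℝ (fderiv ℝ (partialDeriv φ i) u a) x := by
    rw [clm_apply_eq_sum, sum_inner, ← Finset.sum_neg_distrib]
    refine Finset.sum_congr rfl fun j _ => ?_
    simp [secondForm, partialDeriv₂, inner_smul_left]
  rw [e]
  simp [fderivInnerCLM_apply]

/-- In `u`, the derivative of the tangential part is minus the second fundamental form with respect
to `-x`. Definiteness makes it invertible, and the implicit function theorem solves for `u`. -/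
theorem IsLocalParametrization.exists_implicit (hφ : IsLocalParametrization S V φ) (hu : u ∈ V)
    (hcrit : ∀ i, inner ℝ (partialDeriv φ i u) x = 0) (hpd : (secondForm φ u (-x)).PosDef) :
    ∃ ψ : Euc (n + 1) → Euc n, ψ x = u ∧ ContDiffAt ℝ ∞ ψ x ∧
      ∀ᶠ z in 𝓝 (x, u), (∀ i, inner ℝ (partialDeriv φ i z.2) z.1 = 0) ↔ ψ z.1 = z.2 := by
  have hc := hφ.contDiffAt_tangentialPart (x := x) hu
  set L := fderiv ℝ (tangentialPart φ) (x, u) ∘L .inr ℝ (Euc (n + 1)) (Euc n) with hL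
  have hinj : Function.Injective L := by
    rw [injective_iff_map_eq_zero]
    intro a ha
    by_contra hne
    have h0 : (WithLp.ofLp a : Fin n → ℝ) ≠ 0 := fun h => hne (by ext i; exact congrFun h i)
    have h1 := hpd.dotProduct_mulVec_pos h0
    have h2 : ∀ i, ∑ j, a j * secondForm φ u (-x) j i = 0 := by
      intro i
      have := congrArg (fun b : Euc n => b i) ha
      simp only [hL, ContinuousLinearMap.comp_apply, ContinuousLinearMap.inr_apply,
        hφ.fderiv_tangentialPart hu, inner_zero_right, zero_sub, PiLp.zero_apply] at this
      linarith
    rw [Matrix.dotProduct_mulVec] at h1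
    have h3 : Matrix.vecMul (star (WithLp.ofLp a)) (secondForm φ u (-x)) = 0 := by
      funext i
      simpa [Matrix.vecMul, dotProduct] using h2 i
    rw [h3] at h1
    simp at h1
  have hinv : L.IsInvertible := by
    refine ⟨(LinearEquiv.ofBijective L.toLinearMap
      ⟨hinj, LinearMap.injective_iff_surjective.1 hinj⟩).toContinuousLinearEquiv, ?_⟩
    ext a : 1
    rfl
  refine ⟨hc.implicitFunction (by simp) hinv, hc.implicitFunction_apply_self (by simp) hinv,
    hc.contDiffAt_implicitFunction (by simp) hinv, ?_⟩
  filter_upwards [hc.eventually_apply_eq_iff_implicitFunction (by simp) hinv] with z hz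
  rw [← hz, (tangentialPart_eq_zero_iff (x, u)).2 hcrit, tangentialPart_eq_zero_iff]

end LocalGeometry

/-! ### Support points: uniqueness and smooth dependence. -/

/-- `p` maximizes the linear functional `⟨·, x⟩` on `C`. -/
structure IsSupportPoint {d : ℕ} (C : Set (Euc d)) (x p : Euc d) : Prop where
  mem : p ∈ C
  le : ∀ y ∈ C, inner ℝ y x ≤ inner ℝ p x

theorem _root_.IsCompact.exists_isSupportPoint {d : ℕ} {C : Set (Euc d)} (hC : IsCompact C)
    (hne : C.Nonempty) (x : Euc d) : ∃ p, IsSupportPoint C x p := by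
  obtain ⟨p, hp, hmax⟩ := hC.exists_isMaxOn hne
    (f := fun y => inner ℝ y x) (by fun_prop)
  exact ⟨p, hp, fun y hy => hmax hy⟩

namespace IsSupportPoint

theorem mem_frontier {d : ℕ} {C : Set (Euc d)} {x p : Euc d} (hp : IsSupportPoint C x p)
    (hx : x ≠ 0) : p ∈ frontier C := by
  refine ⟨subset_closure hp.mem, fun hint => ?_⟩
  have hc : ContinuousAt (fun t : ℝ => p + t • x) 0 := by fun_prop
  have h1 : ∀ᶠ t : ℝ in 𝓝 0, p + t • x ∈ C :=
    hc.eventually_mem (by simpa using mem_interior_iff_mem_nhds.1 hint)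
  obtain ⟨t, ht, ht0⟩ := ((h1.filter_mono nhdsWithin_le_nhds).and
    (self_mem_nhdsWithin (a := (0 : ℝ)) (s := Set.Ioi 0))).exists
  have h2 := hp.le _ ht
  rw [inner_add_left, inner_smul_left, real_inner_self_eq_norm_sq] at h2
  have := mul_pos ht0 (pow_pos (norm_pos_iff.2 hx) 2)
  simp at h2
  nlinarith

theorem add_smul {d : ℕ} {C : Set (Euc d)} {x p q : Euc d} (hC : Convex ℝ C)
    (hp : IsSupportPoint C x p) (hq : IsSupportPoint C x q) {t : ℝ} (ht0 : 0 ≤ t) (ht1 : t ≤ 1) :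
    IsSupportPoint C x (p + t • (q - p)) where
  mem := hC.add_smul_sub_mem hp.mem hq.mem ⟨ht0, ht1⟩
  le y hy := by
    have h1 := hp.le q hq.mem
    have h2 := hq.le p hp.mem
    rw [inner_add_left, inner_smul_left, inner_sub_left, le_antisymm h1 h2, sub_self, mul_zero,
      add_zero, ← le_antisymm h1 h2]
    exact hq.le y hy

variable {n : ℕ} {S C : Set (Euc (n + 1))} {x p : Euc (n + 1)}

/-- Every support point is a critical point of the height function, so near `p` it is given by the
implicit solution. Support points outside `U` are not excluded yet. -/
theorem exists_local_implicit (hS : IsClosedStrictlyConvexHypersurface S)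
    (hfr : frontier C = S) (hcl : IsClosed C) (hx : x ≠ 0) (hp : IsSupportPoint C x p) :
    ∃ V φ u, IsLocalParametrization S V φ ∧ u ∈ V ∧ φ u = p ∧
      ∃ ψ : Euc (n + 1) → Euc n, ψ x = u ∧ ContDiffAt ℝ ∞ ψ x ∧
      (∀ᶠ y in 𝓝 x, ∀ i, inner ℝ (partialDeriv φ i (ψ y)) y = 0) ∧
      ∃ U, IsOpen U ∧ p ∈ U ∧ ∀ᶠ y in 𝓝 x, ∀ q ∈ U, IsSupportPoint C y q → q = φ (ψ y) := by
  obtain ⟨V, φ, hφ, u, hu, rfl⟩ := hS.smooth p (hfr ▸ hp.mem_frontier hx)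
  have hSC : S ⊆ C := hfr ▸ hcl.frontier_subset
  have hmax : ∀ y ∈ S, inner ℝ y x ≤ inner ℝ (φ u) x := fun y hy => hp.le y (hSC hy)
  obtain ⟨ψ, h1, h2, h3⟩ := hφ.exists_implicit hu
    (fun i => hφ.inner_fderiv_eq_zero hu hmax _) (hS.secondForm_posDef hφ hu hx hmax)
  refine ⟨V, φ, u, hφ, hu, rfl, ψ, h1, h2, ?_, ?_⟩
  · have ht : Tendsto (fun y => (y, ψ y)) (𝓝 x) (𝓝 (x, u)) := by
      have := (continuousAt_id (x := x)).prodMk h2.continuousAt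
      rwa [ContinuousAt, h1] at this
    filter_upwards [ht.eventually h3] with y hy using hy.2 rfl
  · rw [nhds_prod_eq, eventually_prod_iff] at h3
    obtain ⟨pa, ha, pb, hb, hab⟩ := h3
    obtain ⟨W, hWs, hW, huW⟩ := mem_nhds_iff.1 (Filter.inter_mem (hφ.isOpen.mem_nhds hu) hb)
    obtain ⟨U, hU, hUW⟩ := hφ.relOpen W (fun v hv => (hWs hv).1) hW
    refine ⟨U, hU, ((Set.ext_iff.1 hUW _).1 ⟨u, huW, rfl⟩).2, ?_⟩
    filter_upwards [ha, isOpen_ne.mem_nhds hx] with y hy hy0 q hq hqs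
    obtain ⟨v, hv, rfl⟩ := (Set.ext_iff.1 hUW q).2 ⟨hfr ▸ hqs.mem_frontier hy0, hq⟩
    rw [(hab hy (hWs hv).2).1 fun i => hφ.inner_fderiv_eq_zero (hWs hv).1
      (fun z hz => hqs.le z (hSC hz)) _]

/-- The support points in direction `x` form a convex set. A second one, `q`, would give support
points on the segment from `p` to `q` arbitrarily close to `p`, against local uniqueness. -/
theorem unique (hS : IsClosedStrictlyConvexHypersurface S) (hC : Convex ℝ C)
    (hfr : frontier C = S) (hcl : IsClosed C) (hx : x ≠ 0) (hp : IsSupportPoint C x p)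
    {q : Euc (n + 1)} (hq : IsSupportPoint C x q) : q = p := by
  obtain ⟨V, φ, u, -, -, hφu, ψ, hψ, -, -, U, hU, hpU, hev⟩ :=
    hp.exists_local_implicit hS hfr hcl hx
  have hc : ContinuousAt (fun t : ℝ => p + t • (q - p)) 0 := by fun_prop
  have h1 : ∀ᶠ t : ℝ in 𝓝 0, p + t • (q - p) ∈ U :=
    hc.eventually_mem (by simpa using hU.mem_nhds hpU)
  obtain ⟨t, ⟨ht, ht1⟩, ht0⟩ := (((h1.and (eventually_le_nhds one_pos)).filter_mono
    nhdsWithin_le_nhds).and (self_mem_nhdsWithin (a := (0 : ℝ)) (s := Set.Ioi 0))).exists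
  have h2 := hev.self_of_nhds _ ht (hp.add_smul hC hq (le_of_lt ht0) ht1)
  rw [hψ, hφu, add_eq_left, smul_eq_zero] at h2
  exact sub_eq_zero.1 (h2.resolve_left (ne_of_gt ht0))

/-- On the compact set `C \ U` the height in direction `x` is strictly below that of `p`, by
uniqueness, and this persists for nearby directions. -/
theorem eventually_mem (hS : IsClosedStrictlyConvexHypersurface S) (hC : Convex ℝ C)
    (hfr : frontier C = S) (hcpt : IsCompact C) (hx : x ≠ 0) (hp : IsSupportPoint C x p)
    {U : Set (Euc (n + 1))} (hU : IsOpen U) (hpU : p ∈ U) :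
    ∀ᶠ y in 𝓝 x, ∀ q, IsSupportPoint C y q → q ∈ U := by
  have h : ∀ᶠ y in 𝓝 x, ∀ q ∈ C \ U, inner ℝ q y < inner ℝ p y := by
    refine (hcpt.diff hU).eventually_forall_of_forall_eventually fun q hq => ?_
    have hlt : inner ℝ q x < inner ℝ p x := by
      refine lt_of_le_of_ne (hp.le q hq.1) fun heq => hq.2 ?_
      rwa [hp.unique hS hC hfr hcpt.isClosed hx ⟨hq.1, fun y hy => (hp.le y hy).trans heq.ge⟩]
    have hc : ContinuousAt (fun z : Euc (n + 1) × Euc (n + 1) => inner ℝ p z.1 - inner ℝ z.2 z.1)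
      (x, q) := by fun_prop
    filter_upwards [hc.eventually (eventually_gt_nhds (sub_pos.2 hlt))] with z hz
    exact sub_pos.1 hz
  filter_upwards [h] with y hy q hq
  by_contra hqU
  exact absurd (hq.le p hp.mem) (not_le.2 (hy q ⟨hq.mem, hqU⟩))

/-- The support point depends smoothly on the direction. -/
theorem exists_implicit (hS : IsClosedStrictlyConvexHypersurface S) (hC : Convex ℝ C)
    (hfr : frontier C = S) (hcpt : IsCompact C) (hx : x ≠ 0) (hp : IsSupportPoint C x p) :
    ∃ V φ u, IsLocalParametrization S V φ ∧ u ∈ V ∧ φ u = p ∧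
      ∃ ψ : Euc (n + 1) → Euc n, ψ x = u ∧ ContDiffAt ℝ ∞ ψ x ∧
      (∀ᶠ y in 𝓝 x, ∀ i, inner ℝ (partialDeriv φ i (ψ y)) y = 0) ∧
      ∀ᶠ y in 𝓝 x, ∀ q, IsSupportPoint C y q → q = φ (ψ y) := by
  obtain ⟨V, φ, u, h1, h2, h3, ψ, h4, h5, h6, U, hU, hpU, h7⟩ :=
    hp.exists_local_implicit hS hfr hcpt.isClosed hx
  refine ⟨V, φ, u, h1, h2, h3, ψ, h4, h5, h6, ?_⟩
  filter_upwards [h7, hp.eventually_mem hS hC hfr hcpt hx hU hpU] with y hy hyU q hq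
  exact hy q (hyU q hq) hq

end IsSupportPoint

/-! ### Gram determinants and orthogonality to the tangent space. -/

theorem inner_eq_sum_orthonormal {n : ℕ} {b : Fin (n + 1) → Euc (n + 1)}
    (hb : Orthonormal ℝ b) (v w : Euc (n + 1)) :
    inner ℝ v w = inner ℝ v (b 0) * inner ℝ w (b 0)
      + ∑ k : Fin n, inner ℝ v (b k.succ) * inner ℝ w (b k.succ) := by
  let B : OrthonormalBasis (Fin (n + 1)) ℝ (Euc (n + 1)) :=
    OrthonormalBasis.mk hb (by
      rw [hb.linearIndependent.span_eq_top_of_card_eq_finrank (by simp)])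
  have hB : ∀ i, B i = b i := fun i => by simp [B]
  rw [← B.sum_inner_mul_inner v w, Fin.sum_univ_succ]
  simp only [hB, real_inner_comm]

/-- The Gram determinant of `n` vectors orthogonal to `x`, in terms of their components in the
directions `b 1, …, b n`. -/
theorem det_gram_eq {n : ℕ} {b : Fin (n + 1) → Euc (n + 1)} (hb : Orthonormal ℝ b)
    {x : Euc (n + 1)} (hx : inner ℝ x (b 0) = 1) {e : Fin n → Euc (n + 1)}
    (he : ∀ k, inner ℝ (e k) x = 0) :
    (Matrix.of fun k l => inner ℝ (e k) (e l)).det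
      = ‖x‖ ^ 2 * (Matrix.of fun i k : Fin n => inner ℝ (e k) (b i.succ)).det ^ 2 := by
  set Q := Matrix.of fun i k : Fin n => inner ℝ (e k) (b i.succ) with hQ
  set y : Fin n → ℝ := fun i => inner ℝ x (b i.succ) with hy
  have hx2 : ‖x‖ ^ 2 = 1 + ∑ i, y i * y i := by
    rw [← real_inner_self_eq_norm_sq, inner_eq_sum_orthonormal hb, hx, one_mul]
  have h0 : ∀ k, inner ℝ (e k) (b 0) = -∑ i, y i * Q i k := by
    intro k
    have := he k
    rw [inner_eq_sum_orthonormal hb, hx, mul_one] at this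
    rw [eq_neg_iff_add_eq_zero, ← this]
    simp only [hy, hQ, Matrix.of_apply, mul_comm]
  have hG : (Matrix.of fun k l => inner ℝ (e k) (e l))
      = Q.transpose * (1 + Matrix.replicateCol Unit y * Matrix.replicateRow Unit y) * Q := by
    rw [Matrix.mul_add, Matrix.add_mul, Matrix.mul_one]
    ext k l
    have e1 : (Q.transpose * (Matrix.replicateCol Unit y * Matrix.replicateRow Unit y) * Q) k l
        = (∑ i, y i * Q i k) * ∑ i, y i * Q i l := by
      rw [← Matrix.mul_assoc, Matrix.mul_assoc]
      simp only [Matrix.mul_apply, Matrix.replicateCol_apply, Matrix.replicateRow_apply,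
        Matrix.transpose_apply, Finset.univ_unique, Finset.sum_const, Finset.card_singleton,
        one_smul, mul_comm]
    rw [Matrix.add_apply, e1, Matrix.of_apply, inner_eq_sum_orthonormal hb, h0, h0, neg_mul_neg,
      add_comm]
    rfl
  rw [hG, Matrix.det_mul, Matrix.det_mul, Matrix.det_transpose,
    Matrix.det_one_add_replicateCol_mul_replicateRow, hx2]
  simp only [dotProduct]
  ring

theorem IsLocalParametrization.linearIndependent {n : ℕ} {S : Set (Euc (n + 1))} {V : Set (Euc n)}
    {φ : Euc n → Euc (n + 1)} {u : Euc n} (hφ : IsLocalParametrization S V φ) (hu : u ∈ V) :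
    LinearIndependent ℝ fun i => partialDeriv φ i u := by
  have := (EuclideanSpace.basisFun (Fin n) ℝ).toBasis.linearIndependent.map'
    (fderiv ℝ φ u).toLinearMap (LinearMap.ker_eq_bot.2 (hφ.immersion u hu))
  have e : (fun i => partialDeriv φ i u)
      = (fderiv ℝ φ u).toLinearMap ∘ (EuclideanSpace.basisFun (Fin n) ℝ).toBasis := by
    funext i
    simp [partialDeriv]
  rw [e]
  exact this

theorem IsLocalParametrization.firstForm_posDef {n : ℕ} {S : Set (Euc (n + 1))} {V : Set (Euc n)}
    {φ : Euc n → Euc (n + 1)} {u : Euc n} (hφ : IsLocalParametrization S V φ) (hu : u ∈ V) :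
    (firstForm φ u).PosDef :=
  Matrix.posDef_gram_of_linearIndependent (hφ.linearIndependent hu)

/-- A vector orthogonal to the tangent space and to a normal vector is zero. -/
theorem IsLocalParametrization.eq_zero_of_orthogonal {n : ℕ} {S : Set (Euc (n + 1))}
    {V : Set (Euc n)} {φ : Euc n → Euc (n + 1)} {u : Euc n} (hφ : IsLocalParametrization S V φ)
    (hu : u ∈ V) {x v : Euc (n + 1)} (hx : x ≠ 0) (hφx : ∀ i, inner ℝ (partialDeriv φ i u) x = 0)
    (hφv : ∀ i, inner ℝ (partialDeriv φ i u) v = 0) (hxv : inner ℝ x v = 0) : v = 0 := by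
  by_contra hv
  have h1 : LinearIndependent ℝ ![x, v] := by
    refine linearIndependent_of_ne_zero_of_inner_eq_zero (fun i => ?_) fun i j hij => ?_
    · fin_cases i
      exacts [hx, hv]
    · fin_cases i <;> fin_cases j
      exacts [absurd rfl hij, hxv, (real_inner_comm _ _).trans hxv, absurd rfl hij]
  have hK : Module.finrank ℝ (Submodule.span ℝ (Set.range ![x, v])) = 2 := by
    rw [finrank_span_eq_card h1, Fintype.card_fin]
  have hR : Module.finrank ℝ (Submodule.span ℝ (Set.range fun i => partialDeriv φ i u)) = n := by
    rw [finrank_span_eq_card (hφ.linearIndependent hu), Fintype.card_fin]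
  have hle : Submodule.span ℝ (Set.range fun i => partialDeriv φ i u)
      ≤ (Submodule.span ℝ (Set.range ![x, v]))ᗮ := by
    rw [← Submodule.isOrtho_iff_le, Submodule.isOrtho_span]
    rintro _ ⟨i, rfl⟩ _ ⟨j, rfl⟩
    fin_cases j
    exacts [hφx i, hφv i]
  have h2 := Submodule.finrank_mono hle
  have h3 := Submodule.finrank_add_finrank_orthogonal (Submodule.span ℝ (Set.range ![x, v]))
  rw [finrank_euclideanSpace_fin] at h3
  omega

/-! ### The support function: gradient, Hessian and the Monge–Ampère equation. -/

section Support

variable {n : ℕ} {S C : Set (Euc (n + 1))} {P : Euc (n + 1) → Euc (n + 1)} {x : Euc (n + 1)}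

/-- The support point as a function of the direction, in a local parametrization. -/
theorem exists_hasFDerivAt_supportPoint (hS : IsClosedStrictlyConvexHypersurface S)
    (hC : Convex ℝ C) (hfr : frontier C = S) (hcpt : IsCompact C)
    (hP : ∀ x, IsSupportPoint C x (P x)) (hx : x ≠ 0) :
    ContDiffAt ℝ ∞ P x ∧ ∃ V φ u, IsLocalParametrization S V φ ∧ u ∈ V ∧ φ u = P x ∧
      ∃ A : Euc (n + 1) →L[ℝ] Euc n, HasFDerivAt P (fderiv ℝ φ u ∘L A) x ∧
      ∀ v i, inner ℝ (partialDeriv φ i u) v = ∑ j, A v j * secondForm φ u (-x) j i := by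
  obtain ⟨V, φ, u, hφ, hu, hφu, ψ, rfl, hψ, hcrit, hψP⟩ :=
    (hP x).exists_implicit hS hC hfr hcpt hx
  have heq : P =ᶠ[𝓝 x] φ ∘ ψ := by
    filter_upwards [hψP] with y hy using hy _ (hP y)
  have hdψ := (hψ.differentiableAt (by simp)).hasFDerivAt
  refine ⟨((hφ.contDiffAt hu).comp x hψ).congr_of_eventuallyEq heq, V, φ, ψ x, hφ, hu, hφu,
    fderiv ℝ ψ x, ?_, fun v i => ?_⟩
  · exact (((hφ.contDiffAt hu).differentiableAt (by simp)).hasFDerivAt.comp x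
      hdψ).congr_of_eventuallyEq heq
  · have h1 := (((hφ.contDiffAt_tangentialPart (x := x) hu).differentiableAt
      (by simp)).hasFDerivAt).comp x ((hasFDerivAt_id x).prodMk hdψ)
    have h2 : HasFDerivAt (tangentialPart φ ∘ fun y => (id y, ψ y))
        (0 : Euc (n + 1) →L[ℝ] Euc n) x := by
      refine (hasFDerivAt_const (0 : Euc n) x).congr_of_eventuallyEq ?_
      filter_upwards [hcrit] with y hy using (tangentialPart_eq_zero_iff (y, ψ y)).2 hy
    have h3 := congrArg (fun a : Euc n => a i) (DFunLike.congr_fun (h1.unique h2) v)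
    refine sub_eq_zero.1 ((hφ.fderiv_tangentialPart hu v (fderiv ℝ ψ x v) i).symm.trans ?_)
    simpa using h3

/-- The gradient of the support function is the support point. -/
theorem hasFDerivAt_supportFunction (hS : IsClosedStrictlyConvexHypersurface S)
    (hC : Convex ℝ C) (hfr : frontier C = S) (hcpt : IsCompact C)
    (hP : ∀ x, IsSupportPoint C x (P x)) (hx : x ≠ 0) :
    HasFDerivAt (fun x => inner ℝ (P x) x) (innerSL ℝ (P x)) x := by
  obtain ⟨-, V, φ, u, hφ, hu, hφu, A, hA, -⟩ :=
    exists_hasFDerivAt_supportPoint hS hC hfr hcpt hP hx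
  refine (hA.inner ℝ (hasFDerivAt_id x)).congr_fderiv ?_
  ext v
  have hmax : ∀ y ∈ S, inner ℝ y x ≤ inner ℝ (φ u) x := fun y hy =>
    hφu ▸ (hP x).le y (hcpt.isClosed.frontier_subset (hfr.symm ▸ hy))
  simpa [fderivInnerCLM_apply] using hφ.inner_fderiv_eq_zero hu hmax (A v)

theorem exists_hessian_supportFunction (hS : IsClosedStrictlyConvexHypersurface S)
    (hC : Convex ℝ C) (hfr : frontier C = S) (hcpt : IsCompact C)
    (hP : ∀ x, IsSupportPoint C x (P x)) (hx : x ≠ 0) :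
    ∃ V φ u, IsLocalParametrization S V φ ∧ u ∈ V ∧ φ u = P x ∧
      (∀ y ∈ S, inner ℝ y x ≤ inner ℝ (φ u) x) ∧ ∃ A : Euc (n + 1) →L[ℝ] Euc n,
      (∀ v i, inner ℝ (partialDeriv φ i u) v = ∑ j, A v j * secondForm φ u (-x) j i) ∧
      ∀ v w, fderiv ℝ (fderiv ℝ fun x => inner ℝ (P x) x) x v w
        = ∑ i, A v i * ∑ j, A w j * secondForm φ u (-x) j i := by
  obtain ⟨-, V, φ, u, hφ, hu, hφu, A, hA, hAM⟩ :=
    exists_hasFDerivAt_supportPoint hS hC hfr hcpt hP hx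
  refine ⟨V, φ, u, hφ, hu, hφu, fun y hy =>
    hφu ▸ (hP x).le y (hcpt.isClosed.frontier_subset (hfr.symm ▸ hy)), A, hAM, fun v w => ?_⟩
  have heq : (fderiv ℝ fun x => inner ℝ (P x) x) =ᶠ[𝓝 x] fun y => innerSL ℝ (P y) := by
    filter_upwards [isOpen_ne.mem_nhds hx] with y hy
    exact (hasFDerivAt_supportFunction hS hC hfr hcpt hP hy).fderiv
  have h1 := ((innerSL ℝ (E := Euc (n + 1))).hasFDerivAt.comp x hA).congr_of_eventuallyEq heq
  rw [h1.fderiv]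
  change inner ℝ (fderiv ℝ φ u (A v)) w = _
  rw [clm_apply_eq_sum, sum_inner]
  refine Finset.sum_congr rfl fun i _ => ?_
  rw [inner_smul_left, ← hAM w i]
  rfl

end Support

section Support

variable {n : ℕ} {S C : Set (Euc (n + 1))} {P : Euc (n + 1) → Euc (n + 1)} {α : ℝ}

theorem supportFunction_smoothOff (hS : IsClosedStrictlyConvexHypersurface S)
    (hC : Convex ℝ C) (hfr : frontier C = S) (hcpt : IsCompact C)
    (hP : ∀ x, IsSupportPoint C x (P x)) : SmoothOff fun x => inner ℝ (P x) x := fun _ hx =>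
  (exists_hasFDerivAt_supportPoint hS hC hfr hcpt hP hx).1.inner ℝ contDiffAt_id

/-- The shrinker equation, in terms of an outer normal vector `x` of arbitrary length. -/
theorem SatisfiesShrinkerEquation.curvature_eq (hE : SatisfiesShrinkerEquation α S) (hα : 0 < α)
    (hS : IsClosedStrictlyConvexHypersurface S) {V : Set (Euc n)} {φ : Euc n → Euc (n + 1)}
    {u : Euc n} (hφ : IsLocalParametrization S V φ) (hu : u ∈ V) {x : Euc (n + 1)} (hx : x ≠ 0)
    (hmax : ∀ y ∈ S, inner ℝ y x ≤ inner ℝ (φ u) x) :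
    0 < inner ℝ (φ u) x ∧ ‖x‖⁻¹ ^ n * (secondForm φ u (-x)).det
      = (inner ℝ (φ u) x / ‖x‖) ^ (1 / α) * (firstForm φ u).det := by
  have hr : 0 < ‖x‖ := norm_pos_iff.2 hx
  have hM := (hS.secondForm_posDef hφ hu hx hmax).det_pos
  have hg := (hφ.firstForm_posDef hu).det_pos
  have h := hE V φ hφ u hu _ (hφ.isInteriorUnitNormal hu hx hmax)
  have hK : gaussCurvature φ u (‖x‖⁻¹ • -x)
      = ‖x‖⁻¹ ^ n * (secondForm φ u (-x)).det / (firstForm φ u).det := by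
    rw [gaussCurvature, secondForm_smul, Matrix.det_smul, Fintype.card_fin]
  have hKpos : 0 < gaussCurvature φ u (‖x‖⁻¹ • -x) := by rw [hK]; positivity
  have h' : gaussCurvature φ u (‖x‖⁻¹ • -x) ^ α = inner ℝ (φ u) x / ‖x‖ := by
    rw [h, inner_smul_right, inner_neg_right]; ring
  refine ⟨?_, ?_⟩
  · have := Real.rpow_pos_of_pos hKpos α
    rw [h'] at this
    exact (div_pos_iff_of_pos_right hr).1 this
  · rw [← h', ← Real.rpow_mul hKpos.le, mul_one_div_cancel hα.ne', Real.rpow_one, hK,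
      div_mul_cancel₀ _ hg.ne']

/-- The support function of a shrinker. -/
theorem SatisfiesShrinkerEquation.isShrinkerSupport (hE : SatisfiesShrinkerEquation α S)
    (hα : 0 < α) (hS : IsClosedStrictlyConvexHypersurface S)
    (hC : Convex ℝ C) (hfr : frontier C = S) (hcpt : IsCompact C)
    (hP : ∀ x, IsSupportPoint C x (P x)) :
    IsShrinkerSupport n (1 / α) fun x => inner ℝ (P x) x where
  smooth := supportFunction_smoothOff hS hC hfr hcpt hP
  homog c hc x hx := by
    have h : IsSupportPoint C (c • x) (P x) := by
      refine ⟨(hP x).mem, fun y hy => ?_⟩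
      rw [inner_smul_right, inner_smul_right]
      exact mul_le_mul_of_nonneg_left ((hP x).le y hy) hc.le
    change inner ℝ (P (c • x)) (c • x) = c ^ (1 : ℤ) * inner ℝ (P x) x
    rw [h.unique hS hC hfr hcpt.isClosed (smul_ne_zero hc.ne' hx) (hP _), inner_smul_right,
      zpow_one]
  pos x hx := by
    obtain ⟨V, φ, u, hφ, hu, hφu, hmax, -⟩ :=
      exists_hessian_supportFunction hS hC hfr hcpt hP hx
    exact hφu ▸ (hE.curvature_eq hα hS hφ hu hx hmax).1
  hess_pos x hx v hv hxv := by
    obtain ⟨V, φ, u, hφ, hu, hφu, hmax, A, hAM, hD⟩ :=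
      exists_hessian_supportFunction hS hC hfr hcpt hP hx
    have hpd := hS.secondForm_posDef hφ hu hx hmax
    have hne : (WithLp.ofLp (A v) : Fin n → ℝ) ≠ 0 := by
      intro h0
      have h0' : ∀ j, A v j = 0 := fun j => congrFun h0 j
      refine hv (hφ.eq_zero_of_orthogonal hu hx (fun i => hφ.inner_fderiv_eq_zero hu hmax _)
        (fun i => ?_) hxv)
      rw [hAM]
      simp [h0']
    have h1 := hpd.dotProduct_mulVec_pos hne
    rw [Matrix.dotProduct_mulVec, dotProduct_comm] at h1
    rw [hD]
    simpa [dotProduct, Matrix.vecMul] using h1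
  monge b hb x hx := by
    have hx0 : x ≠ 0 := by rintro rfl; simp at hx
    have hr : 0 < ‖x‖ := norm_pos_iff.2 hx0
    obtain ⟨V, φ, u, hφ, hu, hφu, hmax, A, hAM, hD⟩ :=
      exists_hessian_supportFunction hS hC hfr hcpt hP hx0
    obtain ⟨hH, hcurv⟩ := hE.curvature_eq hα hS hφ hu hx0 hmax
    have hM := (hS.secondForm_posDef hφ hu hx0 hmax).det_pos
    have hg := (hφ.firstForm_posDef hu).det_pos
    have hgram := det_gram_eq hb hx (e := fun i => partialDeriv φ i u)
      fun i => hφ.inner_fderiv_eq_zero hu hmax _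
    set Q := Matrix.of fun i k : Fin n => inner ℝ (partialDeriv φ k u) (b i.succ) with hQ
    set a : Matrix (Fin n) (Fin n) ℝ := Matrix.of fun i k => A (b i.succ) k with ha
    have e1 : Q = a * secondForm φ u (-x) := by
      ext i k
      rw [Matrix.mul_apply]
      exact hAM _ _
    -- Since `Q = a * secondForm`, the determinant of the Hessian is `(det Q)² / det secondForm`;
    -- the Gram identity replaces `(det Q)²` by `det firstForm / ‖x‖²`.
    have e2 : (Matrix.of fun i j : Fin n => dirDeriv (b i.succ) (dirDeriv (b j.succ)
        fun x => inner ℝ (P x) x) x) = a * Q.transpose := by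
      ext i j
      rw [Matrix.mul_apply, Matrix.of_apply,
        (supportFunction_smoothOff hS hC hfr hcpt hP).dirDeriv_dirDeriv _ _ hx0, hD]
      exact Finset.sum_congr rfl fun k _ => by rw [← hAM]; rfl
    rw [e2, Matrix.det_mul, Matrix.det_transpose, ← hφu]
    have e3 : Q.det = a.det * (secondForm φ u (-x)).det := by rw [e1, Matrix.det_mul]
    change (firstForm φ u).det = _ at hgram
    -- The three factors come from normalizing the normal in the second fundamental form, from the
    -- Gram determinant, and from rewriting `H` at `x / ‖x‖`.
    have h1 : ((‖x‖ ^ 2) ^ (-(n + 2 - 1 / α) / 2) : ℝ) = ‖x‖⁻¹ ^ n * ‖x‖⁻¹ ^ 2 * ‖x‖ ^ (1 / α) := by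
      rw [← Real.rpow_natCast ‖x‖ 2, ← Real.rpow_mul hr.le, inv_pow, inv_pow,
        ← Real.rpow_natCast, ← Real.rpow_natCast, ← Real.rpow_neg hr.le, ← Real.rpow_neg hr.le,
        ← Real.rpow_add hr, ← Real.rpow_add hr]
      congr 1
      push_cast
      ring
    rw [h1, Real.rpow_neg hH.le]
    rw [Real.div_rpow hH.le hr.le] at hcurv
    have p1 := Real.rpow_pos_of_pos hH (1 / α)
    have p2 := Real.rpow_pos_of_pos hr (1 / α)
    have p3 : 0 < ‖x‖⁻¹ ^ n := by positivity
    have h2 : ‖x‖ ^ 2 * (a.det * Q.det) * (secondForm φ u (-x)).det = (firstForm φ u).det := by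
      rw [hgram, e3]; ring
    have h3 : (‖x‖⁻¹ ^ n * (‖x‖ ^ (1 / α) / inner ℝ (φ u) x ^ (1 / α)))
        * (secondForm φ u (-x)).det = (firstForm φ u).det := by
      rw [mul_right_comm, hcurv]
      field_simp
    refine mul_right_cancel₀ hM.ne' ?_
    refine mul_left_cancel₀ (pow_pos hr 2).ne' ?_
    rw [← mul_assoc, h2, ← h3]
    field_simp

/-- A closed strictly convex hypersurface whose support function is that of the unit sphere. -/
theorem eq_sphere_of_supportFunction (hS : IsClosedStrictlyConvexHypersurface S)
    (hC : Convex ℝ C) (hfr : frontier C = S) (hcpt : IsCompact C) (hint : (interior C).Nonempty)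
    (hP : ∀ x, IsSupportPoint C x (P x)) (hhom : Homog 1 fun x => inner ℝ (P x) x)
    (h : ∀ x, ‖x‖ = 1 → inner ℝ (P x) x = 1) : S = Metric.sphere 0 1 := by
  have hnorm : ∀ x, x ≠ 0 → inner ℝ (P x) x = ‖x‖ := by
    intro x hx
    have h1 := hhom _ (inv_pos.2 (norm_pos_iff.2 hx)) x hx
    simp only [zpow_one] at h1
    rw [h _ (by rw [norm_smul, norm_inv, norm_norm, inv_mul_cancel₀ (norm_ne_zero_iff.2 hx)])] at h1
    have := norm_pos_iff.2 hx
    field_simp at h1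
    exact h1.symm
  have hPx : ∀ x, ‖x‖ = 1 → P x = x := by
    intro x hx
    have hx0 : x ≠ 0 := norm_ne_zero_iff.1 (by rw [hx]; exact one_ne_zero)
    have h1 := hasFDerivAt_supportFunction hS hC hfr hcpt hP hx0
    have h2 : HasFDerivAt (fun y => inner ℝ (P y) y) (innerSL ℝ x) x := by
      -- Away from the origin the support function is the norm, whose gradient at a unit vector is
      -- that vector.
      have := (hasStrictFDerivAt_norm_sq x).hasFDerivAt.sqrt (by simp [hx])
      refine (this.congr_fderiv ?_).congr_of_eventuallyEq ?_
      · ext v; simp [hx]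
      · filter_upwards [isOpen_ne.mem_nhds hx0] with y hy
        rw [hnorm y hy, Real.sqrt_sq (norm_nonneg y)]
    have h3 := h1.unique h2
    exact ext_inner_right ℝ fun v => DFunLike.congr_fun h3 v
  ext p
  rw [mem_sphere_zero_iff_norm]
  constructor
  · intro hp
    have hpC : p ∈ C := hcpt.isClosed.frontier_subset (hfr.symm ▸ hp)
    -- A supporting functional shows that every boundary point is a support point. Separation is
    -- strict on the interior, whose nonemptiness makes `f` nonzero, and passes to `C` by closure.
    obtain ⟨f, hf⟩ := geometric_hahn_banach_open_point hC.interior isOpen_interior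
      (x := p) (by rw [← hfr] at hp; exact hp.2)
    have hfle : ∀ y ∈ C, f y ≤ f p := by
      intro y hy
      have hcl : C ⊆ closure (interior C) := by
        rw [hC.closure_interior_eq_closure_of_nonempty_interior hint]; exact subset_closure
      exact closure_minimal (t := {y | f y ≤ f p}) (fun y hy => (hf y hy).le)
        (isClosed_le f.continuous continuous_const) (hcl hy)
    obtain ⟨x, rfl⟩ := (InnerProductSpace.toDual ℝ (Euc (n + 1))).surjective f
    obtain ⟨z, hz⟩ := hint
    have hx : x ≠ 0 := by
      rintro rfl
      simpa using hf z hz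
    have hsp : IsSupportPoint C (‖x‖⁻¹ • x) p := by
      refine ⟨hpC, fun y hy => ?_⟩
      rw [inner_smul_right, inner_smul_right]
      refine mul_le_mul_of_nonneg_left ?_ (inv_nonneg.2 (norm_nonneg x))
      simpa [real_inner_comm] using hfle y hy
    have hx1 : ‖‖x‖⁻¹ • x‖ = 1 := by
      rw [norm_smul, norm_inv, norm_norm, inv_mul_cancel₀ (norm_ne_zero_iff.2 hx)]
    rw [(hP _).unique hS hC hfr hcpt.isClosed
      (smul_ne_zero (inv_ne_zero (norm_ne_zero_iff.2 hx)) hx) hsp, hPx _ hx1, hx1]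
  · intro hp
    have hp0 : p ≠ 0 := norm_ne_zero_iff.1 (by rw [hp]; exact one_ne_zero)
    have := (hP p).mem_frontier hp0
    rwa [hPx p hp, hfr] at this

end Support

/-- A shrinker is the unit sphere. -/
theorem SatisfiesShrinkerEquation.eq_sphere {n : ℕ} {S : Set (Euc (n + 1))} {α : ℝ}
    (hE : SatisfiesShrinkerEquation α S) (hS : IsClosedStrictlyConvexHypersurface S) (hn : 1 ≤ n)
    (hα : 1 / (n : ℝ) < α) : S = Metric.sphere 0 1 := by
  obtain ⟨C, hC, hcpt, hint, hfr⟩ := hS.convex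
  choose P hP using hcpt.exists_isSupportPoint (hint.mono interior_subset)
  have hn0 : (0 : ℝ) < n := by exact_mod_cast hn
  have hα0 : 0 < α := (one_div_pos.2 hn0).trans hα
  have H := hE.isShrinkerSupport hα0 hS hC hfr hcpt hP
  refine eq_sphere_of_supportFunction hS hC hfr hcpt hint hP H.homog fun x hx => ?_
  exact H.eq_one hn (one_div_pos.2 hα0) ((one_div_lt hα0 hn0).2 hα) hx

/-! ### The unit sphere is a shrinker. -/

section Sphere

variable {n : ℕ} {V : Set (Euc n)} {φ : Euc n → Euc (n + 1)} {u : Euc n}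

namespace IsLocalParametrization

theorem inner_fderiv_self_of_sphere
    (hφ : IsLocalParametrization (Metric.sphere (0 : Euc (n + 1)) 1) V φ) (hu : u ∈ V)
    (a : Euc n) : inner ℝ (fderiv ℝ φ u a) (φ u) = 0 := by
  have h1 := mem_sphere_zero_iff_norm.1 (hφ.mapsTo hu)
  refine hφ.inner_fderiv_eq_zero hu (fun y hy => ?_) a
  refine (real_inner_le_norm _ _).trans ?_
  rw [real_inner_self_eq_norm_sq, h1, mem_sphere_zero_iff_norm.1 hy]
  norm_num

/-- Differentiating `⟨∂ⱼφ, φ⟩ = 0` in the direction `i`. -/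
theorem secondForm_of_sphere
    (hφ : IsLocalParametrization (Metric.sphere (0 : Euc (n + 1)) 1) V φ) (hu : u ∈ V) :
    secondForm φ u (-φ u) = firstForm φ u := by
  ext i j
  have h1 : HasFDerivAt (fun v => inner ℝ (partialDeriv φ j v) (φ v)) (0 : Euc n →L[ℝ] ℝ) u := by
    refine (hasFDerivAt_const (0 : ℝ) u).congr_of_eventuallyEq ?_
    filter_upwards [hφ.isOpen.mem_nhds hu] with v hv using hφ.inner_fderiv_self_of_sphere hv _
  have h2 := ((hφ.contDiffAt_partialDeriv hu j).differentiableAt (by simp)).hasFDerivAt.inner ℝ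
    ((hφ.contDiffAt hu).differentiableAt (by simp)).hasFDerivAt
  have h3 := DFunLike.congr_fun (h2.unique h1) (EuclideanSpace.single i 1)
  simp only [ContinuousLinearMap.comp_apply, ContinuousLinearMap.prod_apply,
    fderivInnerCLM_apply, _root_.zero_apply] at h3
  change inner ℝ (partialDeriv φ j u) (partialDeriv φ i u)
    + inner ℝ (partialDeriv₂ φ i j u) (φ u) = 0 at h3
  rw [secondForm, firstForm, Matrix.of_apply, Matrix.of_apply, inner_neg_right,
    real_inner_comm (partialDeriv φ j u)]
  linarith

theorem normal_of_sphere
    (hφ : IsLocalParametrization (Metric.sphere (0 : Euc (n + 1)) 1) V φ) (hu : u ∈ V)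
    {N : Euc (n + 1)} (hN : IsInteriorUnitNormal (Metric.sphere 0 1) φ u N) : N = -φ u := by
  have h1 := mem_sphere_zero_iff_norm.1 (hφ.mapsTo hu)
  have h0 : φ u ≠ 0 := norm_ne_zero_iff.1 (by rw [h1]; exact one_ne_zero)
  have hw : N - (inner ℝ (φ u) N : ℝ) • φ u = 0 := by
    refine hφ.eq_zero_of_orthogonal hu h0 (fun i => hφ.inner_fderiv_self_of_sphere hu _)
      (fun i => ?_) ?_
    · rw [inner_sub_right, hN.orthogonal, inner_smul_right, partialDeriv,
        hφ.inner_fderiv_self_of_sphere hu]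
      simp
    · rw [inner_sub_right, inner_smul_right, real_inner_self_eq_norm_sq, h1]
      simp
  have hN' := sub_eq_zero.1 hw
  set c : ℝ := inner ℝ (φ u) N with hc
  have hc1 : |c| = 1 := by
    have := hN.norm_eq_one
    rwa [hN', norm_smul, h1, mul_one, Real.norm_eq_abs] at this
  -- The normal is `±φ u`; testing the inward condition at the antipodal point fixes the sign.
  have h2 := hN.inward (-φ u) (by simpa using h1)
  rw [inner_sub_left, inner_neg_left, ← hc] at h2
  rcases eq_or_eq_neg_of_abs_eq hc1 with h | h
  · linarith
  · rw [hN', h, neg_one_smul]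

end IsLocalParametrization

theorem isSmoothHypersurface_sphere :
    IsSmoothHypersurface (Metric.sphere (0 : Euc (n + 1)) 1) := by
  intro x hx
  have : Fact (Module.finrank ℝ (Euc (n + 1)) = n + 1) := ⟨finrank_euclideanSpace_fin⟩
  -- Stereographic projection from the antipode of `x`: its inverse is defined on all of `ℝ^n` and
  -- covers `x`.
  set v : Metric.sphere (0 : Euc (n + 1)) 1 := -⟨x, hx⟩ with hv
  set σ := stereographic' n v with hσ
  set U := (OrthonormalBasis.fromOrthogonalSpanSingleton (𝕜 := ℝ) n (ne_zero_of_mem_unit_sphere v)).repr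
  have ht : σ.target = Set.univ := stereographic'_target v
  have hsrc : σ.source = {v}ᶜ := stereographic'_source v
  have hxv : (⟨x, hx⟩ : Metric.sphere (0 : Euc (n + 1)) 1) ∈ σ.source := by
    rw [hsrc]
    exact (ne_neg_of_mem_unit_sphere ℝ (⟨x, hx⟩ : Metric.sphere (0 : Euc (n + 1)) 1))
  have hsmooth : ContDiff ℝ ∞ fun u => (σ.symm u : Euc (n + 1)) := by
    exact (contDiff_stereoInvFunAux (v := (v : Euc (n + 1)))).comp
      ((Submodule.subtypeL (ℝ ∙ (v : Euc (n + 1)))ᗮ).contDiff.comp U.symm.contDiff)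
  refine ⟨Set.univ, fun u => σ.symm u, ⟨isOpen_univ, hsmooth.contDiffOn, ?_, ?_, ?_⟩, σ ⟨x, hx⟩,
    trivial, ?_⟩
  · intro a _ b _ hab
    exact σ.symm.injOn (by simp [ht]) (by simp [ht]) (Subtype.ext hab)
  · intro u _
    have h1 : inner ℝ (v : Euc (n + 1)) (σ.symm u) ≠ 1 := by
      rw [Ne, inner_eq_one_iff_of_norm_eq_one (norm_eq_of_mem_sphere v)
        (norm_eq_of_mem_sphere (σ.symm u))]
      intro h
      have h2 := σ.map_target (x := u) (by simp [ht])
      rw [hsrc] at h2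
      exact h2 (Subtype.ext h.symm)
    have h2 : DifferentiableAt ℝ (fun y => U (stereoToFun (v : Euc (n + 1)) y)) (σ.symm u) :=
      U.differentiableAt.comp _ (((contDiffOn_stereoToFun (n := 1)).contDiffAt
        ((isOpen_ne_fun (innerSL ℝ (v : Euc (n + 1))).continuous continuous_const).mem_nhds
          h1)).differentiableAt one_ne_zero)
    -- Stereographic projection is a differentiable left inverse of the parametrization, so by the
    -- chain rule the derivative of the latter is injective.
    have h3 : HasFDerivAt id _ u :=
      h2.hasFDerivAt.comp u ((hsmooth.differentiable (by simp)) u).hasFDerivAt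
        |>.congr_of_eventuallyEq (Eventually.of_forall fun w => (σ.right_inv (by simp [ht])).symm)
    have h4 := h3.unique (hasFDerivAt_id u)
    exact Function.LeftInverse.injective fun a => DFunLike.congr_fun h4 a
  · intro W _ hW
    have := σ.symm.isOpen_image_of_subset_source hW (by simp [ht])
    obtain ⟨U, hU, hUW⟩ := isOpen_induced_iff.1 this
    refine ⟨U, hU, ?_⟩
    rw [← Subtype.image_preimage_coe, hUW, Set.image_image]
  · simp [σ.left_inv hxv]

/-- The unit sphere is a closed strictly convex hypersurface. -/
theorem isClosedStrictlyConvexHypersurface_sphere :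
    IsClosedStrictlyConvexHypersurface (Metric.sphere (0 : Euc (n + 1)) 1) where
  smooth := isSmoothHypersurface_sphere
  convex := ⟨Metric.closedBall 0 1, convex_closedBall 0 1, isCompact_closedBall 0 1,
    ⟨0, by rw [interior_closedBall _ one_ne_zero]; simp⟩, frontier_closedBall _ one_ne_zero⟩
  posDef V φ hφ u hu N hN := by
    rw [hφ.normal_of_sphere hu hN, hφ.secondForm_of_sphere hu]
    exact hφ.firstForm_posDef hu

/-- The unit sphere is a shrinker. -/
theorem satisfiesShrinkerEquation_sphere (α : ℝ) :
    SatisfiesShrinkerEquation α (Metric.sphere (0 : Euc (n + 1)) 1) := by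
  intro V φ hφ u hu N hN
  have h1 := mem_sphere_zero_iff_norm.1 (hφ.mapsTo hu)
  rw [hφ.normal_of_sphere hu hN, gaussCurvature, hφ.secondForm_of_sphere hu,
    div_self (hφ.firstForm_posDef hu).det_pos.ne', Real.one_rpow, inner_neg_right,
    real_inner_self_eq_norm_sq, h1]
  norm_num

end Sphere

end GaussShrinker

end

theorem theorem1 (n : ℕ) (hn : 1 ≤ n) (α : ℝ) (hα₁ : 1 / (n : ℝ) < α)
    (hα₂ : α < 1 + 1 / (n : ℝ)) (S : Set (GaussShrinker.Euc (n + 1))) :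
    (GaussShrinker.IsClosedStrictlyConvexHypersurface S ∧
        GaussShrinker.SatisfiesShrinkerEquation α S) ↔
      S = Metric.sphere (0 : GaussShrinker.Euc (n + 1)) 1 := by
  refine ⟨fun h => h.2.eq_sphere h.1 hn hα₁, ?_⟩
  rintro rfl
  exact ⟨GaussShrinker.isClosedStrictlyConvexHypersurface_sphere,
    GaussShrinker.satisfiesShrinkerEquation_sphere α⟩
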